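/- Let $\mathbb T^d=(\mathbb R/\mathbb Z)^d$, let $\mathcal M_d$ be the space of $d$-tuples of finite signed measures on $\mathbb T^d$ and $\mathcal F$ the set of measurable $\rho:\mathbb T^d\to[0,1]$, both with the weak topology (duality with continuous functions, pairing $\langle\cdot,\cdot\rangle$). Let $\gamma\in C^2(\mathbb T^d)$ satisfy $\delta\le\gamma\le 1-\delta$ for some $\delta>0$, and put $\chi(a)=a(1-a)$. For $T>0$ and a càdlàg path $\mathbf W:[0,T]\to\mathcal M_d$, let $\pi:[0,T]\to\mathcal F$ be the (a.e. unique) path with $$\mathbf W_0=0,\qquad \langle\pi_t,F\rangle-\langle\gamma,F\rangle=\langle\mathbf W_t,\nabla F\rangle\quad\text{for all }t\in[0,T],\ F\in C^1(\mathbb T^d).$$ If such a $\pi$ exists and $(\mathbf W,\pi)$ is continuous from $[0,T]$ to $\mathcal M_d\times\mathcal F$, set $$I_{[0,T]}(\mathbf W|\gamma)=\sup_{\mathbf F}\Big\{\langle\mathbf W_T,\mathbf F_T\rangle-\int_0^T\!\langle\mathbf W_t,\partial_t\mathbf F_t\rangle\,dt-\tfrac12\int_0^T\!\langle\pi_t,\nabla\cdot\mathbf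 F_t\rangle\,dt-\tfrac12\int_0^T\!\langle\chi(\pi_t),|\mathbf F_t|^2\rangle\,dt\Big\},$$ the supremum being over $\mathbf F\in C^{1,1}([0,T]\times\mathbb T^d;\mathbb R^d)$; otherwise set $I_{[0,T]}(\mathbf W|\gamma)=+\infty$. For $\mathbf J\in\mathcal M_d$ define $$\Phi_T(\mathbf J|\gamma)=\frac1T\inf\big\{I_{[0,T]}(\mathbf W|\gamma):\ \mathbf W\ \text{càdlàg},\ \mathbf W_T=T\mathbf J\big\}.$$ Let $\tilde\Phi(\mathbf J|\gamma)=\inf_{T>0}\Phi_T(\mathbf J|\gamma)$ if $\langle\mathbf J,\nabla f\rangle=0$ for all $f\in C^1(\mathbb T^d)$, and $\tilde\Phi(\mathbf J|\gamma)=+\infty$ otherwise. Let $\Phi(\cdot|\gamma)$ be the lower semicontinuous envelope of $\tilde\Phi(\cdot|\gamma)$, that is, $\Phi(\mathbf J|\gamma)=\sup_{U\ni\mathbf J}\inf_{\mathbf J'\in U}\tilde\Phi(\mathbf J'|\gamma)$ over open $U\subset\mathcal M_d$. Then $\Phi_T(\cdot|\gamma)$ $\Gamma$-converges to $\Phi(\cdot|\gamma)$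 on $\mathcal M_d$ as $T\to\infty$, that is, for every $\mathbf J\in\mathcal M_d$: 1. for every family $\mathbf J_T\to\mathbf J$ as $T\to\infty$, $\ \Phi(\mathbf J|\gamma)\le\liminf_{T\to\infty}\Phi_T(\mathbf J_T|\gamma)$; 2. there is a family $\mathbf J_T\to\mathbf J$ as $T\to\infty$ with $\ \limsup_{T\to\infty}\Phi_T(\mathbf J_T|\gamma)\le\Phi(\mathbf J|\gamma)$. -/

import Mathlib

open MeasureTheory Filter Topology Set
open scoped ENNReal

noncomputable section

namespace CurrentLD

/-! ### Calculus on the torus -/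

/-- A map on the torus `𝕋ᵈ = (ℝ/ℤ)ᵈ` is of class `Cⁿ` if its periodic lift to `ℝᵈ` is. -/
def IsCk {d : ℕ} {E : Type*} [NormedAddCommGroup E] [NormedSpace ℝ E]
    (n : ℕ) (f : UnitAddTorus (Fin d) → E) : Prop :=
  ContDiff ℝ n (fun x : Fin d → ℝ => f (fun i => (x i : UnitAddCircle)))

/-- The partial derivative `∂_{u_j} f` at `u`. -/
def partialDeriv {d : ℕ} (j : Fin d) (f : UnitAddTorus (Fin d) → ℝ)
    (u : UnitAddTorus (Fin d)) : ℝ :=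
  deriv (fun s : ℝ => f (Function.update u j (u j + (s : UnitAddCircle)))) 0

/-- The gradient `∇f`. -/
def grad {d : ℕ} (f : UnitAddTorus (Fin d) → ℝ) : UnitAddTorus (Fin d) → Fin d → ℝ :=
  fun u j => partialDeriv j f u

/-- The divergence `∇ · F`. -/
def divergence {d : ℕ} (F : UnitAddTorus (Fin d) → Fin d → ℝ) (u : UnitAddTorus (Fin d)) : ℝ :=
  ∑ j, partialDeriv j (fun v => F v j) u

/-- Time-dependent vector fields of class `C^{1,1}` on `[0,T] × 𝕋ᵈ`. -/
def IsC11 {d : ℕ} (T : ℝ) (F : ℝ → UnitAddTorus (Fin d) → Fin d → ℝ) : Prop :=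
  ContDiffOn ℝ 1
    (fun p : ℝ × (Fin d → ℝ) => F p.1 (fun i => (p.2 i : UnitAddCircle)))
    (Icc 0 T ×ˢ univ)

/-- The time derivative `∂_t F_t`, one-sided at the endpoints of `[0,T]`. -/
def timeDeriv {d : ℕ} (T : ℝ) (F : ℝ → UnitAddTorus (Fin d) → Fin d → ℝ) (t : ℝ) :
    UnitAddTorus (Fin d) → Fin d → ℝ :=
  fun u j => derivWithin (fun s => F s u j) (Icc 0 T) t

/-! ### The spaces of currents and of density profiles -/

/-- The space `M_d` of `ℝᵈ`-valued measures on the torus: `d`-tuples of finite signed measures. -/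
def Current (d : ℕ) : Type := Fin d → SignedMeasure (UnitAddTorus (Fin d))

instance (d : ℕ) : AddCommGroup (Current d) :=
  inferInstanceAs (AddCommGroup (Fin d → SignedMeasure (UnitAddTorus (Fin d))))

instance (d : ℕ) : Module ℝ (Current d) :=
  inferInstanceAs (Module ℝ (Fin d → SignedMeasure (UnitAddTorus (Fin d))))

/-- The pairing `⟨J, F⟩ = ∑ⱼ ∫ Fⱼ dJⱼ`. -/
def pair {d : ℕ} (J : Current d) (F : UnitAddTorus (Fin d) → Fin d → ℝ) : ℝ :=
  ∑ j, VectorMeasure.integral (J j) (fun u => F u j) (ContinuousLinearMap.lsmul ℝ ℝ)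

/-- The weak topology of `M_d`: the coarsest one for which `J ↦ ⟨J, F⟩` is continuous for every
continuous vector field `F`. -/
instance (d : ℕ) : TopologicalSpace (Current d) :=
  TopologicalSpace.induced
    (fun J (F : C(UnitAddTorus (Fin d), Fin d → ℝ)) => pair J F) inferInstance

/-- The space `𝓕` of measurable density profiles with values in `[0,1]`. Profiles are not
identified when they agree almost everywhere; nothing below distinguishes such profiles. -/
structure Profile (d : ℕ) where
  /-- The underlying function. -/
  toFun : UnitAddTorus (Fin d) → ℝ
  measurable : Measurable toFun
  nonneg : ∀ u, 0 ≤ toFun u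
  le_one : ∀ u, toFun u ≤ 1

/-- The pairing `⟨ρ, F⟩ = ∫ ρ F du`. -/
def dpair {d : ℕ} (ρ F : UnitAddTorus (Fin d) → ℝ) : ℝ := ∫ u, ρ u * F u

/-- The weak topology of `𝓕`. -/
instance (d : ℕ) : TopologicalSpace (Profile d) :=
  TopologicalSpace.induced
    (fun ρ (F : C(UnitAddTorus (Fin d), ℝ)) => dpair ρ.toFun F) inferInstance

/-- The mobility `χ(a) = a (1 - a)`. -/
def mobility (a : ℝ) : ℝ := a * (1 - a)

/-! ### The rate functional on `[0,T]`

Paths on `[0,T]` are functions on `ℝ` of which only the values on `[0,T]` are ever used. -/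

/-- The functional `J_F(W, π)` for a path `(W, π)` on `[0,T]` and a test field `F`. -/
def testFunctional {d : ℕ} (T : ℝ) (W : ℝ → Current d) (π : ℝ → Profile d)
    (F : ℝ → UnitAddTorus (Fin d) → Fin d → ℝ) : ℝ :=
  pair (W T) (F T)
    - (∫ t in (0 : ℝ)..T, pair (W t) (timeDeriv T F t))
    - (1 / 2) * (∫ t in (0 : ℝ)..T, dpair (π t).toFun (divergence (F t)))
    - (1 / 2) * (∫ t in (0 : ℝ)..T,
        dpair (fun u => mobility ((π t).toFun u)) (fun u => ∑ j, (F t u j) ^ 2))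

open Classical in
/-- The functional `J(W, π) = sup_F J_F(W, π)`, equal to `+∞` when `(W, π)` is not weakly
continuous on `[0,T]`. Since `F = 0` is a test field with `J_0(W, π) = 0`, the supremum of the
`J_F` is nonnegative and equals the supremum of their positive parts. -/
def dynFunctional {d : ℕ} (T : ℝ) (W : ℝ → Current d) (π : ℝ → Profile d) : ℝ≥0∞ :=
  if ContinuousOn (fun t => (W t, π t)) (Icc 0 T) then
    ⨆ (F : ℝ → UnitAddTorus (Fin d) → Fin d → ℝ) (_ : IsC11 T F),
      ENNReal.ofReal (testFunctional T W π F)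
  else ⊤

/-- The continuity equation with initial density `γ`, in weak form:
`⟨π_t, F⟩ - ⟨γ, F⟩ = ⟨W_t, ∇F⟩` for all `F ∈ C¹` and `t ∈ [0,T]`, and `W_0 = 0`. -/
def ContinuityEq {d : ℕ} (γ : UnitAddTorus (Fin d) → ℝ) (T : ℝ)
    (W : ℝ → Current d) (π : ℝ → Profile d) : Prop :=
  (∀ t ∈ Icc 0 T, ∀ F : UnitAddTorus (Fin d) → ℝ, IsCk 1 F →
    dpair (π t).toFun F - dpair γ F = pair (W t) (grad F)) ∧ W 0 = 0

open Classical in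
/-- The rate functional `I_{[0,T]}(W, π)` for the initial density `γ`. -/
def pairRate {d : ℕ} (γ : UnitAddTorus (Fin d) → ℝ) (T : ℝ)
    (W : ℝ → Current d) (π : ℝ → Profile d) : ℝ≥0∞ :=
  if ContinuityEq γ T W π then dynFunctional T W π else ⊤

/-- The functional `I_{[0,T]}(W | γ) = I_{[0,T]}(W, π)`, where `π` solves the continuity equation
driven by `W`. The solution is unique up to null sets, on which `I_{[0,T]}(W, π)` does not depend,
so the infimum only selects it; the value is `+∞` when there is none. -/
def rate {d : ℕ} (γ : UnitAddTorus (Fin d) → ℝ) (T : ℝ) (W : ℝ → Current d) : ℝ≥0∞ :=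
  ⨅ π : ℝ → Profile d, pairRate γ T W π

/-! ### Mean currents over long times -/

/-- Càdlàg paths on `[0,T]`. -/
def IsCadlag {X : Type*} [TopologicalSpace X] (T : ℝ) (x : ℝ → X) : Prop :=
  (∀ t ∈ Ico 0 T, Tendsto x (𝓝[>] t) (𝓝 (x t))) ∧
    ∀ t ∈ Ioc 0 T, ∃ l, Tendsto x (𝓝[<] t) (𝓝 l)

/-- The set `A_{T,J}` of càdlàg paths with `W_T = T J`. -/
def pathsWithMean {d : ℕ} (T : ℝ) (J : Current d) : Set (ℝ → Current d) :=
  {W | IsCadlag T W ∧ W T = T • J}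

/-- `Φ_T(J | γ) = T⁻¹ inf { I_{[0,T]}(W | γ) : W ∈ A_{T,J} }`, for `T > 0`. -/
def Phi_T {d : ℕ} (γ : UnitAddTorus (Fin d) → ℝ) (T : ℝ) (J : Current d) : ℝ≥0∞ :=
  (⨅ W ∈ pathsWithMean T J, rate γ T W) / ENNReal.ofReal T

/-- The set of divergence free currents. -/
def divFree (d : ℕ) : Set (Current d) :=
  {J | ∀ f : UnitAddTorus (Fin d) → ℝ, IsCk 1 f → pair J (grad f) = 0}

open Classical in
/-- `Φ̃(J | γ) = inf_{T > 0} Φ_T(J | γ)` on divergence free currents, and `+∞` elsewhere. -/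
def PhiTilde {d : ℕ} (γ : UnitAddTorus (Fin d) → ℝ) (J : Current d) : ℝ≥0∞ :=
  if J ∈ divFree d then ⨅ (T : ℝ) (_ : 0 < T), Phi_T γ T J else ⊤

/-- The lower semicontinuous envelope `Φ(· | γ)` of `Φ̃(· | γ)` in the weak topology. -/
def Phi {d : ℕ} (γ : UnitAddTorus (Fin d) → ℝ) (J : Current d) : ℝ≥0∞ :=
  ⨆ (U : Set (Current d)) (_ : IsOpen U ∧ J ∈ U), ⨅ J' ∈ U, PhiTilde γ J'

/-- Sequential `Γ`-convergence of `F_T` to `F` as `T → ∞`. -/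
def GammaConverges {X : Type*} [TopologicalSpace X] (FT : ℝ → X → ℝ≥0∞) (F : X → ℝ≥0∞) : Prop :=
  ∀ x : X,
    (∀ y : ℝ → X, Tendsto y atTop (𝓝 x) → F x ≤ liminf (fun T => FT T (y T)) atTop) ∧
    ∃ y : ℝ → X, Tendsto y atTop (𝓝 x) ∧ limsup (fun T => FT T (y T)) atTop ≤ F x

end CurrentLD

end

open MeasureTheory Filter Topology Set
open scoped ENNReal NNReal

noncomputable section

namespace CurrentLD

/-! The mechanism is the surgery of paths. If the total current of a path on [0,T] is divergence
free, the continuity equation forces the density at time T to be γ again, so any other path starting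
from γ can be appended; total currents and costs add (`HasCostLE.concat`).

Upper bound. Near a current J with Φ(J) = m finite there are a divergence free K and a time T₀ with
Φ_{T₀}(K) < m + ε. For large T an almost optimal path for K is repeated about T/T₀ times, and the
remaining time, which stays bounded, is spent with zero current and density γ. Standing still has
finite cost per unit time because γ is C¹ and χ(γ) is bounded below. The mean current is then a
multiple of K with factor tending to 1, and the mean cost is at most m + ε + O(1/T). A diagonal
choice over test fields and ε gives one family.

Lower bound. A path of cost at most cT with mean current J_T need not return to γ. It is modified
into one that does (`HasCostLE.exists_relaxation`). With a weight l increasing from 0 to 1, the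
density becomes π' = (1-l)π + lγ. The current becomes (1-l)W plus the time integral of l'(W + R),
where R is a bounded current solving the divergence equation with datum γ - π, so that W + R is
divergence free. Testing the new path with F amounts to testing the old one with (1-l)F, up to an
error linear in F. Concavity of χ yields a gain of order l|F|², uniform because χ(γ) ≥ κ, and this
absorbs the linear error. Absorption requires (l')² to be controlled by l, and the total price is
bounded in T if the controlling function is integrable uniformly in T; l = (t/T)ⁿ with n comparable
to T has both properties. The extra mean cost is therefore O(1/T). Testing the old path with ±√T
l(t)G shows that the mean current, paired with a C¹ field G, moves by O(T^{-1/2}).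

Compactness. Pairings with C¹ fields determine weak limits only on bounded sets of currents. For
divergence free currents a bound on the cost bounds the current in the dual of the continuous fields
(`HasCostLE.abs_pair_le`): test with a time-independent divergence free field, and reach general
fields by the Helmholtz decomposition. Hence the modified currents still converge weakly to J. They
enter every neighbourhood of J, and their Φ̃ is at most c + O(1/T), which is the bound required by
the lower semicontinuous envelope. -/

section

/-! ### Representation of bounded functionals by signed measures -/

section Riesz

open CompactlySupported Pointwise

variable {X : Type*} [TopologicalSpace X]

/-- The values of a functional on the order interval `[0, f]`. -/
def intervalValues (ℓ : C(X, ℝ) →ₗ[ℝ] ℝ) (f : C(X, ℝ)) : Set ℝ :=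
  ℓ '' Icc 0 f

lemma intervalValues_nonempty (ℓ : C(X, ℝ) →ₗ[ℝ] ℝ) {f : C(X, ℝ)} (hf : 0 ≤ f) :
    (intervalValues ℓ f).Nonempty :=
  ⟨ℓ 0, 0, ⟨le_rfl, hf⟩, rfl⟩

/-- Riesz decomposition: an element h of [0, f+g] splits as h ⊓ f in [0, f] plus a remainder in [0,
g]. This makes the positive part of a functional additive. -/
lemma intervalValues_add (ℓ : C(X, ℝ) →ₗ[ℝ] ℝ) {f g : C(X, ℝ)} (hf : 0 ≤ f) (hg : 0 ≤ g) :
    intervalValues ℓ (f + g) = intervalValues ℓ f + intervalValues ℓ g := by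
  ext x
  constructor
  · rintro ⟨h, ⟨h0, h1⟩, rfl⟩
    refine ⟨_, ⟨h ⊓ f, ⟨le_inf h0 hf, inf_le_right⟩, rfl⟩, _, ⟨h - h ⊓ f, ⟨?_, ?_⟩, rfl⟩, ?_⟩
    · exact sub_nonneg.2 inf_le_left
    · intro u
      have h2 : h u ≤ f u + g u := h1 u
      have h3 : 0 ≤ g u := hg u
      change h u - min (h u) (f u) ≤ g u
      rcases min_cases (h u) (f u) with h4 | h4 <;> linarith
    · simp
  · rintro ⟨_, ⟨a, ⟨a0, a1⟩, rfl⟩, _, ⟨b, ⟨b0, b1⟩, rfl⟩, rfl⟩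
    exact ⟨a + b, ⟨add_nonneg a0 b0, add_le_add a1 b1⟩, map_add ℓ a b⟩

lemma intervalValues_smul (ℓ : C(X, ℝ) →ₗ[ℝ] ℝ) {f : C(X, ℝ)} {c : ℝ} (hc : 0 < c) :
    intervalValues ℓ (c • f) = c • intervalValues ℓ f := by
  ext x
  constructor
  · rintro ⟨h, ⟨h0, h1⟩, rfl⟩
    refine ⟨_, ⟨c⁻¹ • h, ⟨smul_nonneg (by positivity) h0, ?_⟩, rfl⟩, ?_⟩
    · intro u
      change c⁻¹ * h u ≤ f u
      rw [inv_mul_le_iff₀ hc]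
      exact h1 u
    · simp [hc.ne']
  · rintro ⟨_, ⟨a, ⟨a0, a1⟩, rfl⟩, rfl⟩
    exact ⟨c • a, ⟨smul_nonneg hc.le a0, smul_le_smul_of_nonneg_left a1 hc.le⟩, map_smul ℓ c a⟩

variable [CompactSpace X]

lemma intervalValues_bddAbove (ℓ : C(X, ℝ) →L[ℝ] ℝ) (f : C(X, ℝ)) :
    BddAbove (intervalValues (ℓ : C(X, ℝ) →ₗ[ℝ] ℝ) f) := by
  refine ⟨‖ℓ‖ * ‖f‖, ?_⟩
  rintro _ ⟨g, ⟨g0, g1⟩, rfl⟩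
  refine (le_abs_self _).trans ((ℓ.le_opNorm g).trans ?_)
  gcongr
  refine (ContinuousMap.norm_le _ (norm_nonneg _)).2 fun u => ?_
  have h0 : 0 ≤ g u := g0 u
  have h1 : g u ≤ f u := g1 u
  rw [Real.norm_of_nonneg h0]
  exact h1.trans ((le_abs_self _).trans (f.norm_coe_le_norm u))

/-- The real valued function underlying a nonnegative continuous function. -/
def toRealMap (f : C_c(X, ℝ≥0)) : C(X, ℝ) := ⟨fun x => (f x : ℝ), by fun_prop⟩

omit [CompactSpace X] in
lemma toRealMap_nonneg (f : C_c(X, ℝ≥0)) : 0 ≤ toRealMap f := fun x => (f x).2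

/-- The positive part of a bounded functional. -/
def posPartFunctional (ℓ : C(X, ℝ) →L[ℝ] ℝ) : C_c(X, ℝ≥0) →ₗ[ℝ≥0] ℝ≥0 where
  toFun f := ⟨sSup (intervalValues (ℓ : C(X, ℝ) →ₗ[ℝ] ℝ) (toRealMap f)),
    le_csSup (intervalValues_bddAbove ℓ _) ⟨0, ⟨le_rfl, toRealMap_nonneg f⟩, by simp⟩⟩
  map_add' f g := by
    apply NNReal.eq
    have : toRealMap (f + g) = toRealMap f + toRealMap g := by ext; simp [toRealMap]
    change sSup (intervalValues (ℓ : C(X, ℝ) →ₗ[ℝ] ℝ) _) = sSup _ + sSup _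
    rw [this, intervalValues_add _ (toRealMap_nonneg f) (toRealMap_nonneg g)]
    exact csSup_add (intervalValues_nonempty _ (toRealMap_nonneg f)) (intervalValues_bddAbove ℓ _)
      (intervalValues_nonempty _ (toRealMap_nonneg g)) (intervalValues_bddAbove ℓ _)
  map_smul' c f := by
    apply NNReal.eq
    have : toRealMap (c • f) = (c : ℝ) • toRealMap f := by ext; simp [toRealMap]
    change sSup (intervalValues (ℓ : C(X, ℝ) →ₗ[ℝ] ℝ) _) = (c : ℝ) * sSup _
    rw [this]
    rcases eq_or_ne c 0 with rfl | hc
    · have : intervalValues (ℓ : C(X, ℝ) →ₗ[ℝ] ℝ) 0 = {0} := by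
        simp [intervalValues]
      simp [this]
    · rw [intervalValues_smul _ (NNReal.coe_pos.2 (pos_iff_ne_zero.2 hc))]
      exact Real.sSup_smul_of_nonneg (NNReal.coe_nonneg c) _

/-- The negative part of a bounded functional. -/
def negPartFunctional (ℓ : C(X, ℝ) →L[ℝ] ℝ) : C_c(X, ℝ≥0) →ₗ[ℝ≥0] ℝ≥0 where
  toFun f := ⟨posPartFunctional ℓ f - ℓ (toRealMap f), sub_nonneg.2
    (le_csSup (intervalValues_bddAbove ℓ _) ⟨toRealMap f, ⟨toRealMap_nonneg f, le_rfl⟩, rfl⟩)⟩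
  map_add' f g := by
    apply NNReal.eq
    have : toRealMap (f + g) = toRealMap f + toRealMap g := by ext; simp [toRealMap]
    change (posPartFunctional ℓ (f + g) : ℝ) - ℓ _
      = ((posPartFunctional ℓ f : ℝ) - ℓ _) + ((posPartFunctional ℓ g : ℝ) - ℓ _)
    rw [this, map_add, map_add, NNReal.coe_add]
    ring
  map_smul' c f := by
    apply NNReal.eq
    have : toRealMap (c • f) = (c : ℝ) • toRealMap f := by ext; simp [toRealMap]
    change (posPartFunctional ℓ (c • f) : ℝ) - ℓ _ = c * ((posPartFunctional ℓ f : ℝ) - ℓ _)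
    rw [this, map_smul, map_smul, smul_eq_mul, smul_eq_mul, NNReal.coe_mul]
    ring

variable [T2Space X] [MeasurableSpace X] [BorelSpace X]

lemma integral_posPart_sub_negPart (ℓ : C(X, ℝ) →L[ℝ] ℝ) (f : C_c(X, ℝ≥0)) :
    ∫ x, (f x : ℝ) ∂(NNRealRMK.rieszMeasure (posPartFunctional ℓ)) -
      ∫ x, (f x : ℝ) ∂(NNRealRMK.rieszMeasure (negPartFunctional ℓ)) = ℓ (toRealMap f) := by
  rw [NNRealRMK.integral_rieszMeasure, NNRealRMK.integral_rieszMeasure]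
  change (posPartFunctional ℓ f : ℝ) - ((posPartFunctional ℓ f : ℝ) - ℓ _) = _
  ring

omit [CompactSpace X] [T2Space X] [BorelSpace X] [TopologicalSpace X] in
lemma integral_lsmul_toSignedMeasure (μ : Measure X) [IsFiniteMeasure μ] (f : X → ℝ) :
    VectorMeasure.integral μ.toSignedMeasure f (ContinuousLinearMap.lsmul ℝ ℝ) = ∫ x, f x ∂μ := by
  have : (ContinuousLinearMap.lsmul ℝ ℝ : ℝ →L[ℝ] ℝ →L[ℝ] ℝ)
      = (ContinuousLinearMap.lsmul ℝ ℝ).flip := by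
    ext; simp
  rw [this]
  exact VectorMeasure.integral_toSignedMeasure

/-- Every bounded functional on `C(X, ℝ)` is the integral against a signed measure. -/
theorem exists_signedMeasure_integral_eq (ℓ : C(X, ℝ) →L[ℝ] ℝ) :
    ∃ μ : SignedMeasure X, ∀ f : C(X, ℝ),
      VectorMeasure.integral μ f (ContinuousLinearMap.lsmul ℝ ℝ) = ℓ f := by
  set μ := NNRealRMK.rieszMeasure (posPartFunctional ℓ)
  set ν := NNRealRMK.rieszMeasure (negPartFunctional ℓ)
  have hi (κ : Measure X) [IsFiniteMeasure κ] (f : X → ℝ) (hf : Continuous f) : Integrable f κ :=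
    hf.integrable_of_hasCompactSupport (HasCompactSupport.of_compactSpace _)
  refine ⟨μ.toSignedMeasure - ν.toSignedMeasure, fun f => ?_⟩
  have hiV (κ : Measure X) [IsFiniteMeasure κ] (f : X → ℝ) (hf : Continuous f) :
      κ.toSignedMeasure.Integrable f := by
    rw [VectorMeasure.Integrable, Measure.variation_toSignedMeasure]
    exact hi κ f hf
  rw [VectorMeasure.integral_sub_vectorMeasure (hiV _ _ f.continuous) (hiV _ _ f.continuous),
    integral_lsmul_toSignedMeasure, integral_lsmul_toSignedMeasure]
  -- The two Riesz measures represent ℓ only on nonnegative functions, so f is split into its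
  -- positive and negative parts.
  let p : C_c(X, ℝ≥0) := ⟨⟨fun x => (f x).toNNReal, by fun_prop⟩, HasCompactSupport.of_compactSpace _⟩
  let n : C_c(X, ℝ≥0) := ⟨⟨fun x => (-f x).toNNReal, by fun_prop⟩, HasCompactSupport.of_compactSpace _⟩
  have hf : f = toRealMap p - toRealMap n := by
    ext x
    simp only [toRealMap, p, n, ContinuousMap.sub_apply, ContinuousMap.coe_mk]
    change f x = ((f x).toNNReal : ℝ) - ((-f x).toNNReal : ℝ)
    simp [Real.coe_toNNReal']
  have hsplit (κ : Measure X) [IsFiniteMeasure κ] :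
      ∫ x, f x ∂κ = ∫ x, (p x : ℝ) ∂κ - ∫ x, (n x : ℝ) ∂κ := by
    rw [← integral_sub (hi _ _ (by fun_prop)) (hi _ _ (by fun_prop))]
    congr 1
    ext x
    exact congrArg (fun g : C(X, ℝ) => g x) hf
  rw [hsplit, hsplit]
  conv_rhs => rw [hf]
  rw [map_sub, ← integral_posPart_sub_negPart ℓ p, ← integral_posPart_sub_negPart ℓ n]
  ring

end Riesz

end

section

/-! ### Currents and profiles as functionals -/

/-- Continuous vector fields on the torus. -/
abbrev VField (d : ℕ) : Type := C(UnitAddTorus (Fin d), Fin d → ℝ)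

variable {d : ℕ}

instance : IsProbabilityMeasure (volume : Measure UnitAddCircle) :=
  ⟨UnitAddCircle.measure_univ⟩

instance (d : ℕ) : IsProbabilityMeasure (volume : Measure (UnitAddTorus (Fin d))) :=
  inferInstanceAs (IsProbabilityMeasure (Measure.pi fun _ => (volume : Measure UnitAddCircle)))

lemma integrable_of_continuous_torus {E : Type*} [NormedAddCommGroup E]
    {f : UnitAddTorus (Fin d) → E} (hf : Continuous f) : Integrable f :=
  hf.integrable_of_hasCompactSupport (HasCompactSupport.of_compactSpace _)

instance isFiniteMeasure_variation (μ : SignedMeasure (UnitAddTorus (Fin d))) :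
    IsFiniteMeasure μ.variation := by
  rw [← SignedMeasure.totalVariation_eq_variation]
  infer_instance

lemma signedMeasure_integrable (μ : SignedMeasure (UnitAddTorus (Fin d)))
    {f : UnitAddTorus (Fin d) → ℝ} (hf : Continuous f) : μ.Integrable f :=
  hf.integrable_of_hasCompactSupport (HasCompactSupport.of_compactSpace _)

lemma continuous_component {F : UnitAddTorus (Fin d) → Fin d → ℝ} (hF : Continuous F) (j : Fin d) :
    Continuous (fun u => F u j) := (continuous_apply j).comp hF

/-- The functional `F ↦ ⟨J, F⟩` on continuous vector fields. -/
def pairL (J : Current d) : VField d →L[ℝ] ℝ :=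
  LinearMap.mkContinuous
    { toFun := fun F => pair J F
      map_add' := fun F G => by
        simp only [pair, ← Finset.sum_add_distrib]
        refine Finset.sum_congr rfl fun j _ => ?_
        exact VectorMeasure.integral_add
          (signedMeasure_integrable _ (continuous_component F.continuous j))
          (signedMeasure_integrable _ (continuous_component G.continuous j))
      map_smul' := fun c F => by
        simp only [pair, Finset.smul_sum, RingHom.id_apply]
        refine Finset.sum_congr rfl fun j _ => ?_
        exact VectorMeasure.integral_fun_smul (J j) _ c (fun u => F u j) }
    (∑ j, ‖(ContinuousLinearMap.lsmul ℝ ℝ : ℝ →L[ℝ] ℝ →L[ℝ] ℝ)‖ * (J j).variation.real univ)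
    (fun F => by
      rw [Finset.sum_mul]
      change ‖∑ j : Fin d, VectorMeasure.integral (J j) _ _‖ ≤ _
      refine (norm_sum_le _ _).trans (Finset.sum_le_sum fun j _ => ?_)
      refine (VectorMeasure.norm_integral_le_of_norm_le_const (C := ‖F‖)
        (ae_of_all _ fun u => (norm_le_pi_norm (F u) j).trans (F.norm_coe_le_norm u))).trans ?_
      apply le_of_eq; ring)

@[simp] lemma pairL_apply (J : Current d) (F : VField d) : pairL J F = pair J F := rfl

lemma pair_zero_left (F : UnitAddTorus (Fin d) → Fin d → ℝ) : pair (0 : Current d) F = 0 := by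
  refine Finset.sum_eq_zero fun j _ => ?_
  exact VectorMeasure.integral_zero_vectorMeasure

lemma pair_smul_left (c : ℝ) (J : Current d) (F : UnitAddTorus (Fin d) → Fin d → ℝ) :
    pair (c • J) F = c * pair J F := by
  rw [pair, pair, Finset.mul_sum]
  refine Finset.sum_congr rfl fun j _ => ?_
  exact VectorMeasure.integral_smul_vectorMeasure _ c

lemma pair_add_left (J K : Current d) {F : UnitAddTorus (Fin d) → Fin d → ℝ} (hF : Continuous F) :
    pair (J + K) F = pair J F + pair K F := by
  simp only [pair, ← Finset.sum_add_distrib]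
  refine Finset.sum_congr rfl fun j _ => ?_
  exact VectorMeasure.integral_add_vectorMeasure
    (signedMeasure_integrable _ (continuous_component hF j))
    (signedMeasure_integrable _ (continuous_component hF j))

/-- Every bounded functional on continuous vector fields is the pairing with a current. -/
theorem exists_current_pair_eq (ℓ : VField d →L[ℝ] ℝ) : ∃ K : Current d, pairL K = ℓ := by
  let ι : Fin d → C(UnitAddTorus (Fin d), ℝ) →L[ℝ] VField d := fun j =>
    ContinuousLinearMap.compLeftContinuous ℝ _
      (ContinuousLinearMap.single ℝ (fun _ : Fin d => ℝ) j)
  choose μ hμ using fun j => exists_signedMeasure_integral_eq (ℓ.comp (ι j))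
  refine ⟨(μ : Current d), ?_⟩
  ext F
  have hF : F = ∑ j, ι j ⟨fun u => F u j, continuous_component F.continuous j⟩ := by
    ext u k
    have (j : Fin d) (f : C(UnitAddTorus (Fin d), ℝ)) :
        (ι j f) u k = if k = j then f u else 0 := Pi.single_apply _ _ _
    rw [ContinuousMap.sum_apply, Finset.sum_apply]
    simp [this]
  conv_rhs => rw [hF, map_sum]
  change ∑ j : Fin d, VectorMeasure.integral (μ j) _ _ = _
  refine Finset.sum_congr rfl fun j _ => ?_
  exact hμ j ⟨fun u => F u j, continuous_component F.continuous j⟩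

/-- The functional `f ↦ ⟨ρ, f⟩` on continuous functions. -/
def dpairL (ρ : Profile d) : C(UnitAddTorus (Fin d), ℝ) →L[ℝ] ℝ :=
  LinearMap.mkContinuous
    { toFun := fun F => dpair ρ.toFun F
      map_add' := fun F G => by
        simp only [dpair, ContinuousMap.add_apply, mul_add]
        refine integral_add ?_ ?_
        · exact (integrable_of_continuous_torus F.continuous).bdd_mul
            ρ.measurable.aestronglyMeasurable (c := 1)
            (ae_of_all _ fun u => by rw [Real.norm_of_nonneg (ρ.nonneg u)]; exact ρ.le_one u)
        · exact (integrable_of_continuous_torus G.continuous).bdd_mul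
            ρ.measurable.aestronglyMeasurable (c := 1)
            (ae_of_all _ fun u => by rw [Real.norm_of_nonneg (ρ.nonneg u)]; exact ρ.le_one u)
      map_smul' := fun c F => by
        simp only [dpair, ContinuousMap.smul_apply, smul_eq_mul, RingHom.id_apply]
        rw [← integral_const_mul]
        congr 1; ext u; ring }
    1
    (fun F => by
      have : ∀ᵐ u : UnitAddTorus (Fin d), ‖ρ.toFun u * F u‖ ≤ ‖F‖ := ae_of_all _ fun u => by
        rw [norm_mul, Real.norm_of_nonneg (ρ.nonneg u)]
        have h1 := F.norm_coe_le_norm u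
        have h2 := ρ.le_one u
        have h3 := norm_nonneg (F u)
        nlinarith [ρ.nonneg u]
      simpa [dpair] using norm_integral_le_of_norm_le_const this)

@[simp] lemma dpairL_apply (ρ : Profile d) (F : C(UnitAddTorus (Fin d), ℝ)) :
    dpairL ρ F = dpair ρ.toFun F := rfl

lemma Profile.integrable_mul (ρ : Profile d) {F : UnitAddTorus (Fin d) → ℝ} (hF : Integrable F) :
    Integrable fun u => ρ.toFun u * F u :=
  hF.bdd_mul ρ.measurable.aestronglyMeasurable (c := 1)
    (ae_of_all _ fun u => by rw [Real.norm_of_nonneg (ρ.nonneg u)]; exact ρ.le_one u)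

lemma mobility_bounds {a : ℝ} (h0 : 0 ≤ a) (h1 : a ≤ 1) : 0 ≤ mobility a ∧ mobility a ≤ 1 / 4 := by
  unfold mobility
  constructor <;> nlinarith [sq_nonneg (a - 1 / 2)]

lemma Profile.integrable_mobility_mul (ρ : Profile d) {F : UnitAddTorus (Fin d) → ℝ}
    (hF : Integrable F) : Integrable fun u => mobility (ρ.toFun u) * F u := by
  refine hF.bdd_mul (c := 1 / 4) ?_ (ae_of_all _ fun u => ?_)
  · exact (ρ.measurable.mul (measurable_const.sub ρ.measurable)).aestronglyMeasurable
  · have := mobility_bounds (ρ.nonneg u) (ρ.le_one u)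
    rw [Real.norm_of_nonneg this.1]; exact this.2

/-! ### The weak topologies -/

lemma tendsto_current_iff {α : Type*} {l : Filter α} {W : α → Current d} {J : Current d} :
    Tendsto W l (𝓝 J) ↔ ∀ F : VField d, Tendsto (fun a => pair (W a) F) l (𝓝 (pair J F)) := by
  rw [nhds_induced, tendsto_comap_iff, tendsto_pi_nhds]
  rfl

lemma tendsto_profile_iff {α : Type*} {l : Filter α} {π : α → Profile d} {ρ : Profile d} :
    Tendsto π l (𝓝 ρ) ↔ ∀ F : C(UnitAddTorus (Fin d), ℝ),
      Tendsto (fun a => dpair (π a).toFun F) l (𝓝 (dpair ρ.toFun F)) := by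
  rw [nhds_induced, tendsto_comap_iff, tendsto_pi_nhds]
  rfl

lemma continuousOn_current_profile_iff {W : ℝ → Current d} {π : ℝ → Profile d} {s : Set ℝ} :
    ContinuousOn (fun t => (W t, π t)) s ↔
      (∀ F : VField d, ContinuousOn (fun t => pair (W t) F) s) ∧
      ∀ F : C(UnitAddTorus (Fin d), ℝ), ContinuousOn (fun t => dpair (π t).toFun F) s := by
  simp only [ContinuousOn, ContinuousWithinAt, nhds_prod_eq, tendsto_prod_iff']
  constructor
  · intro h
    exact ⟨fun F t ht => tendsto_current_iff.1 (h t ht).1 F,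
      fun F t ht => tendsto_profile_iff.1 (h t ht).2 F⟩
  · intro h t ht
    exact ⟨tendsto_current_iff.2 fun F => h.1 F t ht, tendsto_profile_iff.2 fun F => h.2 F t ht⟩

end

section

variable {d : ℕ}

/-! ### Calculus on the torus -/

/-- The projection from `ℝᵈ` to the torus. -/
def torusMk (x : Fin d → ℝ) : UnitAddTorus (Fin d) := fun i => (x i : UnitAddCircle)

lemma torusMk_add (x y : Fin d → ℝ) : torusMk (x + y) = torusMk x + torusMk y := by
  ext i; simp [torusMk]

lemma torusMk_zero : torusMk (0 : Fin d → ℝ) = 0 := by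
  ext i; simp [torusMk]

lemma isOpenQuotientMap_torusMk : IsOpenQuotientMap (torusMk (d := d)) :=
  IsOpenQuotientMap.piMap fun _ => QuotientAddGroup.isOpenQuotientMap_mk

lemma continuous_torusMk : Continuous (torusMk (d := d)) := isOpenQuotientMap_torusMk.continuous

lemma exists_torusMk_eq (u : UnitAddTorus (Fin d)) : ∃ x : Fin d → ℝ, torusMk x = u :=
  isOpenQuotientMap_torusMk.surjective u

lemma update_eq_add_torusMk (u : UnitAddTorus (Fin d)) (j : Fin d) (s : ℝ) :
    Function.update u j (u j + (s : UnitAddCircle)) = u + torusMk (s • Pi.single j 1) := by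
  ext i
  rcases eq_or_ne i j with rfl | h
  · simp [torusMk]
  · simp [torusMk, h]

lemma partialDeriv_eq (j : Fin d) (f : UnitAddTorus (Fin d) → ℝ) (u : UnitAddTorus (Fin d)) :
    partialDeriv j f u = deriv (fun s : ℝ => f (u + torusMk (s • Pi.single j 1))) 0 := by
  simp only [partialDeriv, update_eq_add_torusMk]

section IsCk

variable {E : Type*} [NormedAddCommGroup E] [NormedSpace ℝ E] {n : ℕ}

lemma IsCk.contDiff {f : UnitAddTorus (Fin d) → E} (hf : IsCk n f) :
    ContDiff ℝ n (fun x => f (torusMk x)) := hf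

lemma IsCk.of_le {m : ℕ} {f : UnitAddTorus (Fin d) → E} (hf : IsCk n f) (h : m ≤ n) : IsCk m f :=
  ContDiff.of_le hf (by exact_mod_cast h)

lemma IsCk.continuous {f : UnitAddTorus (Fin d) → E} (hf : IsCk n f) : Continuous f :=
  isOpenQuotientMap_torusMk.isQuotientMap.continuous_iff.2 hf.contDiff.continuous

lemma isCk_component {F : UnitAddTorus (Fin d) → Fin d → ℝ} (hF : IsCk n F) (j : Fin d) :
    IsCk n (fun u => F u j) := (contDiff_pi.1 hF) j

lemma isCk_pi {F : UnitAddTorus (Fin d) → Fin d → ℝ} (hF : ∀ j, IsCk n (fun u => F u j)) :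
    IsCk n F := contDiff_pi.2 hF

lemma isCk_const (c : E) : IsCk n (fun _ : UnitAddTorus (Fin d) => c) := contDiff_const

end IsCk

/-- The lifted derivative of a `C¹` function in the direction of a vector. -/
lemma IsCk.hasDerivAt_line {f : UnitAddTorus (Fin d) → ℝ} (hf : IsCk 1 f)
    (x z : Fin d → ℝ) (s : ℝ) :
    HasDerivAt (fun s : ℝ => f (torusMk x + torusMk (s • z)))
      (fderiv ℝ (fun x => f (torusMk x)) (x + s • z) z) s := by
  have h1 : HasFDerivAt (fun x => f (torusMk x)) (fderiv ℝ (fun x => f (torusMk x)) (x + s • z))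
      (x + s • z) := (hf.contDiff.differentiable (by norm_num) _).hasFDerivAt
  have h2 : HasDerivAt (fun s : ℝ => x + s • z) z s := by
    simpa using ((hasDerivAt_id s).smul_const z).const_add x
  have := h1.comp_hasDerivAt s h2
  simpa only [Function.comp_def, torusMk_add] using this

lemma IsCk.partialDeriv_torusMk {f : UnitAddTorus (Fin d) → ℝ} (hf : IsCk 1 f) (j : Fin d)
    (x : Fin d → ℝ) :
    partialDeriv j f (torusMk x) = fderiv ℝ (fun x => f (torusMk x)) x (Pi.single j 1) := by
  rw [partialDeriv_eq]
  simpa using (hf.hasDerivAt_line x (Pi.single j 1) 0).deriv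

lemma IsCk.hasDerivAt_partialDeriv {f : UnitAddTorus (Fin d) → ℝ} (hf : IsCk 1 f) (j : Fin d)
    (u : UnitAddTorus (Fin d)) (s : ℝ) :
    HasDerivAt (fun s : ℝ => f (u + torusMk (s • Pi.single j 1)))
      (partialDeriv j f (u + torusMk (s • Pi.single j 1))) s := by
  obtain ⟨x, rfl⟩ := exists_torusMk_eq u
  rw [← torusMk_add, hf.partialDeriv_torusMk]
  exact hf.hasDerivAt_line x _ s

lemma IsCk.hasDerivAt_grad {f : UnitAddTorus (Fin d) → ℝ} (hf : IsCk 1 f)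
    (u : UnitAddTorus (Fin d)) (z : Fin d → ℝ) (s : ℝ) :
    HasDerivAt (fun s : ℝ => f (u + torusMk (s • z)))
      (∑ j, z j * grad f (u + torusMk (s • z)) j) s := by
  obtain ⟨x, rfl⟩ := exists_torusMk_eq u
  suffices h : ∑ j, z j * grad f (torusMk x + torusMk (s • z)) j
      = fderiv ℝ (fun x => f (torusMk x)) (x + s • z) z from h ▸ hf.hasDerivAt_line x z s
  rw [← torusMk_add]
  simp only [grad, hf.partialDeriv_torusMk]
  generalize fderiv ℝ (fun x => f (torusMk x)) (x + s • z) = L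
  conv_rhs => rw [← Finset.univ_sum_single z, map_sum]
  refine Finset.sum_congr rfl fun j _ => ?_
  have : Pi.single j (z j) = z j • (Pi.single j 1 : Fin d → ℝ) := by
    ext i
    simp [Pi.single_apply]
  rw [this, map_smul, smul_eq_mul]

lemma IsCk.continuous_partialDeriv {f : UnitAddTorus (Fin d) → ℝ} (hf : IsCk 1 f) (j : Fin d) :
    Continuous (partialDeriv j f) := by
  refine isOpenQuotientMap_torusMk.isQuotientMap.continuous_iff.2 ?_
  have : partialDeriv j f ∘ torusMk = fun x => fderiv ℝ (fun x => f (torusMk x)) x (Pi.single j 1) := by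
    ext x; exact hf.partialDeriv_torusMk j x
  rw [this]
  exact (hf.contDiff.continuous_fderiv (by norm_num)).clm_apply continuous_const

lemma IsCk.continuous_grad {f : UnitAddTorus (Fin d) → ℝ} (hf : IsCk 1 f) :
    Continuous (grad f) := continuous_pi fun j => hf.continuous_partialDeriv j

lemma IsCk.continuous_divergence {F : UnitAddTorus (Fin d) → Fin d → ℝ} (hF : IsCk 1 F) :
    Continuous (divergence F) :=
  continuous_finsetSum _ fun j _ => (isCk_component hF j).continuous_partialDeriv j

lemma partialDeriv_add {f g : UnitAddTorus (Fin d) → ℝ} (hf : IsCk 1 f) (hg : IsCk 1 g)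
    (j : Fin d) (u : UnitAddTorus (Fin d)) :
    partialDeriv j (fun v => f v + g v) u = partialDeriv j f u + partialDeriv j g u := by
  have h1 := hf.hasDerivAt_partialDeriv j u 0
  have h2 := hg.hasDerivAt_partialDeriv j u 0
  rw [partialDeriv_eq, (h1.fun_add h2).deriv]
  simp [torusMk_zero]

lemma partialDeriv_mul {f g : UnitAddTorus (Fin d) → ℝ} (hf : IsCk 1 f) (hg : IsCk 1 g)
    (j : Fin d) (u : UnitAddTorus (Fin d)) :
    partialDeriv j (fun v => f v * g v) u = partialDeriv j f u * g u + f u * partialDeriv j g u := by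
  have h1 := hf.hasDerivAt_partialDeriv j u 0
  have h2 := hg.hasDerivAt_partialDeriv j u 0
  rw [partialDeriv_eq, (h1.fun_mul h2).deriv]
  simp [torusMk_zero]

lemma partialDeriv_const_mul (c : ℝ) (f : UnitAddTorus (Fin d) → ℝ)
    (j : Fin d) (u : UnitAddTorus (Fin d)) :
    partialDeriv j (fun v => c * f v) u = c * partialDeriv j f u := by
  rw [partialDeriv_eq, partialDeriv_eq, deriv_const_mul_field]

lemma divergence_add {F G : UnitAddTorus (Fin d) → Fin d → ℝ} (hF : IsCk 1 F) (hG : IsCk 1 G)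
    (u : UnitAddTorus (Fin d)) :
    divergence (fun v => F v + G v) u = divergence F u + divergence G u := by
  simp only [divergence, ← Finset.sum_add_distrib]
  exact Finset.sum_congr rfl fun j _ =>
    partialDeriv_add (isCk_component hF j) (isCk_component hG j) j u

lemma divergence_smul (c : ℝ) (F : UnitAddTorus (Fin d) → Fin d → ℝ) (u : UnitAddTorus (Fin d)) :
    divergence (fun v => c • F v) u = c * divergence F u := by
  simp only [divergence, Finset.mul_sum]
  exact Finset.sum_congr rfl fun j _ => partialDeriv_const_mul c (fun v => F v j) j u

lemma grad_add {f g : UnitAddTorus (Fin d) → ℝ} (hf : IsCk 1 f) (hg : IsCk 1 g) :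
    grad (fun v => f v + g v) = grad f + grad g := by
  ext u j; exact partialDeriv_add hf hg j u

lemma partialDeriv_const (c : ℝ) (j : Fin d) (u : UnitAddTorus (Fin d)) :
    partialDeriv j (fun _ => c) u = 0 := by
  simp [partialDeriv]

/-- The integral of a partial derivative over the torus vanishes. -/
lemma integral_partialDeriv {f : UnitAddTorus (Fin d) → ℝ} (hf : IsCk 1 f) (j : Fin d) :
    ∫ u, partialDeriv j f u = 0 := by
  obtain ⟨C, hC⟩ := (isCompact_range (hf.continuous_partialDeriv j)).isBounded.exists_norm_le
  have hcont : ∀ s : ℝ, Continuous fun u => f (u + torusMk (s • Pi.single j 1)) := fun s =>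
    hf.continuous.comp (continuous_id.add continuous_const)
  let H : ℝ → UnitAddTorus (Fin d) → ℝ := fun s u => f (u + torusMk (s • Pi.single j 1))
  let H' : ℝ → UnitAddTorus (Fin d) → ℝ :=
    fun s u => partialDeriv j f (u + torusMk (s • Pi.single j 1))
  have h1 : ∀ᶠ s in 𝓝 (0 : ℝ), AEStronglyMeasurable (H s) volume :=
    Eventually.of_forall fun s => (hcont s).aestronglyMeasurable
  have h2 : AEStronglyMeasurable (H' 0) volume :=
    Continuous.aestronglyMeasurable
      ((hf.continuous_partialDeriv j).comp (continuous_id.add continuous_const))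
  have h3 : ∀ᵐ u : UnitAddTorus (Fin d), ∀ s ∈ (univ : Set ℝ), ‖H' s u‖ ≤ C :=
    ae_of_all _ fun u s _ => hC _ ⟨_, rfl⟩
  have h4 : ∀ᵐ u : UnitAddTorus (Fin d), ∀ s ∈ (univ : Set ℝ),
      HasDerivAt (fun s => H s u) (H' s u) s :=
    ae_of_all _ fun u s _ => hf.hasDerivAt_partialDeriv j u s
  have hd : HasDerivAt (fun s : ℝ => ∫ u, H s u) (∫ u, H' 0 u) 0 :=
    (hasDerivAt_integral_of_dominated_loc_of_deriv_le (bound := fun _ => C) univ_mem h1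
      (integrable_of_continuous_torus (hcont 0)) h2 h3 (integrable_const C) h4).2
  -- By translation invariance the function just differentiated is constant in s, so its derivative
  -- at 0 vanishes.
  have hc : (fun s : ℝ => ∫ u, H s u) = fun _ => ∫ u, f u := by
    ext s
    exact integral_add_right_eq_self f (torusMk (s • Pi.single j 1))
  rw [hc] at hd
  simpa [H', torusMk_zero] using hd.unique (hasDerivAt_const (0 : ℝ) (∫ u, f u))

/-- Integration by parts on the torus. -/
lemma integral_mul_divergence {g : UnitAddTorus (Fin d) → ℝ} {F : UnitAddTorus (Fin d) → Fin d → ℝ}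
    (hg : IsCk 1 g) (hF : IsCk 1 F) :
    ∫ u, g u * divergence F u = - ∫ u, ∑ j, grad g u j * F u j := by
  have h (j : Fin d) : ∫ u, (grad g u j * F u j + g u * partialDeriv j (fun v => F v j) u) = 0 := by
    rw [← integral_partialDeriv (f := fun v => g v * F v j)
      (ContDiff.mul hg (isCk_component hF j)) j]
    congr 1; ext u
    rw [partialDeriv_mul hg (isCk_component hF j)]
    rfl
  have hi1 (j : Fin d) : Integrable fun u => grad g u j * F u j :=
    integrable_of_continuous_torus ((continuous_component hg.continuous_grad j).mul
      (continuous_component hF.continuous j))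
  have hi2 (j : Fin d) : Integrable fun u => g u * partialDeriv j (fun v => F v j) u :=
    integrable_of_continuous_torus (hg.continuous.mul
      ((isCk_component hF j).continuous_partialDeriv j))
  have : ∀ j : Fin d, ∫ u, g u * partialDeriv j (fun v => F v j) u
      = - ∫ u, grad g u j * F u j := fun j => by
    have := h j
    rw [integral_add (hi1 j) (hi2 j)] at this
    linarith
  simp only [divergence, Finset.mul_sum]
  rw [integral_finsetSum _ fun j _ => hi2 j, integral_finsetSum _ fun j _ => hi1 j,
    ← Finset.sum_neg_distrib]
  exact Finset.sum_congr rfl fun j _ => this j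

end

section

variable {d : ℕ}

/-! ### Time-dependent fields -/

/-- A function on `[0,T] × 𝕋ᵈ` with continuous lift defines a continuous path in `C(𝕋ᵈ, E)`. -/
lemma exists_continuous_path {E : Type*} [NormedAddCommGroup E] {T : ℝ} (hT : 0 ≤ T)
    {A : ℝ → UnitAddTorus (Fin d) → E}
    (hA : ContinuousOn (fun p : ℝ × (Fin d → ℝ) => A p.1 (torusMk p.2)) (Icc 0 T ×ˢ univ)) :
    ∃ Φ : ℝ → C(UnitAddTorus (Fin d), E), Continuous Φ ∧ ∀ t ∈ Icc 0 T, A t = Φ t := by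
  -- Clamping time to [0,T] extends the path to all times. Joint continuity can be checked on the
  -- lift, since the product of the identity with an open quotient map is again a quotient map.
  let c : ℝ → ℝ := fun t => projIcc 0 T hT t
  have hc : Continuous c := continuous_subtype_val.comp continuous_projIcc
  have hlift : Continuous fun p : ℝ × UnitAddTorus (Fin d) => A (c p.1) p.2 := by
    have hq : IsOpenQuotientMap (Prod.map (id : ℝ → ℝ) (torusMk (d := d))) :=
      IsOpenQuotientMap.id.prodMap isOpenQuotientMap_torusMk
    refine hq.isQuotientMap.continuous_iff.2 ?_
    have h2 : Continuous fun p : ℝ × (Fin d → ℝ) => (c p.1, p.2) := by fun_prop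
    exact hA.comp_continuous h2 fun p => ⟨(projIcc 0 T hT p.1).2, mem_univ _⟩
  refine ⟨fun t => ContinuousMap.curry ⟨_, hlift⟩ t, (ContinuousMap.curry ⟨_, hlift⟩).continuous,
    fun t ht => ?_⟩
  ext u
  simp only [ContinuousMap.curry_apply, ContinuousMap.coe_mk, c]
  rw [projIcc_of_mem hT ht]

/-- Turns a test field into a differentiable curve in the Banach space of continuous fields, so that
functionals can be applied to it and integrated in time. The curve is a primitive of the time
derivative, hence differentiable on all of ℝ, with no endpoint conditions to carry along. -/
theorem IsC11.exists_paths {T : ℝ} (hT : 0 < T) {F : ℝ → UnitAddTorus (Fin d) → Fin d → ℝ}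
    (hF : IsC11 T F) :
    ∃ (Φ Φ' : ℝ → VField d) (δ : ℝ → C(UnitAddTorus (Fin d), ℝ)),
      Continuous Φ' ∧ Continuous δ ∧ (∀ t, HasDerivAt Φ (Φ' t) t) ∧
      ∀ t ∈ Icc 0 T, F t = Φ t ∧ timeDeriv T F t = Φ' t ∧ divergence (F t) = δ t := by
  set S : Set (ℝ × (Fin d → ℝ)) := Icc 0 T ×ˢ univ
  set G : ℝ × (Fin d → ℝ) → Fin d → ℝ := fun p => F p.1 (torusMk p.2)
  have hG : ContDiffOn ℝ 1 G S := hF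
  have hS : UniqueDiffOn ℝ S := (uniqueDiffOn_Icc hT).prod uniqueDiffOn_univ
  have hDG : ContinuousOn (fderivWithin ℝ G S) S := hG.continuousOn_fderivWithin hS (by norm_num)
  have hfd : ∀ p ∈ S, HasFDerivWithinAt G (fderivWithin ℝ G S p) S p := fun p hp =>
    (hG.differentiableOn (by norm_num) p hp).hasFDerivWithinAt
  have htime : ∀ t ∈ Icc 0 T, ∀ x j, HasDerivWithinAt (fun s => F s (torusMk x) j)
      (fderivWithin ℝ G S (t, x) (1, 0) j) (Icc 0 T) t := by
    intro t ht x j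
    have h1 : HasDerivWithinAt (fun s : ℝ => ((s, x) : ℝ × (Fin d → ℝ))) (1, 0) (Icc 0 T) t :=
      ((hasDerivAt_id t).prodMk (hasDerivAt_const t x)).hasDerivWithinAt
    have hm : MapsTo (fun s : ℝ => ((s, x) : ℝ × (Fin d → ℝ))) (Icc 0 T) S :=
      fun s hs => ⟨hs, mem_univ _⟩
    have h2 := (hfd (t, x) ⟨ht, mem_univ _⟩).comp_hasDerivWithinAt t h1 hm
    exact (hasDerivWithinAt_pi.1 h2) j
  have htd : ∀ t ∈ Icc 0 T, ∀ x, timeDeriv T F t (torusMk x)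
      = fderivWithin ℝ G S (t, x) (1, 0) := by
    intro t ht x
    ext j
    exact (htime t ht x j).derivWithin (uniqueDiffOn_Icc hT t ht)
  have hpd : ∀ t ∈ Icc 0 T, ∀ x, divergence (F t) (torusMk x)
      = ∑ j, fderivWithin ℝ G S (t, x) (0, Pi.single j 1) j := by
    intro t ht x
    refine Finset.sum_congr rfl fun j _ => ?_
    rw [partialDeriv_eq]
    have h1 : HasDerivAt (fun s : ℝ => ((t, x + s • Pi.single j 1) : ℝ × (Fin d → ℝ)))
        (0, Pi.single j 1) 0 := by
      refine (hasDerivAt_const (0 : ℝ) t).prodMk ?_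
      simpa using ((hasDerivAt_id (0 : ℝ)).smul_const (Pi.single j 1 : Fin d → ℝ)).const_add x
    have h3 : HasFDerivWithinAt G (fderivWithin ℝ G S (t, x)) S (t, x + (0 : ℝ) • Pi.single j 1) := by
      simpa using hfd (t, x) ⟨ht, mem_univ _⟩
    have hm : ∀ᶠ s in 𝓝 (0 : ℝ), ((t, x + s • Pi.single j 1) : ℝ × (Fin d → ℝ)) ∈ S :=
      Eventually.of_forall fun s => ⟨ht, mem_univ _⟩
    have h2 := h3.comp_hasDerivAt (0 : ℝ) h1 hm
    have h4 := ((hasDerivAt_pi.1 h2) j).deriv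
    simpa only [G, Function.comp_def, torusMk_add] using h4
  obtain ⟨Ψ, hΨ, hΨF⟩ := exists_continuous_path (A := F) hT.le hG.continuousOn
  obtain ⟨Φ', hΦ', hΦ'F⟩ := exists_continuous_path (A := timeDeriv T F) hT.le
    ((hDG.clm_apply continuousOn_const).congr fun p hp => htd p.1 hp.1 p.2)
  obtain ⟨δ, hδ, hδF⟩ := exists_continuous_path (A := fun t => divergence (F t)) hT.le
    ((continuousOn_finsetSum _ fun j _ => (continuous_apply j).comp_continuousOn
      (hDG.clm_apply (continuousOn_const (c := ((0 : ℝ), (Pi.single j 1 : Fin d → ℝ)))))).congr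
      fun p hp => hpd p.1 hp.1 p.2)
  have hder : ∀ t, HasDerivAt (fun t => Ψ 0 + ∫ s in (0 : ℝ)..t, Φ' s) (Φ' t) t := fun t =>
    (intervalIntegral.integral_hasDerivAt_right (hΦ'.intervalIntegrable _ _)
      (hΦ'.stronglyMeasurableAtFilter _ _) hΦ'.continuousAt).const_add _
  refine ⟨fun t => Ψ 0 + ∫ s in (0 : ℝ)..t, Φ' s, Φ', δ, hΦ', hδ, hder, fun t ht =>
    ⟨?_, hΦ'F t ht, hδF t ht⟩⟩
  ext u j
  obtain ⟨x, rfl⟩ := exists_torusMk_eq u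
  -- both sides have the same derivative and agree at time zero
  let ev : VField d →L[ℝ] ℝ :=
    (ContinuousLinearMap.proj j).comp (ContinuousMap.evalCLM ℝ (torusMk x))
  have h1 : ∀ s ∈ Icc 0 T, HasDerivWithinAt (fun s => F s (torusMk x) j) (ev (Φ' s)) (Icc 0 T) s := by
    intro s hs
    have h := htime s hs x j
    rw [← htd s hs x, hΦ'F s hs] at h
    exact h
  have h2 : ∀ s, HasDerivAt (fun t => ev (Ψ 0 + ∫ s in (0 : ℝ)..t, Φ' s)) (ev (Φ' s)) s := fun s =>
    ev.hasFDerivAt.comp_hasDerivAt s (hder s)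
  have h3 : ∫ s in (0 : ℝ)..t, ev (Φ' s) = F t (torusMk x) j - F 0 (torusMk x) j := by
    refine intervalIntegral.integral_eq_sub_of_hasDerivAt_of_le (f := fun s => F s (torusMk x) j)
      (f' := fun s => ev (Φ' s)) ht.1 ?_ (fun s hs => ?_) ((ev.continuous.comp hΦ').intervalIntegrable _ _)
    · exact fun s hs => ((h1 s ⟨hs.1, hs.2.trans ht.2⟩).continuousWithinAt).mono
        (Icc_subset_Icc_right ht.2)
    · exact (h1 s ⟨hs.1.le, hs.2.le.trans ht.2⟩).hasDerivAt
        (Icc_mem_nhds hs.1 (hs.2.trans_le ht.2))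
  have h4 : ∫ s in (0 : ℝ)..t, ev (Φ' s) = ev (Ψ 0 + ∫ s in (0 : ℝ)..t, Φ' s) -
      ev (Ψ 0 + ∫ s in (0 : ℝ)..0, Φ' s) :=
    intervalIntegral.integral_eq_sub_of_hasDerivAt (fun s _ => h2 s)
      ((ev.continuous.comp hΦ').intervalIntegrable _ _)
  have h5 : ev (Ψ 0 + ∫ s in (0 : ℝ)..0, Φ' s) = F 0 (torusMk x) j := by
    rw [intervalIntegral.integral_same, add_zero, hΨF 0 ⟨le_rfl, hT.le⟩]
    rfl
  have h6 : F t (torusMk x) j = ev (Ψ 0 + ∫ s in (0 : ℝ)..t, Φ' s) := by linarith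
  exact h6

end

section

variable {d : ℕ}

/-! ### Weakly continuous paths -/

section Weak

variable {E : Type*} [NormedAddCommGroup E] [NormedSpace ℝ E] [CompleteSpace E]

/-- Uniform boundedness principle: weak continuity on a compact set gives pointwise bounds, hence a
bound on the operator norms. -/
lemma exists_norm_le_of_weakly_continuousOn {w : ℝ → E →L[ℝ] ℝ} {K : Set ℝ} (hK : IsCompact K)
    (hw : ∀ x, ContinuousOn (fun t => w t x) K) : ∃ C, 0 ≤ C ∧ ∀ t ∈ K, ‖w t‖ ≤ C := by
  obtain ⟨C, hC⟩ := banach_steinhaus (g := fun t : K => w t) fun x => by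
    obtain ⟨C, hC⟩ := hK.exists_bound_of_continuousOn (hw x)
    exact ⟨C, fun t => hC t t.2⟩
  exact ⟨max C 0, le_max_right _ _, fun t ht => (hC ⟨t, ht⟩).trans (le_max_left _ _)⟩

/-- The change of the argument is harmless because the functionals are uniformly bounded: w_s(Φ_s) =
w_s(Φ_s - Φ_t) + w_s(Φ_t). -/
lemma continuousOn_weak_apply {w : ℝ → E →L[ℝ] ℝ} {K : Set ℝ} (hK : IsCompact K)
    (hw : ∀ x, ContinuousOn (fun t => w t x) K) {Φ : ℝ → E} (hΦ : ContinuousOn Φ K) :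
    ContinuousOn (fun t => w t (Φ t)) K := by
  obtain ⟨C, hC0, hC⟩ := exists_norm_le_of_weakly_continuousOn hK hw
  intro t ht
  have h1 : Tendsto (fun s => C * ‖Φ s - Φ t‖) (𝓝[K] t) (𝓝 0) := by
    have : Tendsto (fun s => C * ‖Φ s - Φ t‖) (𝓝[K] t) (𝓝 (C * ‖Φ t - Φ t‖)) :=
      ((hΦ t ht).sub_const (Φ t)).norm.const_mul C
    simpa using this
  have h2 : Tendsto (fun s => w s (Φ s - Φ t)) (𝓝[K] t) (𝓝 0) := by
    refine squeeze_zero_norm' ?_ h1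
    filter_upwards [self_mem_nhdsWithin] with s hs
    exact ((w s).le_opNorm _).trans (by gcongr; exact hC s hs)
  have h3 := h2.add (hw (Φ t) t ht)
  simpa [ContinuousWithinAt] using h3

end Weak

/-- Integration over the torus as a functional on continuous functions. -/
def integralL (d : ℕ) : C(UnitAddTorus (Fin d), ℝ) →L[ℝ] ℝ :=
  dpairL ⟨fun _ => 1, measurable_const, fun _ => zero_le_one, fun _ => le_rfl⟩

lemma integralL_apply (f : C(UnitAddTorus (Fin d), ℝ)) : integralL d f = ∫ u, f u := by
  simp [integralL, dpair]

/-! ### The mobility term -/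

/-- The quadratic term `⟨χ(ρ), |F|²⟩`. -/
def energy (ρ : Profile d) (F : UnitAddTorus (Fin d) → Fin d → ℝ) : ℝ :=
  dpair (fun u => mobility (ρ.toFun u)) (fun u => ∑ j, (F u j) ^ 2)

/-- The squared length of a continuous field. -/
def sqLength (F : VField d) : C(UnitAddTorus (Fin d), ℝ) :=
  ⟨fun u => ∑ j, (F u j) ^ 2,
    continuous_finsetSum _ fun j _ => (continuous_component F.continuous j).pow 2⟩

@[simp] lemma sqLength_apply (F : VField d) (u : UnitAddTorus (Fin d)) :
    sqLength F u = ∑ j, (F u j) ^ 2 := rfl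

lemma sqLength_nonneg (F : VField d) (u : UnitAddTorus (Fin d)) : 0 ≤ sqLength F u :=
  Finset.sum_nonneg (s := Finset.univ) (f := fun j => (F u j) ^ 2) fun _ _ => sq_nonneg _

lemma continuous_sqLength : Continuous (sqLength (d := d)) := by
  refine ContinuousMap.continuous_of_continuous_uncurry _ ?_
  simp only [Function.uncurry_def, sqLength_apply]
  refine continuous_finsetSum _ fun j _ => Continuous.pow ?_ 2
  exact (continuous_apply j).comp (continuous_eval)

lemma energy_eq (ρ : Profile d) (F : VField d) :
    energy ρ F = ∫ u, mobility (ρ.toFun u) * sqLength F u := rfl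

lemma energy_nonneg (ρ : Profile d) (F : UnitAddTorus (Fin d) → Fin d → ℝ) : 0 ≤ energy ρ F :=
  integral_nonneg fun u => mul_nonneg (mobility_bounds (ρ.nonneg u) (ρ.le_one u)).1
    (Finset.sum_nonneg fun _ _ => sq_nonneg _)

lemma energy_le (ρ : Profile d) (F : VField d) : energy ρ F ≤ 1 / 4 * ∫ u, sqLength F u := by
  rw [energy_eq, ← integral_const_mul]
  have hi := integrable_of_continuous_torus (sqLength F).continuous
  refine integral_mono (ρ.integrable_mobility_mul hi) (hi.const_mul _) fun u => ?_
  exact mul_le_mul_of_nonneg_right (mobility_bounds (ρ.nonneg u) (ρ.le_one u)).2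
    (sqLength_nonneg F u)

/-- The integral of `ρ² g`, which is weakly lower semicontinuous in `ρ`. -/
def sqIntegral (ρ : Profile d) (g : C(UnitAddTorus (Fin d), ℝ)) : ℝ :=
  ∫ u, ρ.toFun u ^ 2 * g u

lemma Profile.integrable_sq_mul (ρ : Profile d) (g : C(UnitAddTorus (Fin d), ℝ)) :
    Integrable fun u => ρ.toFun u ^ 2 * g u := by
  have := ρ.integrable_mul (ρ.integrable_mul (integrable_of_continuous_torus g.continuous))
  refine this.congr (ae_of_all _ fun u => ?_)
  simp only
  ring

/-- The pointwise inequality ρ² ≥ 2hρ - h² with its exact defect. The right side is weakly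
continuous in ρ for fixed continuous h, so ρ² is handled as a supremum of such functions. -/
lemma sqIntegral_sub (ρ : Profile d) (g h : C(UnitAddTorus (Fin d), ℝ)) :
    sqIntegral ρ g - (dpairL ρ ((2 : ℝ) • (h * g)) - ∫ u, h u ^ 2 * g u)
      = ∫ u, (ρ.toFun u - h u) ^ 2 * g u := by
  have h1 := ρ.integrable_sq_mul g
  have h2 := ρ.integrable_mul (integrable_of_continuous_torus ((2 : ℝ) • (h * g)).continuous)
  have h3 : Integrable fun u => h u ^ 2 * g u :=
    integrable_of_continuous_torus (by fun_prop)
  rw [sqIntegral, dpairL_apply, dpair, ← integral_sub h2 h3,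
    ← integral_sub h1 (g := fun u => _ - _) (h2.sub h3)]
  congr 1; ext u
  simp
  ring

lemma exists_continuous_sq_approx (ρ : Profile d) {ε : ℝ} (hε : 0 < ε) :
    ∃ h : C(UnitAddTorus (Fin d), ℝ), ∫ u, (ρ.toFun u - h u) ^ 2 ≤ ε := by
  have hm : MemLp ρ.toFun (ENNReal.ofReal 2) (volume : Measure (UnitAddTorus (Fin d))) :=
    MemLp.of_bound ρ.measurable.aestronglyMeasurable 1
      (ae_of_all _ fun u => by rw [Real.norm_of_nonneg (ρ.nonneg u)]; exact ρ.le_one u)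
  obtain ⟨g, hg, -⟩ := hm.exists_boundedContinuous_integral_rpow_sub_le (by norm_num) hε
  refine ⟨⟨g, g.continuous⟩, le_trans (le_of_eq ?_) hg⟩
  congr 1; ext u
  rw [Real.rpow_two, Real.norm_eq_abs, sq_abs]
  rfl

/-- Since χ(ρ) = ρ - ρ², the energy is a weakly continuous term minus a lower semicontinuous one. It
is not weakly continuous itself, but it is measurable in time. -/
lemma energy_eq_sub (ρ : Profile d) (F : VField d) :
    energy ρ F = dpairL ρ (sqLength F) - sqIntegral ρ (sqLength F) := by
  rw [energy_eq, dpairL_apply, dpair, sqIntegral, ← integral_sub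
    (ρ.integrable_mul (integrable_of_continuous_torus (sqLength F).continuous))
    (ρ.integrable_sq_mul _)]
  congr 1; ext u
  simp only [mobility]; ring

lemma lowerSemicontinuous_sqIntegral {π : ℝ → Profile d}
    (hπ : ∀ f : C(UnitAddTorus (Fin d), ℝ), Continuous fun t => dpairL (π t) f)
    {g : ℝ → C(UnitAddTorus (Fin d), ℝ)} (hg : Continuous g) (hg0 : ∀ t u, 0 ≤ g t u) :
    LowerSemicontinuous fun t => sqIntegral (π t) (g t) := by
  intro t y hy
  -- The tolerance makes the defect at time t at most half of the gap above y; the `+ 1` covers the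
  -- case of a vanishing g t.
  obtain ⟨h, hh⟩ := exists_continuous_sq_approx (π t)
    (ε := (sqIntegral (π t) (g t) - y) / (2 * (‖g t‖ + 1)))
    (div_pos (sub_pos.2 hy) (by positivity))
  have hlow : ∀ s, dpairL (π s) ((2 : ℝ) • (h * g s)) - ∫ u, h u ^ 2 * g s u ≤ sqIntegral (π s) (g s) := by
    intro s
    have := sqIntegral_sub (π s) (g s) h
    have h0 : 0 ≤ ∫ u, ((π s).toFun u - h u) ^ 2 * g s u :=
      integral_nonneg fun u => mul_nonneg (sq_nonneg _) (hg0 s u)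
    linarith
  have hcont : Continuous fun s => dpairL (π s) ((2 : ℝ) • (h * g s)) - ∫ u, h u ^ 2 * g s u := by
    refine Continuous.sub ?_ ?_
    · refine continuous_iff_continuousAt.2 fun s => ?_
      have hc : ContinuousOn (fun s => dpairL (π s) ((2 : ℝ) • (h * g s))) (Icc (s - 1) (s + 1)) :=
        continuousOn_weak_apply isCompact_Icc (fun f => (hπ f).continuousOn)
          (Continuous.continuousOn (by fun_prop))
      exact hc.continuousAt (Icc_mem_nhds (by linarith) (by linarith))
    · have : Continuous fun s => integralL d (h ^ 2 * g s) := by fun_prop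
      exact this.congr fun s => integralL_apply _
  have hlt : y < dpairL (π t) ((2 : ℝ) • (h * g t)) - ∫ u, h u ^ 2 * g t u := by
    have h1 := sqIntegral_sub (π t) (g t) h
    have hi : Integrable fun u => ((π t).toFun u - h u) ^ 2 := by
      have e := ((π t).integrable_sq_mul 1).sub (((π t).integrable_mul
        (integrable_of_continuous_torus ((2 : ℝ) • h).continuous)).sub
        (integrable_of_continuous_torus (h ^ 2).continuous))
      refine e.congr (ae_of_all _ fun u => ?_)
      simp
      ring
    have h2 : ∫ u, ((π t).toFun u - h u) ^ 2 * g t u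
        ≤ ∫ u, ((π t).toFun u - h u) ^ 2 * ‖g t‖ := by
      refine integral_mono_of_nonneg (ae_of_all _ fun u => mul_nonneg (sq_nonneg _) (hg0 t u))
        (hi.mul_const _) (ae_of_all _ fun u => ?_)
      exact mul_le_mul_of_nonneg_left ((le_abs_self _).trans ((g t).norm_coe_le_norm u))
        (sq_nonneg _)
    rw [integral_mul_const] at h2
    have h3 : (∫ u, ((π t).toFun u - h u) ^ 2) * ‖g t‖ ≤ (sqIntegral (π t) (g t) - y) / 2 := by
      calc _ ≤ (sqIntegral (π t) (g t) - y) / (2 * (‖g t‖ + 1)) * (‖g t‖ + 1) := by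
            have h0 := (div_pos (sub_pos.2 hy) (by positivity : 0 < 2 * (‖g t‖ + 1))).le
            exact mul_le_mul hh (by linarith) (norm_nonneg _) h0
        _ = _ := by field_simp
    linarith
  filter_upwards [hcont.continuousAt.eventually (lt_mem_nhds hlt)] with s hs
  exact hs.trans_le (hlow s)

/-- Along weakly continuous paths the mobility term is integrable in time. -/
lemma intervalIntegrable_energy {T : ℝ} (hT : 0 ≤ T) {π : ℝ → Profile d}
    (hπ : ∀ f : C(UnitAddTorus (Fin d), ℝ), ContinuousOn (fun t => dpairL (π t) f) (Icc 0 T))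
    {Φ : ℝ → VField d} (hΦ : Continuous Φ) :
    IntervalIntegrable (fun t => energy (π t) (Φ t)) volume 0 T := by
  let c : ℝ → ℝ := fun t => projIcc 0 T hT t
  have hc : Continuous c := continuous_subtype_val.comp continuous_projIcc
  have hcm : ∀ t, c t ∈ Icc 0 T := fun t => (projIcc 0 T hT t).2
  have hπc : ∀ f : C(UnitAddTorus (Fin d), ℝ), Continuous fun t => dpairL (π (c t)) f :=
    fun f => (hπ f).comp_continuous hc hcm
  have hg : Continuous fun t => sqLength (Φ (c t)) := continuous_sqLength.comp (hΦ.comp hc)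
  have hmeas : Measurable fun t => energy (π (c t)) (Φ (c t)) := by
    simp only [energy_eq_sub]
    refine Measurable.sub ?_ (lowerSemicontinuous_sqIntegral hπc hg
      fun t u => sqLength_nonneg _ u).measurable
    refine Continuous.measurable (continuous_iff_continuousAt.2 fun s => ?_)
    exact (continuousOn_weak_apply isCompact_Icc (fun f => (hπc f).continuousOn)
      hg.continuousOn).continuousAt (Icc_mem_nhds (sub_one_lt s) (lt_add_one s))
  have hI : Continuous fun t => ∫ u, sqLength (Φ t) u := by
    exact ((integralL d).continuous.comp (continuous_sqLength.comp hΦ)).congr fun s =>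
      integralL_apply _
  have hint : IntervalIntegrable (fun t => energy (π (c t)) (Φ (c t))) volume 0 T := by
    refine ((hI.comp hc).const_mul (1 / 4) |>.intervalIntegrable 0 T).mono_fun
      hmeas.aestronglyMeasurable (ae_of_all _ fun t => ?_)
    change ‖energy _ _‖ ≤ _
    rw [Real.norm_of_nonneg (energy_nonneg _ _)]
    exact (energy_le _ _).trans (le_abs_self _)
  refine hint.congr fun t ht => ?_
  rw [uIoc_of_le hT] at ht
  simp only [c, projIcc_of_mem hT ⟨ht.1.le, ht.2⟩]

end

section

variable {d : ℕ}

/-! ### Test fields as paths of continuous fields -/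

/-- The paths `Φ`, `Φ'`, `δ` represent the field `F`, its time derivative and its divergence. -/
structure FieldPath (T : ℝ) (F : ℝ → UnitAddTorus (Fin d) → Fin d → ℝ)
    (Φ Φ' : ℝ → VField d) (δ : ℝ → C(UnitAddTorus (Fin d), ℝ)) : Prop where
  continuous_deriv : Continuous Φ'
  continuous_div : Continuous δ
  hasDerivAt : ∀ t, HasDerivAt Φ (Φ' t) t
  eqOn : ∀ t ∈ Icc 0 T, F t = Φ t
  timeDeriv_eq : ∀ t ∈ Icc 0 T, timeDeriv T F t = Φ' t
  divergence_eq : ∀ t ∈ Icc 0 T, divergence (F t) = δ t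

lemma IsC11.exists_fieldPath {T : ℝ} (hT : 0 < T) {F : ℝ → UnitAddTorus (Fin d) → Fin d → ℝ}
    (hF : IsC11 T F) : ∃ Φ Φ' δ, FieldPath T F Φ Φ' δ := by
  obtain ⟨Φ, Φ', δ, h1, h2, h3, h4⟩ := hF.exists_paths hT
  exact ⟨Φ, Φ', δ, h1, h2, h3, fun t ht => (h4 t ht).1, fun t ht => (h4 t ht).2.1,
    fun t ht => (h4 t ht).2.2⟩

lemma FieldPath.continuous {T : ℝ} {F : ℝ → UnitAddTorus (Fin d) → Fin d → ℝ}
    {Φ Φ' : ℝ → VField d} {δ : ℝ → C(UnitAddTorus (Fin d), ℝ)} (h : FieldPath T F Φ Φ' δ) :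
    Continuous Φ := continuous_iff_continuousAt.2 fun t => (h.hasDerivAt t).continuousAt

/-- Evaluation of a component of a continuous field at a point. -/
def evalComp (u : UnitAddTorus (Fin d)) (j : Fin d) : VField d →L[ℝ] ℝ :=
  (ContinuousLinearMap.proj j).comp (ContinuousMap.evalCLM ℝ u)

/-- The one-sided time derivative need not be checked separately: on [0,T] it is determined by the
values of the field, hence by the derivative of Φ. -/
lemma FieldPath.of_eqOn {T : ℝ} (hT : 0 < T) {F : ℝ → UnitAddTorus (Fin d) → Fin d → ℝ}
    {Φ Φ' : ℝ → VField d} {δ : ℝ → C(UnitAddTorus (Fin d), ℝ)}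
    (h1 : Continuous Φ') (h2 : Continuous δ) (h3 : ∀ t, HasDerivAt Φ (Φ' t) t)
    (h4 : ∀ t ∈ Icc 0 T, F t = Φ t) (h5 : ∀ t ∈ Icc 0 T, divergence (F t) = δ t) :
    FieldPath T F Φ Φ' δ := by
  refine ⟨h1, h2, h3, h4, fun t ht => ?_, h5⟩
  ext u j
  have : HasDerivAt (fun s => Φ s u j) (Φ' t u j) t :=
    (evalComp u j).hasFDerivAt.comp_hasDerivAt t (h3 t)
  refine (this.hasDerivWithinAt.congr (fun s hs => ?_) ?_).derivWithin (uniqueDiffOn_Icc hT t ht)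
  · rw [h4 s hs]
  · rw [h4 t ht]

lemma IsC11.isCk {T : ℝ} {F : ℝ → UnitAddTorus (Fin d) → Fin d → ℝ} (hF : IsC11 T F) {t : ℝ}
    (ht : t ∈ Icc 0 T) : IsCk 1 (F t) := by
  have h1 : ContDiff ℝ 1 fun x : Fin d → ℝ => ((t, x) : ℝ × (Fin d → ℝ)) := by fun_prop
  have h2 : ContDiffOn ℝ 1 (fun p : ℝ × (Fin d → ℝ) => F p.1 (torusMk p.2)) (Icc 0 T ×ˢ univ) := hF
  have h3 : ContDiffOn ℝ 1 (fun x => F t (torusMk x)) univ :=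
    h2.comp (contDiffOn_univ.2 h1) fun x _ => ⟨ht, mem_univ _⟩
  exact contDiffOn_univ.1 h3

lemma IsC11.mono {T S : ℝ} (hST : S ≤ T) {F : ℝ → UnitAddTorus (Fin d) → Fin d → ℝ}
    (hF : IsC11 T F) : IsC11 S F :=
  ContDiffOn.mono hF (prod_mono (Icc_subset_Icc_right hST) le_rfl)

lemma IsC11.shift {T S : ℝ} (hT : 0 ≤ T) {F : ℝ → UnitAddTorus (Fin d) → Fin d → ℝ}
    (hF : IsC11 (T + S) F) : IsC11 S (fun t => F (T + t)) := by
  have h1 : ContDiff ℝ 1 fun p : ℝ × (Fin d → ℝ) => ((T + p.1, p.2) : ℝ × (Fin d → ℝ)) := by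
    fun_prop
  exact ContDiffOn.comp hF h1.contDiffOn fun p hp =>
    ⟨⟨by linarith [hp.1.1], by linarith [hp.1.2]⟩, mem_univ _⟩

lemma FieldPath.mono {T S : ℝ} (hS : 0 < S) (hST : S ≤ T)
    {F : ℝ → UnitAddTorus (Fin d) → Fin d → ℝ}
    {Φ Φ' : ℝ → VField d} {δ : ℝ → C(UnitAddTorus (Fin d), ℝ)} (h : FieldPath T F Φ Φ' δ) :
    FieldPath S F Φ Φ' δ :=
  .of_eqOn hS h.continuous_deriv h.continuous_div h.hasDerivAt
    (fun t ht => h.eqOn t ⟨ht.1, ht.2.trans hST⟩)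
    (fun t ht => h.divergence_eq t ⟨ht.1, ht.2.trans hST⟩)

lemma FieldPath.shift {T S : ℝ} (hT : 0 ≤ T) (hS : 0 < S)
    {F : ℝ → UnitAddTorus (Fin d) → Fin d → ℝ}
    {Φ Φ' : ℝ → VField d} {δ : ℝ → C(UnitAddTorus (Fin d), ℝ)} (h : FieldPath (T + S) F Φ Φ' δ) :
    FieldPath S (fun t => F (T + t)) (fun t => Φ (T + t)) (fun t => Φ' (T + t))
      (fun t => δ (T + t)) :=
  .of_eqOn hS (h.continuous_deriv.comp (by fun_prop)) (h.continuous_div.comp (by fun_prop))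
    (fun t => (h.hasDerivAt (T + t)).comp_const_add T t)
    (fun t ht => h.eqOn _ ⟨by linarith [ht.1], by linarith [ht.2]⟩)
    (fun t ht => h.divergence_eq _ ⟨by linarith [ht.1], by linarith [ht.2]⟩)

lemma IsC11.smul {T : ℝ} {F : ℝ → UnitAddTorus (Fin d) → Fin d → ℝ} (hF : IsC11 T F)
    {θ : ℝ → ℝ} (hθ : ContDiff ℝ 1 θ) : IsC11 T (fun t u => θ t • F t u) :=
  ContDiffOn.smul (hθ.comp contDiff_fst).contDiffOn hF

lemma FieldPath.smul {T : ℝ} (hT : 0 < T) {F : ℝ → UnitAddTorus (Fin d) → Fin d → ℝ}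
    {Φ Φ' : ℝ → VField d} {δ : ℝ → C(UnitAddTorus (Fin d), ℝ)} (h : FieldPath T F Φ Φ' δ)
    {θ θ' : ℝ → ℝ} (hθ : ∀ t, HasDerivAt θ (θ' t) t) (hθ' : Continuous θ') :
    FieldPath T (fun t u => θ t • F t u) (fun t => θ t • Φ t)
      (fun t => θ t • Φ' t + θ' t • Φ t) (fun t => θ t • δ t) := by
  have hc : Continuous θ := continuous_iff_continuousAt.2 fun t => (hθ t).continuousAt
  refine .of_eqOn hT ((hc.smul h.continuous_deriv).add (hθ'.smul h.continuous))
    (hc.smul h.continuous_div) (fun t => (hθ t).smul (h.hasDerivAt t)) (fun t ht => ?_)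
    (fun t ht => ?_)
  · ext u j
    simp [h.eqOn t ht]
  · ext u
    rw [divergence_smul, h.divergence_eq t ht]
    rfl

lemma isC11_const {G : UnitAddTorus (Fin d) → Fin d → ℝ} (hG : IsCk 1 G) (T : ℝ) :
    IsC11 T (fun _ => G) :=
  (hG.contDiff.comp contDiff_snd).contDiffOn

lemma fieldPath_const {T : ℝ} (hT : 0 < T) (G : VField d) {D : C(UnitAddTorus (Fin d), ℝ)}
    (hD : divergence G = D) :
    FieldPath T (fun _ => G) (fun _ => G) (fun _ => 0) (fun _ => D) :=
  .of_eqOn hT continuous_const continuous_const (fun t => hasDerivAt_const t _)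
    (fun _ _ => rfl) (fun _ _ => hD)

/-! ### The test functional along paths of finite cost -/

/-- Weak continuity of `(W, π)` expressed through functionals. -/
structure WeakPath (T : ℝ) (W : ℝ → Current d) (π : ℝ → Profile d) : Prop where
  current : ∀ F : VField d, ContinuousOn (fun t => pairL (W t) F) (Icc 0 T)
  profile : ∀ f : C(UnitAddTorus (Fin d), ℝ), ContinuousOn (fun t => dpairL (π t) f) (Icc 0 T)

lemma weakPath_iff {T : ℝ} {W : ℝ → Current d} {π : ℝ → Profile d} :
    WeakPath T W π ↔ ContinuousOn (fun t => (W t, π t)) (Icc 0 T) := by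
  rw [continuousOn_current_profile_iff]
  exact ⟨fun h => ⟨h.1, h.2⟩, fun h => ⟨h.1, h.2⟩⟩

lemma testFunctional_eq {T : ℝ} (hT : 0 ≤ T) (W : ℝ → Current d) (π : ℝ → Profile d)
    {F : ℝ → UnitAddTorus (Fin d) → Fin d → ℝ}
    {Φ Φ' : ℝ → VField d} {δ : ℝ → C(UnitAddTorus (Fin d), ℝ)} (h : FieldPath T F Φ Φ' δ) :
    testFunctional T W π F = pairL (W T) (Φ T) - (∫ t in (0 : ℝ)..T, pairL (W t) (Φ' t))
      - (1 / 2) * (∫ t in (0 : ℝ)..T, dpairL (π t) (δ t))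
      - (1 / 2) * (∫ t in (0 : ℝ)..T, energy (π t) (Φ t)) := by
  have e1 : ∫ t in (0 : ℝ)..T, pair (W t) (timeDeriv T F t) =
      ∫ t in (0 : ℝ)..T, pairL (W t) (Φ' t) :=
    intervalIntegral.integral_congr fun t ht => by
      rw [uIcc_of_le hT] at ht
      simp only [h.timeDeriv_eq t ht, pairL_apply]
  have e2 : ∫ t in (0 : ℝ)..T, dpair (π t).toFun (divergence (F t)) =
      ∫ t in (0 : ℝ)..T, dpairL (π t) (δ t) :=
    intervalIntegral.integral_congr fun t ht => by
      rw [uIcc_of_le hT] at ht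
      simp only [h.divergence_eq t ht, dpairL_apply]
  have e3 : ∫ t in (0 : ℝ)..T, dpair (fun u => mobility ((π t).toFun u))
      (fun u => ∑ j, (F t u j) ^ 2) = ∫ t in (0 : ℝ)..T, energy (π t) (Φ t) :=
    intervalIntegral.integral_congr fun t ht => by
      rw [uIcc_of_le hT] at ht
      simp only [h.eqOn t ht, energy]
  rw [testFunctional, e1, e2, e3, h.eqOn T ⟨hT, le_rfl⟩, pairL_apply]

section Integrability

variable {T : ℝ} {W : ℝ → Current d} {π : ℝ → Profile d}

lemma WeakPath.intervalIntegrable_current (hT : 0 ≤ T) (h : WeakPath T W π) {Φ : ℝ → VField d}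
    (hΦ : Continuous Φ) : IntervalIntegrable (fun t => pairL (W t) (Φ t)) volume 0 T := by
  refine ContinuousOn.intervalIntegrable ?_
  rw [uIcc_of_le hT]
  exact continuousOn_weak_apply isCompact_Icc h.current hΦ.continuousOn

lemma WeakPath.intervalIntegrable_profile (hT : 0 ≤ T) (h : WeakPath T W π)
    {f : ℝ → C(UnitAddTorus (Fin d), ℝ)} (hf : Continuous f) :
    IntervalIntegrable (fun t => dpairL (π t) (f t)) volume 0 T := by
  refine ContinuousOn.intervalIntegrable ?_
  rw [uIcc_of_le hT]
  exact continuousOn_weak_apply isCompact_Icc h.profile hf.continuousOn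

lemma WeakPath.intervalIntegrable_energy (hT : 0 ≤ T) (h : WeakPath T W π) {Φ : ℝ → VField d}
    (hΦ : Continuous Φ) : IntervalIntegrable (fun t => energy (π t) (Φ t)) volume 0 T :=
  CurrentLD.intervalIntegrable_energy hT h.profile hΦ

end Integrability

/-! ### Paths of bounded cost -/

/-- The pair `(W, π)` solves the continuity equation and its cost on `[0,T]` is at most `M`. -/
structure HasCostLE (γ : UnitAddTorus (Fin d) → ℝ) (T : ℝ) (W : ℝ → Current d)
    (π : ℝ → Profile d) (M : ℝ) : Prop where
  continuityEq : ContinuityEq γ T W π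
  weakPath : WeakPath T W π
  testFunctional_le : ∀ F, IsC11 T F → testFunctional T W π F ≤ M

lemma HasCostLE.phi_T_le {γ : UnitAddTorus (Fin d) → ℝ} {T M : ℝ} (hT : 0 < T)
    {W : ℝ → Current d} {π : ℝ → Profile d} (h : HasCostLE γ T W π M) {J : Current d}
    (hJ : W T = T • J) : Phi_T γ T J ≤ ENNReal.ofReal (M / T) := by
  -- Finite cost already includes continuity on [0,T], which gives the one-sided limits of the
  -- càdlàg condition.
  have hmem : W ∈ pathsWithMean T J := by
    have hc : ContinuousOn W (Icc 0 T) := (weakPath_iff.1 h.weakPath).fst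
    refine ⟨⟨fun t ht => ?_, fun t ht => ⟨W t, ?_⟩⟩, hJ⟩
    · exact (hc t ⟨ht.1, ht.2.le⟩).tendsto.mono_left
        (nhdsWithin_le_of_mem (mem_of_superset (Ioo_mem_nhdsGT ht.2)
          fun s hs => ⟨ht.1.trans hs.1.le, hs.2.le⟩))
    · exact (hc t ⟨ht.1.le, ht.2⟩).tendsto.mono_left
        (nhdsWithin_le_of_mem (mem_of_superset (Ioo_mem_nhdsLT ht.1)
          fun s hs => ⟨hs.1.le, hs.2.le.trans ht.2⟩))
  have hrate : rate γ T W ≤ ENNReal.ofReal M := by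
    refine (iInf_le _ π).trans ?_
    rw [pairRate, if_pos h.continuityEq, dynFunctional, if_pos (weakPath_iff.1 h.weakPath)]
    exact iSup₂_le fun F hF => ENNReal.ofReal_le_ofReal (h.testFunctional_le F hF)
  rw [ENNReal.ofReal_div_of_pos hT]
  exact ENNReal.div_le_div_right ((iInf₂_le W hmem).trans hrate) _

/-- The strict inequality selects an actual path without assuming that the infimum is attained.
Nonnegativity of c T allows the truncation `ENNReal.ofReal` to be undone. -/
lemma exists_hasCostLE_of_phi_T_lt {γ : UnitAddTorus (Fin d) → ℝ} {T c : ℝ} (hT : 0 < T)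
    (hc : 0 ≤ c) {J : Current d} (h : Phi_T γ T J < ENNReal.ofReal c) :
    ∃ W π, HasCostLE γ T W π (c * T) ∧ W T = T • J := by
  rw [Phi_T, ENNReal.div_lt_iff (Or.inl (ENNReal.ofReal_pos.2 hT).ne')
    (Or.inl ENNReal.ofReal_ne_top), ← ENNReal.ofReal_mul hc] at h
  simp only [iInf_lt_iff, rate] at h
  obtain ⟨W, hW, π, h⟩ := h
  refine ⟨W, π, ?_, hW.2⟩
  rw [pairRate] at h
  split_ifs at h with h1
  · rw [dynFunctional] at h
    split_ifs at h with h2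
    · refine ⟨h1, weakPath_iff.2 h2, fun F hF => ?_⟩
      have := (le_iSup₂ (f := fun F (_ : IsC11 T F) => ENNReal.ofReal (testFunctional T W π F))
        F hF).trans h.le
      exact (ENNReal.ofReal_le_ofReal_iff (mul_nonneg hc hT.le)).1 this
    · exact absurd h (by simp)
  · exact absurd h (by simp)

end

section

variable {d : ℕ}

/-! ### Trigonometric modes -/

open UnitAddTorus Complex in
lemma mFourier_torusMk (n : Fin d → ℤ) (x : Fin d → ℝ) :
    mFourier n (torusMk x) = exp (2 * Real.pi * I * ∑ i, (n i : ℂ) * x i) := by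
  simp only [mFourier, ContinuousMap.coe_mk, torusMk, fourier_coe_apply, Complex.ofReal_one, div_one]
  rw [← Complex.exp_sum, Finset.mul_sum]
  congr 1
  exact Finset.sum_congr rfl fun i _ => by ring

open UnitAddTorus in
/-- The real trigonometric mode `Re (c e_n)`. -/
def mode (c : ℂ) (n : Fin d → ℤ) (u : UnitAddTorus (Fin d)) : ℝ := (c * mFourier n u).re

lemma isCk_mode {k : ℕ} (c : ℂ) (n : Fin d → ℤ) : IsCk k (mode c n) := by
  have : ContDiff ℝ k fun x : Fin d → ℝ =>
      (c * Complex.exp (2 * Real.pi * Complex.I * ∑ i, (n i : ℂ) * x i)).re := by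
    refine Complex.reCLM.contDiff.comp (contDiff_const.mul (ContDiff.cexp (contDiff_const.mul
      (ContDiff.sum fun i _ => contDiff_const.mul ?_))))
    exact Complex.ofRealCLM.contDiff.comp (contDiff_apply ℝ ℝ i)
  simp only [← mFourier_torusMk] at this
  exact this

lemma partialDeriv_mode (c : ℂ) (n : Fin d → ℤ) (j : Fin d) (u : UnitAddTorus (Fin d)) :
    partialDeriv j (mode c n) u = mode (2 * Real.pi * Complex.I * n j * c) n u := by
  obtain ⟨x, rfl⟩ := exists_torusMk_eq u
  rw [partialDeriv_eq]
  have h1 : ∀ s : ℝ, mode c n (torusMk x + torusMk (s • Pi.single j 1)) =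
      (c * (Complex.exp (2 * Real.pi * Complex.I * ∑ i, (n i : ℂ) * x i) *
        Complex.exp (2 * Real.pi * Complex.I * (n j * s)))).re := by
    intro s
    rw [← torusMk_add, mode, mFourier_torusMk, ← Complex.exp_add]
    congr 3
    rw [← mul_add]
    congr 1
    have : ∀ i, (n i : ℂ) * ((x + s • Pi.single j 1 : Fin d → ℝ) i : ℝ)
        = n i * x i + (if i = j then (n j : ℂ) * s else 0) := by
      intro i
      rcases eq_or_ne i j with rfl | h
      · simp [mul_add]
      · simp [h]
    simp only [this, Finset.sum_add_distrib, Finset.sum_ite_eq', Finset.mem_univ, if_true]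
  simp only [h1]
  have h2 : HasDerivAt (fun s : ℝ => Complex.exp (2 * Real.pi * Complex.I * (n j * s)))
      (2 * Real.pi * Complex.I * n j) 0 := by
    have h3 : HasDerivAt (fun s : ℝ => 2 * Real.pi * Complex.I * (n j * (s : ℂ)))
        (2 * Real.pi * Complex.I * (n j * 1)) 0 :=
      (((Complex.ofRealCLM.hasDerivAt (x := (0 : ℝ))).const_mul (n j : ℂ)).const_mul _)
    simpa using h3.cexp
  have h4 := Complex.reCLM.hasFDerivAt.comp_hasDerivAt (0 : ℝ)
    ((h2.const_mul (Complex.exp (2 * Real.pi * Complex.I * ∑ i, (n i : ℂ) * x i))).const_mul c)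
  refine h4.deriv.trans ?_
  rw [mode, mFourier_torusMk, Complex.reCLM_apply]
  congr 1
  ring

lemma mode_add (a b : ℂ) (n : Fin d → ℤ) (u : UnitAddTorus (Fin d)) :
    mode (a + b) n u = mode a n u + mode b n u := by
  simp only [mode, add_mul, Complex.add_re]

lemma mode_zero (n : Fin d → ℤ) (u : UnitAddTorus (Fin d)) : mode 0 n u = 0 := by
  simp [mode]

lemma mode_sum {ι : Type*} (s : Finset ι) (a : ι → ℂ) (n : Fin d → ℤ) (u : UnitAddTorus (Fin d)) :
    mode (∑ i ∈ s, a i) n u = ∑ i ∈ s, mode (a i) n u := by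
  simp only [mode, Finset.sum_mul, Complex.re_sum]

open UnitAddTorus in
lemma exists_trig_approx (f : C(UnitAddTorus (Fin d), ℝ)) {ε : ℝ} (hε : 0 < ε) :
    ∃ q ∈ Submodule.span ℂ (range (mFourier (d := Fin d))), ∀ u, |f u - (q u).re| < ε := by
  let f' : C(UnitAddTorus (Fin d), ℂ) := ⟨fun u => (f u : ℂ), by fun_prop⟩
  have h : f' ∈ (Submodule.span ℂ (range (mFourier (d := Fin d)))).topologicalClosure := by
    rw [span_mFourier_closure_eq_top]; trivial
  obtain ⟨q, hq, hd⟩ := Metric.mem_closure_iff.1 h ε hε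
  refine ⟨q, hq, fun u => ?_⟩
  have h1 : ‖(f' - q) u‖ < ε := ((f' - q).norm_coe_le_norm u).trans_lt (by rwa [← dist_eq_norm])
  refine lt_of_le_of_lt ?_ h1
  have h2 := Complex.abs_re_le_norm ((f' - q) u)
  simpa [f'] using h2

/-- Continuous functions are uniform limits of `C¹` functions. -/
lemma exists_isCk_approx (f : C(UnitAddTorus (Fin d), ℝ)) {ε : ℝ} (hε : 0 < ε) :
    ∃ g : C(UnitAddTorus (Fin d), ℝ), IsCk 1 g ∧ ‖f - g‖ ≤ ε := by
  obtain ⟨q, hq, h⟩ := exists_trig_approx f hε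
  -- The factor c strengthens the induction: taking real parts does not commute with complex
  -- scalars, which appear in the span.
  have hC : ∀ c : ℂ, IsCk 1 fun u => (c * q u).re := by
    clear h
    induction hq using Submodule.span_induction with
    | mem x hx => obtain ⟨n, rfl⟩ := hx; exact fun c => isCk_mode c n
    | zero => intro c; simpa using isCk_const (0 : ℝ)
    | add x y _ _ hx hy =>
      intro c
      have h : IsCk 1 fun u => (c * x u).re + (c * y u).re := ContDiff.add (hx c) (hy c)
      convert h using 1
      ext u
      simp [mul_add]
    | smul a x _ hx =>
      intro c
      convert hx (c * a) using 1
      ext u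
      simp [mul_assoc]
  have h1 : IsCk 1 fun u => (q u).re := by simpa using hC 1
  refine ⟨⟨_, h1.continuous⟩, h1, (ContinuousMap.norm_le _ hε.le).2 fun u => (h u).le⟩

/-! ### Helmholtz decomposition of trigonometric fields -/

/-- A field that is the sum of a divergence free `C¹` field and of a gradient. -/
def HasHelmholtz (F : UnitAddTorus (Fin d) → Fin d → ℝ) : Prop :=
  IsCk 1 F ∧ ∃ (G : UnitAddTorus (Fin d) → Fin d → ℝ) (g : UnitAddTorus (Fin d) → ℝ),
    IsCk 1 G ∧ IsCk 1 g ∧ (∀ u, divergence G u = 0) ∧ ∀ u, F u = G u + grad g u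

lemma HasHelmholtz.add {F G : UnitAddTorus (Fin d) → Fin d → ℝ} (hF : HasHelmholtz F)
    (hG : HasHelmholtz G) : HasHelmholtz (fun u => F u + G u) := by
  obtain ⟨h1, A, a, h2, h3, h4, h5⟩ := hF
  obtain ⟨k1, B, b, k2, k3, k4, k5⟩ := hG
  refine ⟨ContDiff.add h1 k1, fun u => A u + B u, fun u => a u + b u, ContDiff.add h2 k2,
    ContDiff.add h3 k3, fun u => ?_, fun u => ?_⟩
  · rw [divergence_add h2 k2, h4, k4, add_zero]
  · simp only [grad_add h3 k3, h5, k5, Pi.add_apply]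
    abel

lemma hasHelmholtz_zero : HasHelmholtz (fun _ : UnitAddTorus (Fin d) => (0 : Fin d → ℝ)) := by
  refine ⟨isCk_const 0, fun _ => 0, fun _ => 0, isCk_const 0, isCk_const 0, fun u => ?_, fun u => ?_⟩
  · simp [divergence, partialDeriv_const]
  · ext j; simp [grad, partialDeriv_const]

lemma hasHelmholtz_sum {ι : Type*} (s : Finset ι) (F : ι → UnitAddTorus (Fin d) → Fin d → ℝ)
    (hF : ∀ i ∈ s, HasHelmholtz (F i)) : HasHelmholtz (fun u => ∑ i ∈ s, F i u) := by
  classical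
  induction s using Finset.induction_on with
  | empty => simpa using hasHelmholtz_zero
  | insert i s hi ih =>
    simp only [Finset.sum_insert hi]
    exact (hF i (Finset.mem_insert_self i s)).add
      (ih fun j hj => hF j (Finset.mem_insert_of_mem hj))

/-- Trigonometric fields are projected onto divergence free ones mode by mode. -/
lemma hasHelmholtz_mode (a : Fin d → ℂ) (n : Fin d → ℤ) :
    HasHelmholtz (fun u j => mode (a j) n u) := by
  set N : ℂ := ∑ k, (n k : ℂ) ^ 2 with hN
  -- α n is the projection of the coefficient vector a onto the frequency n. For n = 0 the division
  -- by zero returns 0, and α N = a · n still holds.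
  set α : ℂ := (∑ k, a k * n k) / N with hα
  have hαN : α * N = ∑ k, a k * n k := by
    by_cases h : N = 0
    · have h' : ∑ k, ((n k : ℝ)) ^ 2 = 0 := by
        have : ((∑ k, ((n k : ℝ)) ^ 2 : ℝ) : ℂ) = 0 := by push_cast; exact h
        exact_mod_cast this
      have hn : ∀ k, n k = 0 := fun k => by
        have := (Finset.sum_eq_zero_iff_of_nonneg (fun i _ => sq_nonneg ((n i : ℝ)))).1 h' k
          (Finset.mem_univ k)
        simpa using this
      simp [h, hn]
    · rw [hα, div_mul_cancel₀ _ h]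
  have hpi : (2 * Real.pi * Complex.I : ℂ) ≠ 0 := by
    simp [Real.pi_ne_zero]
  refine ⟨isCk_pi fun j => isCk_mode _ n, fun u j => mode (a j - α * n j) n u,
    mode (α / (2 * Real.pi * Complex.I)) n, isCk_pi fun j => isCk_mode _ n, isCk_mode _ n,
    fun u => ?_, fun u => ?_⟩
  · simp only [divergence]
    have : ∀ j, partialDeriv j (fun v => mode (a j - α * n j) n v) u
        = mode (2 * Real.pi * Complex.I * n j * (a j - α * n j)) n u :=
      fun j => partialDeriv_mode _ n j u
    simp only [this, ← mode_sum]
    have h0 : ∑ j, 2 * Real.pi * Complex.I * n j * (a j - α * n j) = 0 := by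
      have : ∀ j, 2 * Real.pi * Complex.I * n j * (a j - α * n j)
          = 2 * Real.pi * Complex.I * (a j * n j) - 2 * Real.pi * Complex.I * (α * (n j : ℂ) ^ 2) :=
        fun j => by ring
      simp only [this, Finset.sum_sub_distrib, ← Finset.mul_sum]
      rw [← hN, hαN, sub_self]
    rw [h0, mode_zero]
  · ext j
    simp only [Pi.add_apply, grad, partialDeriv_mode, ← mode_add]
    congr 1
    field_simp
    ring

/-- Continuous fields are uniform limits of fields with a Helmholtz decomposition. -/
lemma exists_hasHelmholtz_approx (F : VField d) {ε : ℝ} (hε : 0 < ε) :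
    ∃ G : VField d, HasHelmholtz G ∧ ‖F - G‖ ≤ ε := by
  choose q hq h using fun j =>
    exists_trig_approx (⟨fun u => F u j, continuous_component F.continuous j⟩) hε
  have hC : ∀ j, ∀ p ∈ Submodule.span ℂ (range (UnitAddTorus.mFourier (d := Fin d))),
      ∀ c : ℂ, HasHelmholtz fun u => (Pi.single j (c * p u).re : Fin d → ℝ) := by
    intro j p hp
    induction hp using Submodule.span_induction with
    | mem x hx =>
      obtain ⟨n, rfl⟩ := hx
      intro c
      convert hasHelmholtz_mode (Pi.single j c) n using 1
      ext u k
      rcases eq_or_ne k j with rfl | hk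
      · simp [mode]
      · simp [hk, mode]
    | zero => intro c; simpa using hasHelmholtz_zero
    | add x y _ _ hx hy =>
      intro c
      convert (hx c).add (hy c) using 1
      ext u k
      rw [← Pi.single_add]
      simp [mul_add]
    | smul a x _ hx =>
      intro c
      convert hx (c * a) using 1
      ext u k
      simp [mul_assoc]
  have h1 : HasHelmholtz fun u => ∑ j, (Pi.single j (q j u).re : Fin d → ℝ) :=
    hasHelmholtz_sum _ _ fun j _ => by simpa using hC j (q j) (hq j) 1
  refine ⟨⟨_, h1.1.continuous⟩, h1, (ContinuousMap.norm_le _ hε.le).2 fun u => ?_⟩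
  refine (pi_norm_le_iff_of_nonneg hε.le).2 fun k => ?_
  have := (h k u).le
  simpa [Finset.sum_apply, Pi.single_apply] using this

end

section

variable {d : ℕ}

/-! ### Concatenation of paths -/

lemma pairL_add (J K : Current d) : pairL (J + K) = pairL J + pairL K := by
  ext F; exact pair_add_left J K F.continuous

lemma pairL_smul (c : ℝ) (J : Current d) : pairL (c • J) = c • pairL J := by
  ext F; exact pair_smul_left c J F

lemma pairL_zero : pairL (0 : Current d) = 0 := by
  ext F; exact pair_zero_left F

lemma smul_mem_divFree (c : ℝ) {J : Current d} (hJ : J ∈ divFree d) :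
    c • J ∈ divFree d := fun f hf => by
  rw [pair_smul_left, hJ f hf, mul_zero]

lemma zero_mem_divFree : (0 : Current d) ∈ divFree d := fun _ _ => pair_zero_left _

/-- Two functionals agreeing on `C¹` functions are equal. -/
lemma functional_ext_isCk {ℓ ℓ' : C(UnitAddTorus (Fin d), ℝ) →L[ℝ] ℝ}
    (h : ∀ f : C(UnitAddTorus (Fin d), ℝ), IsCk 1 f → ℓ f = ℓ' f) : ℓ = ℓ' := by
  have hd : Dense {f : C(UnitAddTorus (Fin d), ℝ) | IsCk 1 f} := by
    refine Metric.dense_iff.2 fun f r hr => ?_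
    obtain ⟨g, hg, hfg⟩ := exists_isCk_approx f (half_pos hr)
    refine ⟨g, ?_, hg⟩
    rw [Metric.mem_ball, dist_comm, dist_eq_norm]
    linarith
  ext f
  exact congrFun (Continuous.ext_on hd ℓ.continuous ℓ'.continuous h) f

/-- When the total current is divergence free, the density pairs with every C¹ function as γ does.
Two such densities are therefore weakly equal, which is the matching condition for gluing. -/
lemma ContinuityEq.dpairL_eq {γ : UnitAddTorus (Fin d) → ℝ} {T : ℝ} {W : ℝ → Current d}
    {π π' : ℝ → Profile d} {W' : ℝ → Current d} {T' t t' : ℝ} (h : ContinuityEq γ T W π)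
    (h' : ContinuityEq γ T' W' π') (ht : t ∈ Icc 0 T) (ht' : t' ∈ Icc 0 T')
    (hW : W t ∈ divFree d) (hW' : W' t' ∈ divFree d) : dpairL (π t) = dpairL (π' t') := by
  refine functional_ext_isCk fun f hf => ?_
  have h1 := h.1 t ht f hf
  have h2 := h'.1 t' ht' f hf
  rw [hW f hf] at h1
  rw [hW' f hf] at h2
  simp only [dpairL_apply]
  linarith

lemma continuousOn_glue {T S : ℝ} (hT : 0 ≤ T) (hS : 0 ≤ S) {f g : ℝ → ℝ}
    (hf : ContinuousOn f (Icc 0 T)) (hg : ContinuousOn g (Icc 0 S)) (hfg : f T = g 0) :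
    ContinuousOn (fun t => if t ≤ T then f t else g (t - T)) (Icc 0 (T + S)) := by
  have h1 : ContinuousOn (fun t => if t ≤ T then f t else g (t - T)) (Icc 0 T) :=
    hf.congr fun t ht => if_pos ht.2
  have h2 : ContinuousOn (fun t => if t ≤ T then f t else g (t - T)) (Icc T (T + S)) := by
    have : ContinuousOn (fun t => g (t - T)) (Icc T (T + S)) :=
      hg.comp (by fun_prop) fun t ht => ⟨by linarith [ht.1], by linarith [ht.2]⟩
    refine this.congr fun t ht => ?_
    rcases ht.1.eq_or_lt with rfl | h
    · simp [hfg]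
    · exact if_neg (not_le.2 h)
  have := h1.union_of_isClosed h2 isClosed_Icc isClosed_Icc
  rwa [Icc_union_Icc_eq_Icc hT (by linarith)] at this

lemma integral_functional_deriv (ℓ : VField d →L[ℝ] ℝ) {Φ Φ' : ℝ → VField d}
    (h : ∀ t, HasDerivAt Φ (Φ' t) t) (h' : Continuous Φ') (a b : ℝ) :
    ∫ t in a..b, ℓ (Φ' t) = ℓ (Φ b) - ℓ (Φ a) :=
  intervalIntegral.integral_eq_sub_of_hasDerivAt (f := fun t => ℓ (Φ t))
    (fun t _ => ℓ.hasFDerivAt.comp_hasDerivAt t (h t))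
    ((ℓ.continuous.comp h').intervalIntegrable _ _)

/-- The second piece is prescribed only for t > 0, because at the junction a glued path takes the
value of its first piece; one point does not affect the integral. -/
lemma integral_glue {T S : ℝ} (hT : 0 ≤ T) (hS : 0 ≤ S) {f g h : ℝ → ℝ}
    (hi : IntervalIntegrable h volume 0 (T + S)) (hf : ∀ t ∈ Icc 0 T, h t = f t)
    (hg : ∀ t ∈ Ioc 0 S, h (T + t) = g t) :
    ∫ t in (0 : ℝ)..(T + S), h t = (∫ t in (0 : ℝ)..T, f t) + ∫ t in (0 : ℝ)..S, g t := by
  rw [← intervalIntegral.integral_add_adjacent_intervals (b := T)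
    (hi.mono_set (by rw [uIcc_of_le hT, uIcc_of_le (by linarith)]
                     exact Icc_subset_Icc_right (by linarith)))
    (hi.mono_set (by rw [uIcc_of_le (by linarith), uIcc_of_le (by linarith)]
                     exact Icc_subset_Icc_left hT))]
  congr 1
  · refine intervalIntegral.integral_congr fun t ht => ?_
    rw [uIcc_of_le hT] at ht
    exact hf t ht
  · have := intervalIntegral.integral_comp_add_left (a := 0) (b := S) h T
    rw [add_zero] at this
    rw [← this]
    refine intervalIntegral.integral_congr_ae (ae_of_all _ fun t ht => ?_)
    rw [uIoc_of_le hS] at ht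
    exact hg t ht

/-- Concatenation: a path ending with a divergence free total current can be prolonged. -/
theorem HasCostLE.concat {γ : UnitAddTorus (Fin d) → ℝ} {T S M N : ℝ} (hT : 0 < T) (hS : 0 < S)
    {W₁ W₂ : ℝ → Current d} {π₁ π₂ : ℝ → Profile d} (h₁ : HasCostLE γ T W₁ π₁ M)
    (h₂ : HasCostLE γ S W₂ π₂ N) (hW : W₁ T ∈ divFree d) :
    ∃ W π, HasCostLE γ (T + S) W π (M + N) ∧ W (T + S) = W₁ T + W₂ S := by
  set W : ℝ → Current d := fun t => if t ≤ T then W₁ t else W₁ T + W₂ (t - T) with hWdef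
  set π : ℝ → Profile d := fun t => if t ≤ T then π₁ t else π₂ (t - T) with hπdef
  have hW₂0 : W₂ 0 = 0 := h₂.continuityEq.2
  have hWle : ∀ t ≤ T, W t = W₁ t := fun t ht => if_pos ht
  have hπle : ∀ t ≤ T, π t = π₁ t := fun t ht => if_pos ht
  have hWgt : ∀ s > 0, W (T + s) = W₁ T + W₂ s := fun s hs => by
    simp only [hWdef]; rw [if_neg (by linarith), add_sub_cancel_left]
  have hπgt : ∀ s > 0, π (T + s) = π₂ s := fun s hs => by
    simp only [hπdef]; rw [if_neg (by linarith), add_sub_cancel_left]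
  have hweak : WeakPath (T + S) W π := by
    constructor
    · intro F
      refine (continuousOn_glue hT.le hS.le (h₁.weakPath.current F)
        ((h₂.weakPath.current F).const_add (pairL (W₁ T) F)) ?_).congr fun t _ => ?_
      · simp [hW₂0, pairL_zero, -pairL_apply]
      · simp only [hWdef]
        split_ifs
        · rfl
        · rw [pairL_add]; rfl
    · intro f
      refine (continuousOn_glue hT.le hS.le (h₁.weakPath.profile f)
        (h₂.weakPath.profile f) ?_).congr fun t _ => ?_
      · rw [h₁.continuityEq.dpairL_eq h₂.continuityEq ⟨hT.le, le_rfl⟩ ⟨le_rfl, hS.le⟩ hW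
          (hW₂0 ▸ zero_mem_divFree)]
      · simp only [hπdef]
        split_ifs <;> rfl
  refine ⟨W, π, ⟨⟨fun t ht f hf => ?_, ?_⟩, hweak, fun F hF => ?_⟩, hWgt S hS⟩
  · rcases le_or_gt t T with h | h
    · rw [hWle t h, hπle t h]
      exact h₁.continuityEq.1 t ⟨ht.1, h⟩ f hf
    · obtain ⟨s, rfl⟩ : ∃ s, t = T + s := ⟨t - T, by ring⟩
      rw [hWgt s (by linarith), hπgt s (by linarith), pair_add_left _ _ hf.continuous_grad,
        hW f hf, zero_add]
      exact h₂.continuityEq.1 s ⟨by linarith, by linarith [ht.2]⟩ f hf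
  · rw [hWle 0 hT.le]; exact h₁.continuityEq.2
  · have hTS : 0 < T + S := by linarith
    obtain ⟨Φ, Φ', δ, hp⟩ := hF.exists_fieldPath hTS
    have e₁ := h₁.testFunctional_le F (hF.mono (by linarith))
    have e₂ := h₂.testFunctional_le _ (hF.shift hT.le)
    rw [testFunctional_eq hT.le _ _ (hp.mono hT (by linarith))] at e₁
    rw [testFunctional_eq hS.le _ _ (hp.shift hT.le hS)] at e₂
    rw [testFunctional_eq hTS.le _ _ hp]
    have i₁ := integral_glue hT.le hS.le
      (f := fun t => pairL (W₁ t) (Φ' t))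
      (g := fun t => pairL (W₁ T) (Φ' (T + t)) + pairL (W₂ t) (Φ' (T + t)))
      (hweak.intervalIntegrable_current hTS.le hp.continuous_deriv)
      (fun t ht => by rw [hWle t ht.2])
      (fun t ht => by rw [hWgt t ht.1, pairL_add]; rfl)
    have i₂ := integral_glue hT.le hS.le
      (f := fun t => dpairL (π₁ t) (δ t)) (g := fun t => dpairL (π₂ t) (δ (T + t)))
      (hweak.intervalIntegrable_profile hTS.le hp.continuous_div)
      (fun t ht => by rw [hπle t ht.2])
      (fun t ht => by rw [hπgt t ht.1])
    have i₃ := integral_glue hT.le hS.le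
      (f := fun t => energy (π₁ t) (Φ t)) (g := fun t => energy (π₂ t) (Φ (T + t)))
      (hweak.intervalIntegrable_energy hTS.le hp.continuous)
      (fun t ht => by rw [hπle t ht.2])
      (fun t ht => by rw [hπgt t ht.1])
    have hsh : Continuous fun t => Φ' (T + t) := hp.continuous_deriv.comp (by fun_prop)
    have hi : IntervalIntegrable (fun t => pairL (W₁ T) (Φ' (T + t))) volume 0 S :=
      ((pairL (W₁ T)).continuous.comp hsh).intervalIntegrable _ _
    -- The constant W₁ T carried by the second piece integrates to the boundary terms at T + S and
    -- T. They cancel the W₁ T part of the new final term and restore the final term of the first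
    -- piece.
    rw [intervalIntegral.integral_add hi
      (h₂.weakPath.intervalIntegrable_current hS.le hsh),
      integral_functional_deriv (pairL (W₁ T)) (Φ := fun t => Φ (T + t))
        (fun t => (hp.hasDerivAt (T + t)).comp_const_add T t) hsh, add_zero] at i₁
    rw [i₁, i₂, i₃, hWgt S hS, pairL_add, _root_.add_apply]
    linarith

/-- Repetition of a path with divergence free total current. -/
lemma HasCostLE.iterate {γ : UnitAddTorus (Fin d) → ℝ} {T M : ℝ} (hT : 0 < T)
    {W : ℝ → Current d} {π : ℝ → Profile d} (h : HasCostLE γ T W π M) (hW : W T ∈ divFree d)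
    {S N : ℝ} (hS : 0 < S) {V : ℝ → Current d} {ρ : ℝ → Profile d} (h' : HasCostLE γ S V ρ N)
    (k : ℕ) :
    ∃ W' π', HasCostLE γ (k * T + S) W' π' (k * M + N) ∧
      W' (k * T + S) = (k : ℝ) • W T + V S := by
  induction k with
  | zero => exact ⟨V, ρ, by simpa using h', by simp⟩
  | succ k ih =>
    obtain ⟨W', π', h1, h2⟩ := ih
    obtain ⟨W'', π'', h3, h4⟩ := h.concat hT (by positivity) h1 hW
    have e : ((k + 1 : ℕ) : ℝ) * T + S = T + (k * T + S) := by push_cast; ring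
    refine ⟨W'', π'', ?_, ?_⟩
    · rw [e]
      have e' : ((k + 1 : ℕ) : ℝ) * M + N = M + (k * M + N) := by push_cast; ring
      rwa [e']
    · rw [e, h4, h2]
      push_cast
      rw [add_smul, one_smul]
      abel

end

section

variable {d : ℕ}

/-! ### The cost of a vanishing current -/

/-- Assumptions on the initial density: it is `C¹` with mobility bounded away from zero. -/
structure IsRegularDensity (γ : UnitAddTorus (Fin d) → ℝ) (κ : ℝ) : Prop where
  isCk : IsCk 1 γ
  nonneg : ∀ u, 0 ≤ γ u
  le_one : ∀ u, γ u ≤ 1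
  pos : 0 < κ
  le_mobility : ∀ u, κ ≤ mobility (γ u)

lemma exists_isRegularDensity {γ : UnitAddTorus (Fin d) → ℝ} (hγ : IsCk 2 γ)
    (hb : ∃ δ : ℝ, 0 < δ ∧ ∀ u, δ ≤ γ u ∧ γ u ≤ 1 - δ) : ∃ κ, IsRegularDensity γ κ := by
  obtain ⟨δ, hδ, h⟩ := hb
  have h0 := h 0
  -- χ is concave and symmetric about 1/2, so its minimum over [δ, 1-δ] is χ(δ).
  refine ⟨δ * (1 - δ), hγ.of_le (by norm_num), fun u => by linarith [h u], fun u => by linarith [h u],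
    mul_pos hδ (by linarith), fun u => ?_⟩
  obtain ⟨h1, h2⟩ := h u
  unfold mobility
  nlinarith [mul_nonneg (sub_nonneg.2 h1) (by linarith : 0 ≤ 1 - δ - γ u)]

namespace IsRegularDensity

variable {γ : UnitAddTorus (Fin d) → ℝ} {κ : ℝ}

/-- The initial density as a profile. -/
def profile (h : IsRegularDensity γ κ) : Profile d :=
  ⟨γ, h.isCk.continuous.measurable, h.nonneg, h.le_one⟩

lemma exists_grad_bound (h : IsRegularDensity γ κ) : ∃ B, 0 ≤ B ∧ ∀ u j, |grad γ u j| ≤ B := by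
  obtain ⟨C, hC⟩ := (isCompact_range h.isCk.continuous_grad).isBounded.exists_norm_le
  refine ⟨max C 0, le_max_right _ _, fun u j => ?_⟩
  exact (norm_le_pi_norm (grad γ u) j).trans ((hC _ ⟨u, rfl⟩).trans (le_max_left _ _))

lemma dpair_divergence (h : IsRegularDensity γ κ) {F : UnitAddTorus (Fin d) → Fin d → ℝ}
    (hF : IsCk 1 F) : dpair γ (divergence F) = - ∫ u, ∑ j, grad γ u j * F u j :=
  integral_mul_divergence h.isCk hF

/-- Integration by parts moves the divergence onto γ; then (1/2)gx - (κ/2)x² ≤ g²/(8κ) is applied to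
each component. -/
lemma slice_bound (h : IsRegularDensity γ κ) {B : ℝ} (hB : ∀ u j, |grad γ u j| ≤ B)
    {F : UnitAddTorus (Fin d) → Fin d → ℝ} (hF : IsCk 1 F) :
    - (1 / 2) * dpair γ (divergence F) - (1 / 2) * energy h.profile F ≤ d * (B ^ 2 / (8 * κ)) := by
  have hκ := h.pos
  have hc : ∀ j, Continuous fun u => F u j := continuous_component hF.continuous
  have i1 : Integrable fun u => ∑ j, grad γ u j * F u j :=
    integrable_of_continuous_torus (continuous_finsetSum _ fun j _ =>
      (continuous_component h.isCk.continuous_grad j).mul (hc j))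
  have i2 : Integrable fun u => mobility (h.profile.toFun u) * ∑ j, (F u j) ^ 2 :=
    h.profile.integrable_mobility_mul (integrable_of_continuous_torus
      (continuous_finsetSum _ fun j _ => (hc j).pow 2))
  rw [h.dpair_divergence hF, energy, dpair]
  calc _ = ∫ u, ((1 / 2) * ∑ j, grad γ u j * F u j
        - (1 / 2) * (mobility (h.profile.toFun u) * ∑ j, (F u j) ^ 2)) := by
        rw [integral_sub (i1.const_mul _) (i2.const_mul _), integral_const_mul, integral_const_mul]
        ring
    _ ≤ ∫ u : UnitAddTorus (Fin d), (d * (B ^ 2 / (8 * κ)) : ℝ) := by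
        refine integral_mono ((i1.const_mul _).sub (i2.const_mul _)) (integrable_const _) fun u => ?_
        have hm : κ ≤ mobility (h.profile.toFun u) := h.le_mobility u
        have h1 : κ * ∑ j, (F u j) ^ 2 ≤ mobility (h.profile.toFun u) * ∑ j, (F u j) ^ 2 :=
          mul_le_mul_of_nonneg_right hm (Finset.sum_nonneg fun _ _ => sq_nonneg _)
        have h2 : ∑ j, ((1 / 2) * (grad γ u j * F u j) - (1 / 2) * (κ * (F u j) ^ 2))
            ≤ ∑ j : Fin d, B ^ 2 / (8 * κ) := by
          refine Finset.sum_le_sum fun j _ => ?_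
          have hg : (grad γ u j) ^ 2 ≤ B ^ 2 := by
            rw [← sq_abs]
            exact pow_le_pow_left₀ (abs_nonneg _) (hB u j) 2
          rw [le_div_iff₀ (by positivity)]
          nlinarith [sq_nonneg (grad γ u j - 2 * κ * F u j)]
        rw [Finset.sum_sub_distrib, ← Finset.mul_sum, ← Finset.mul_sum, ← Finset.mul_sum] at h2
        simp only [Finset.sum_const, Finset.card_univ, Fintype.card_fin, nsmul_eq_mul] at h2
        linarith
    _ = _ := by simp

/-- Staying at γ with no current is an admissible filler for any length of time, at a cost linear in
that length: the slice bound is integrated in time. -/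
lemma exists_zero_current_cost (h : IsRegularDensity γ κ) :
    ∃ C, 0 ≤ C ∧ ∀ S > 0, HasCostLE γ S (fun _ => 0) (fun _ => h.profile) (C * S) := by
  obtain ⟨B, hB0, hB⟩ := h.exists_grad_bound
  have hκ := h.pos
  refine ⟨d * (B ^ 2 / (8 * κ)), by positivity, fun S hS => ⟨⟨fun t _ f _ => ?_, rfl⟩,
    ⟨fun F => continuousOn_const, fun f => continuousOn_const⟩, fun F hF => ?_⟩⟩
  · rw [pair_zero_left]
    exact sub_self _
  · obtain ⟨Φ, Φ', δ, hp⟩ := hF.exists_fieldPath hS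
    have hw : WeakPath S (fun _ => (0 : Current d)) (fun _ => h.profile) :=
      ⟨fun F => continuousOn_const, fun f => continuousOn_const⟩
    have i1 := (hw.intervalIntegrable_profile hS.le hp.continuous_div).const_mul (-(1 / 2))
    have i2 := (hw.intervalIntegrable_energy hS.le hp.continuous).const_mul (1 / 2)
    rw [testFunctional_eq hS.le _ _ hp]
    simp only [pairL_zero, _root_.zero_apply, intervalIntegral.integral_zero]
    calc _ = ∫ t in (0 : ℝ)..S, (-(1 / 2) * dpairL h.profile (δ t)
          - (1 / 2) * energy h.profile (Φ t)) := by
          rw [intervalIntegral.integral_sub i1 i2, intervalIntegral.integral_const_mul,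
            intervalIntegral.integral_const_mul]
          ring
      _ ≤ ∫ t in (0 : ℝ)..S, (d * (B ^ 2 / (8 * κ)) : ℝ) := by
          refine intervalIntegral.integral_mono_on hS.le (i1.sub i2)
            intervalIntegrable_const fun t ht => ?_
          have := h.slice_bound hB (hF.isCk ht)
          rw [hp.divergence_eq t ht, hp.eqOn t ht] at this
          exact this
      _ = _ := by simp; ring

end IsRegularDensity

/-! ### Coercivity on divergence free currents -/

/-- Divergence free fields and gradients are orthogonal in L², by integration by parts, so removing
the gradient part does not increase the norm. -/
lemma integral_sqLength_le_of_helmholtz {F G : UnitAddTorus (Fin d) → Fin d → ℝ}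
    {g : UnitAddTorus (Fin d) → ℝ} (hG : IsCk 1 G) (hg : IsCk 1 g)
    (hdiv : ∀ u, divergence G u = 0) (hF : ∀ u, F u = G u + grad g u) :
    ∫ u, ∑ j, (G u j) ^ 2 ≤ ∫ u, ∑ j, (F u j) ^ 2 := by
  have h1 := integral_mul_divergence hg hG
  simp only [hdiv, mul_zero, integral_zero] at h1
  have i1 : Integrable fun u => ∑ j, (G u j) ^ 2 := integrable_of_continuous_torus
    (continuous_finsetSum _ fun j _ => (continuous_component hG.continuous j).pow 2)
  have i2 : Integrable fun u => ∑ j, grad g u j * G u j := integrable_of_continuous_torus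
    (continuous_finsetSum _ fun j _ => (continuous_component hg.continuous_grad j).mul
      (continuous_component hG.continuous j))
  have hFc : Continuous F := by
    rw [funext hF]; exact hG.continuous.add hg.continuous_grad
  have i3 : Integrable fun u => ∑ j, (F u j) ^ 2 := integrable_of_continuous_torus
    (continuous_finsetSum _ fun j _ => (continuous_component hFc j).pow 2)
  have h2 : ∫ u, (∑ j, (G u j) ^ 2 + 2 * ∑ j, grad g u j * G u j) ≤ ∫ u, ∑ j, (F u j) ^ 2 := by
    refine integral_mono (i1.add (i2.const_mul 2)) i3 fun u => ?_
    simp only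
    rw [Finset.mul_sum, ← Finset.sum_add_distrib]
    refine Finset.sum_le_sum fun j _ => ?_
    rw [hF u, Pi.add_apply]
    nlinarith [sq_nonneg (grad g u j)]
  rw [integral_add i1 (i2.const_mul 2), integral_const_mul] at h2
  linarith

/-- For a divergence free G constant in time, both the time derivative and the divergence terms of
the test functional vanish, and χ ≤ 1/4 bounds the rest. A general field loses only its gradient
part, which W_T does not see; density of fields with a Helmholtz decomposition finishes. -/
theorem HasCostLE.pair_le {γ : UnitAddTorus (Fin d) → ℝ} {T M : ℝ} (hT : 0 < T)
    {W : ℝ → Current d} {π : ℝ → Profile d} (h : HasCostLE γ T W π M) (hW : W T ∈ divFree d)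
    (F : VField d) : pairL (W T) F ≤ M + T / 8 * integralL d (sqLength F) := by
  have hcl : IsClosed {F : VField d | pairL (W T) F ≤ M + T / 8 * integralL d (sqLength F)} :=
    isClosed_le (pairL (W T)).continuous
      (continuous_const.add (continuous_const.mul ((integralL d).continuous.comp continuous_sqLength)))
  have hd : Dense {F : VField d | HasHelmholtz F} := by
    refine Metric.dense_iff.2 fun F r hr => ?_
    obtain ⟨G, hG, hFG⟩ := exists_hasHelmholtz_approx F (half_pos hr)
    refine ⟨G, ?_, hG⟩
    rw [Metric.mem_ball, dist_comm, dist_eq_norm]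
    linarith
  suffices hs : {F : VField d | HasHelmholtz F} ⊆
      {F : VField d | pairL (W T) F ≤ M + T / 8 * integralL d (sqLength F)} from
    (hcl.closure_subset_iff.2 hs) (hd F)
  rintro F ⟨-, G, g, hG, hg, hdiv, hF⟩
  obtain ⟨G, rfl⟩ : ∃ G' : VField d, G' = G := ⟨⟨G, hG.continuous⟩, rfl⟩
  have h1 := h.testFunctional_le _ (isC11_const hG T)
  have hd0 : divergence G = (0 : C(UnitAddTorus (Fin d), ℝ)) := funext hdiv
  rw [testFunctional_eq hT.le _ _ (fieldPath_const hT G hd0)] at h1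
  simp only [map_zero, intervalIntegral.integral_zero, mul_zero, sub_zero] at h1
  have h2 : ∫ t in (0 : ℝ)..T, energy (π t) G ≤ T * (1 / 4 * integralL d (sqLength G)) := by
    have := intervalIntegral.integral_mono_on hT.le
      (h.weakPath.intervalIntegrable_energy hT.le (continuous_const (y := G)))
      (intervalIntegrable_const (c := 1 / 4 * integralL d (sqLength G))) fun t _ => by
        rw [integralL_apply]; exact energy_le (π t) G
    rwa [intervalIntegral.integral_const, sub_zero, smul_eq_mul] at this
  have h3 : pairL (W T) F = pairL (W T) G := by
    have : F = G + ⟨grad g, hg.continuous_grad⟩ := by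
      ext u : 1; exact hF u
    rw [this, map_add, add_eq_left]
    exact hW g hg
  have h4 : integralL d (sqLength G) ≤ integralL d (sqLength F) := by
    rw [integralL_apply, integralL_apply]
    exact integral_sqLength_le_of_helmholtz hG hg hdiv hF
  have h6 := mul_le_mul_of_nonneg_left h4 hT.le
  change pairL (W T) F ≤ _
  rw [h3]
  linarith

lemma integralL_sqLength_le (F : VField d) : integralL d (sqLength F) ≤ d * ‖F‖ ^ 2 := by
  rw [integralL_apply]
  have : ∀ u, sqLength F u ≤ d * ‖F‖ ^ 2 := fun u => by
    have : ∑ j, (F u j) ^ 2 ≤ ∑ _j : Fin d, ‖F‖ ^ 2 := Finset.sum_le_sum fun j _ => by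
      rw [← sq_abs]
      exact pow_le_pow_left₀ (abs_nonneg _)
        ((norm_le_pi_norm (F u) j).trans (F.norm_coe_le_norm u)) 2
    simpa using this
  calc _ ≤ ∫ _u : UnitAddTorus (Fin d), (d * ‖F‖ ^ 2 : ℝ) :=
        integral_mono (integrable_of_continuous_torus (sqLength F).continuous)
          (integrable_const _) this
    _ = _ := by simp

/-- Divergence free mean currents of bounded cost are bounded. -/
theorem HasCostLE.abs_pair_le {γ : UnitAddTorus (Fin d) → ℝ} {T c : ℝ} (hT : 0 < T)
    {W : ℝ → Current d} {π : ℝ → Profile d} (h : HasCostLE γ T W π (c * T)) {J : Current d}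
    (hW : W T = T • J) (hJ : J ∈ divFree d) (F : VField d) :
    |pairL J F| ≤ (c + d / 8) * ‖F‖ := by
  have hW' : W T ∈ divFree d := hW ▸ smul_mem_divFree T hJ
  have key : ∀ G : VField d, pairL J G ≤ c + d / 8 * ‖G‖ ^ 2 := fun G => by
    have h1 := h.pair_le hT hW' G
    rw [hW, pairL_smul, _root_.smul_apply, smul_eq_mul] at h1
    have h2 := integralL_sqLength_le G
    have h3 : T * pairL J G ≤ T * (c + d / 8 * ‖G‖ ^ 2) := by nlinarith
    exact le_of_mul_le_mul_left h3 hT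
  -- The quadratic estimate on the unit sphere becomes a linear one by homogeneity.
  have key2 : ∀ G : VField d, pairL J G ≤ (c + d / 8) * ‖G‖ := fun G => by
    rcases eq_or_ne G 0 with rfl | hG
    · rw [map_zero, norm_zero, mul_zero]
    · have hn : 0 < ‖G‖ := norm_pos_iff.2 hG
      have h1 := key (‖G‖⁻¹ • G)
      rw [map_smul, norm_smul, norm_inv, norm_norm, inv_mul_cancel₀ hn.ne', smul_eq_mul,
        inv_mul_le_iff₀ hn] at h1
      linarith
  refine abs_le.2 ⟨?_, key2 F⟩
  have := key2 (-F)
  rw [map_neg, norm_neg] at this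
  linarith

/-- Bounded families of currents converge weakly if they do so on a dense set of fields. -/
lemma tendsto_current_of_dense {α : Type*} {l : Filter α} {y : α → Current d} {J : Current d}
    {B : ℝ} (hB : ∀ᶠ a in l, ∀ F, |pairL (y a) F| ≤ B * ‖F‖) {D : Set (VField d)} (hD : Dense D)
    (h : ∀ F ∈ D, Tendsto (fun a => pairL (y a) F) l (𝓝 (pairL J F))) : Tendsto y l (𝓝 J) := by
  refine tendsto_current_iff.2 fun F => Metric.tendsto_nhds.2 fun ε hε => ?_
  set C := |B| + ‖pairL J‖ + 1 with hC
  have hCpos : 0 < C := by positivity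
  obtain ⟨G, hG, hGD⟩ := Metric.dense_iff.1 hD F (ε / (2 * C)) (by positivity)
  rw [Metric.mem_ball, dist_comm, dist_eq_norm] at hG
  filter_upwards [hB, Metric.tendsto_nhds.1 (h G hGD) (ε / 2) (half_pos hε)] with a ha hd
  rw [Real.dist_eq] at hd ⊢
  have h1 : |pairL (y a) (F - G)| ≤ |B| * ‖F - G‖ :=
    (ha _).trans (mul_le_mul_of_nonneg_right (le_abs_self B) (norm_nonneg _))
  have h2 : |pairL J (F - G)| ≤ ‖pairL J‖ * ‖F - G‖ := (pairL J).le_opNorm _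
  have h3 : C * ‖F - G‖ < ε / 2 := by
    calc _ < C * (ε / (2 * C)) := mul_lt_mul_of_pos_left hG hCpos
      _ = _ := by field_simp
  have h4 : pairL (y a) F - pairL J F
      = pairL (y a) (F - G) + (pairL (y a) G - pairL J G) - pairL J (F - G) := by
    simp only [map_sub]; ring
  change |pairL (y a) F - pairL J F| < ε
  rw [h4]
  have h5 := abs_sub (pairL (y a) (F - G) + (pairL (y a) G - pairL J G)) (pairL J (F - G))
  have h6 := abs_add_le (pairL (y a) (F - G)) (pairL (y a) G - pairL J G)
  nlinarith [norm_nonneg (F - G)]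

end

section

variable {d : ℕ}

/-! ### Recovery families -/

/-- Recovery family for a divergence free current: repeat an almost optimal path and stop. -/
lemma IsRegularDensity.exists_recovery {γ : UnitAddTorus (Fin d) → ℝ} {κ : ℝ}
    (hγ : IsRegularDensity γ κ) {J : Current d} (hJ : J ∈ divFree d) {c : ℝ} (hc : 0 ≤ c)
    {T₀ : ℝ} (hT₀ : 0 < T₀) (h : Phi_T γ T₀ J < ENNReal.ofReal c) :
    ∃ (a : ℝ → ℝ) (B : ℝ), 0 ≤ B ∧ ∀ T ≥ T₀, 0 ≤ a T ∧ a T ≤ 1 ∧ 1 - a T ≤ B / T ∧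
      Phi_T γ T (a T • J) ≤ ENNReal.ofReal (c + B / T) := by
  obtain ⟨W, π, hW, hWJ⟩ := exists_hasCostLE_of_phi_T_lt hT₀ hc h
  obtain ⟨C, hC0, hC⟩ := hγ.exists_zero_current_cost
  -- One period fewer than fits, so that the idle time S lies in [T₀, 2T₀] and is never zero.
  let k : ℝ → ℕ := fun T => ⌊T / T₀⌋₊ - 1
  refine ⟨fun T => k T * T₀ / T, 2 * T₀ * (C + 1), by positivity, fun T hT => ?_⟩
  have hTpos : 0 < T := hT₀.trans_le hT
  have h1 : 1 ≤ ⌊T / T₀⌋₊ := Nat.le_floor (by rw [Nat.cast_one, one_le_div hT₀]; exact hT)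
  have hk : (k T : ℝ) = ⌊T / T₀⌋₊ - 1 := by simp [k, Nat.cast_sub h1]
  have h2 : (⌊T / T₀⌋₊ : ℝ) * T₀ ≤ T := by
    rw [← le_div_iff₀ hT₀]; exact Nat.floor_le (by positivity)
  have h3 : T < (⌊T / T₀⌋₊ + 1 : ℝ) * T₀ := by
    rw [← div_lt_iff₀ hT₀]; exact Nat.lt_floor_add_one _
  set S := T - k T * T₀ with hS
  have hS1 : T₀ ≤ S := by rw [hS, hk]; linarith
  have hS2 : S ≤ 2 * T₀ := by rw [hS, hk]; linarith
  have hSpos : 0 < S := hT₀.trans_le hS1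
  have hsum : k T * T₀ + S = T := by rw [hS]; ring
  obtain ⟨W', π', h4, h5⟩ := hW.iterate hT₀ (hWJ ▸ smul_mem_divFree T₀ hJ) hSpos (hC S hSpos) (k T)
  rw [hsum] at h4 h5
  refine ⟨by positivity, ?_, ?_, ?_⟩
  · rw [div_le_one hTpos]; linarith
  · have : 1 - k T * T₀ / T = S / T := by
      rw [hS]; field_simp
    rw [this]
    gcongr
    nlinarith
  · refine (h4.phi_T_le hTpos ?_).trans (ENNReal.ofReal_le_ofReal ?_)
    · rw [h5, hWJ, add_zero, smul_smul, smul_smul, mul_div_cancel₀ _ hTpos.ne']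
    · rw [div_le_iff₀ hTpos, add_mul, div_mul_cancel₀ _ hTpos.ne']
      have e1 : k T * (c * T₀) ≤ c * T := by
        have : c * (k T * T₀) ≤ c * T := mul_le_mul_of_nonneg_left (by linarith) hc
        linarith
      have e2 : C * S ≤ C * (2 * T₀) := mul_le_mul_of_nonneg_left hS2 hC0
      nlinarith

/-- Divergence free mean currents of cost below `c` are bounded by `c + d / 8`. -/
lemma abs_pair_le_of_phi_T_lt {γ : UnitAddTorus (Fin d) → ℝ} {T c : ℝ} (hT : 0 < T)
    (hc : 0 ≤ c) {J : Current d} (hJ : J ∈ divFree d) (h : Phi_T γ T J < ENNReal.ofReal c)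
    (F : VField d) : |pairL J F| ≤ (c + d / 8) * ‖F‖ := by
  obtain ⟨W, π, hW, hWJ⟩ := exists_hasCostLE_of_phi_T_lt hT hc h
  exact hW.abs_pair_le hT hWJ hJ F

/-- Approximate recovery, near the values of finitely many test fields. -/
lemma IsRegularDensity.eventually_exists_approx {γ : UnitAddTorus (Fin d) → ℝ} {κ : ℝ}
    (hγ : IsRegularDensity γ κ) {J : Current d} {m : ℝ} (hm : 0 ≤ m)
    (hJ : Phi γ J ≤ ENNReal.ofReal m) (s : Finset (VField d)) {ε : ℝ} (hε : 0 < ε) :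
    ∀ᶠ T in atTop, ∃ y : Current d, (∀ F ∈ s, |pairL y F - pairL J F| < ε) ∧
      (∀ F, |pairL y F| ≤ (m + ε + d / 8) * ‖F‖) ∧ Phi_T γ T y ≤ ENNReal.ofReal (m + 2 * ε) := by
  -- The envelope provides a divergence free K in this neighbourhood with Φ̃(K) < m + ε. The other
  -- half of ε is left for the passage from K to a(T)K.
  let U : Set (Current d) := {K | ∀ F ∈ s, |pairL K F - pairL J F| < ε / 2}
  have hU : IsOpen U := by
    have : U = ⋂ F ∈ s, {K | |pairL K F - pairL J F| < ε / 2} := by ext; simp [U]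
    rw [this]
    refine isOpen_biInter_finset fun F _ => ?_
    have hc : Continuous fun K : Current d => pairL K F :=
      continuous_iff_continuousAt.2 fun K => tendsto_current_iff.1 tendsto_id F
    exact isOpen_lt ((hc.sub continuous_const).abs) continuous_const
  have hJU : J ∈ U := fun F _ => by simpa using half_pos hε
  have h1 : ⨅ K ∈ U, PhiTilde γ K < ENNReal.ofReal (m + ε) := by
    refine lt_of_le_of_lt ((le_iSup₂ (f := fun (U : Set (Current d)) (_ : IsOpen U ∧ J ∈ U) =>
      ⨅ J' ∈ U, PhiTilde γ J') U ⟨hU, hJU⟩).trans hJ) ?_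
    exact (ENNReal.ofReal_lt_ofReal_iff (by linarith)).2 (by linarith)
  simp only [iInf_lt_iff] at h1
  obtain ⟨K, hKU, hK⟩ := h1
  rw [PhiTilde] at hK
  split_ifs at hK with hKd
  swap
  · exact absurd hK (by simp)
  simp only [iInf_lt_iff] at hK
  obtain ⟨T₀, hT₀, hK⟩ := hK
  obtain ⟨a, B, hB0, ha⟩ := hγ.exists_recovery hKd (by linarith) hT₀ hK
  -- This bound on K does not depend on the chosen test fields: it controls the loss (1 - a(T))K and
  -- keeps all approximants in one bounded set.
  have hbd := abs_pair_le_of_phi_T_lt hT₀ (by linarith) hKd hK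
  have hlim : Tendsto (fun T : ℝ => B / T) atTop (𝓝 0) := tendsto_const_nhds.div_atTop tendsto_id
  have hlim2 : ∀ᶠ T : ℝ in atTop, ∀ F ∈ s, B / T * ((m + ε + d / 8) * ‖F‖) < ε / 2 := by
    refine (Filter.eventually_all_finset s).2 fun F _ => ?_
    have : Tendsto (fun T : ℝ => B / T * ((m + ε + d / 8) * ‖F‖)) atTop (𝓝 0) := by
      simpa using hlim.mul_const ((m + ε + d / 8) * ‖F‖)
    exact this.eventually (gt_mem_nhds (half_pos hε))
  filter_upwards [eventually_ge_atTop T₀, hlim.eventually (gt_mem_nhds hε), hlim2]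
    with T hT hTε hT2
  obtain ⟨ha0, ha1, ha2, ha3⟩ := ha T hT
  refine ⟨a T • K, fun F hF => ?_, fun F => ?_, ha3.trans (ENNReal.ofReal_le_ofReal (by linarith))⟩
  · have e1 := hKU F hF
    have e2 := hT2 F hF
    have e3 : |(1 - a T) * pairL K F| ≤ B / T * ((m + ε + d / 8) * ‖F‖) := by
      rw [abs_mul, abs_of_nonneg (by linarith)]
      exact mul_le_mul ha2 (hbd F) (abs_nonneg _) (by linarith)
    rw [pairL_smul, _root_.smul_apply, smul_eq_mul]
    have e4 : a T * pairL K F - pairL J F = (pairL K F - pairL J F) - (1 - a T) * pairL K F := by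
      ring
    rw [e4]
    exact (abs_sub _ _).trans_lt (by linarith)
  · rw [pairL_smul, _root_.smul_apply, smul_eq_mul, abs_mul, abs_of_nonneg ha0]
    have := abs_nonneg (pairL K F)
    nlinarith [hbd F]

/-- The upper bound of the `Γ`-convergence. -/
theorem IsRegularDensity.exists_recovery_family {γ : UnitAddTorus (Fin d) → ℝ} {κ : ℝ}
    (hγ : IsRegularDensity γ κ) (J : Current d) :
    ∃ y : ℝ → Current d, Tendsto y atTop (𝓝 J) ∧
      limsup (fun T => Phi_T γ T (y T)) atTop ≤ Phi γ J := by
  classical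
  rcases eq_or_ne (Phi γ J) ⊤ with htop | htop
  · exact ⟨fun _ => J, tendsto_const_nhds, htop ▸ le_top⟩
  set m := (Phi γ J).toReal with hm
  have hm0 : 0 ≤ m := ENNReal.toReal_nonneg
  have hJm : Phi γ J = ENNReal.ofReal m := (ENNReal.ofReal_toReal htop).symm
  -- On bounded sets of currents, convergence against a countable dense family of fields suffices,
  -- so a diagonal argument is available although the weak topology is not assumed metrizable.
  let F : ℕ → VField d := TopologicalSpace.denseSeq (VField d)
  let ε : ℕ → ℝ := fun n => 1 / ((n : ℝ) + 1)
  have hε : ∀ n, 0 < ε n := fun n => Nat.one_div_pos_of_nat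
  have hε1 : ∀ n, ε n ≤ 1 := fun n => by
    rw [div_le_one (by positivity)]
    linarith [n.cast_nonneg (α := ℝ)]
  have hεanti : ∀ {n k : ℕ}, n ≤ k → ε k ≤ ε n := fun h => Nat.one_div_le_one_div h
  let P : ℕ → ℝ → Current d → Prop := fun n T y =>
    (∀ i ≤ n, |pairL y (F i) - pairL J (F i)| < ε n) ∧
    (∀ G, |pairL y G| ≤ (m + 1 + d / 8) * ‖G‖) ∧ Phi_T γ T y ≤ ENNReal.ofReal (m + 2 * ε n)
  have hP : ∀ n, ∀ᶠ T in atTop, ∃ y, P n T y := fun n => by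
    filter_upwards [hγ.eventually_exists_approx hm0 hJm.le
      ((Finset.range (n + 1)).image F) (hε n)] with T ⟨y, h1, h2, h3⟩
    refine ⟨y, fun i hi => h1 _ (Finset.mem_image_of_mem F (Finset.mem_range.2 (by omega))),
      fun G => (h2 G).trans ?_, h3⟩
    gcongr
    exact hε1 n
  -- The finest accuracy attainable at time T, capped by ⌊T⌋ so that a greatest one exists. It tends
  -- to infinity since each accuracy is eventually attainable.
  let N : ℝ → ℕ := fun T => Nat.findGreatest (fun n => ∃ y, P n T y) ⌊T⌋₊
  have hN : ∀ n, ∀ᶠ T in atTop, n ≤ N T ∧ ∃ y, P (N T) T y := fun n => by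
    filter_upwards [hP n, eventually_ge_atTop (n : ℝ)] with T hT hTn
    have hle : n ≤ ⌊T⌋₊ := Nat.le_floor hTn
    exact ⟨Nat.le_findGreatest hle hT, Nat.findGreatest_spec (P := fun n => ∃ y, P n T y) hle hT⟩
  let y : ℝ → Current d := fun T => if h : ∃ y, P (N T) T y then h.choose else J
  have hy : ∀ n, ∀ᶠ T in atTop, n ≤ N T ∧ P (N T) T (y T) := fun n => by
    filter_upwards [hN n] with T hT
    refine ⟨hT.1, ?_⟩
    simp only [y]
    rw [dif_pos hT.2]
    exact hT.2.choose_spec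
  refine ⟨y, ?_, ?_⟩
  · refine tendsto_current_of_dense (B := m + 1 + d / 8) ((hy 0).mono fun T hT => hT.2.2.1)
      (TopologicalSpace.denseRange_denseSeq (VField d)) ?_
    rintro _ ⟨i, rfl⟩
    refine Metric.tendsto_nhds.2 fun r hr => ?_
    obtain ⟨n, hn⟩ := exists_nat_one_div_lt hr
    filter_upwards [hy (max i n)] with T hT
    rw [Real.dist_eq]
    exact (hT.2.1 i ((le_max_left _ _).trans hT.1)).trans_le
      ((hεanti ((le_max_right _ _).trans hT.1)).trans hn.le)
  · rw [hJm]
    have hlim : Tendsto (fun n => ENNReal.ofReal (m + 2 * ε n)) atTop (𝓝 (ENNReal.ofReal m)) := by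
      refine ENNReal.tendsto_ofReal ?_
      have : Tendsto ε atTop (𝓝 0) := tendsto_one_div_add_atTop_nhds_zero_nat
      simpa using (this.const_mul 2).const_add m
    refine ge_of_tendsto' hlim fun n => ?_
    refine limsup_le_of_le (by isBoundedDefault) ?_
    filter_upwards [hy n] with T hT
    exact hT.2.2.2.trans (ENNReal.ofReal_le_ofReal (by linarith [hεanti hT.1]))

end

section

variable {d : ℕ}

/-! ### A bounded right inverse of the divergence, in dual form -/

/-- The representative in `(0,1]ᵈ` of a point of the torus. -/
def torusRep (v : UnitAddTorus (Fin d)) : Fin d → ℝ := fun j => (AddCircle.equivIoc 1 0 (v j) : ℝ)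

lemma torusMk_torusRep (v : UnitAddTorus (Fin d)) : torusMk (torusRep v) = v := by
  ext j
  exact (AddCircle.equivIoc 1 0).symm_apply_apply (v j)

lemma measurable_torusRep : Measurable (torusRep (d := d)) :=
  measurable_pi_lambda _ fun j => measurable_subtype_coe.comp
    ((AddCircle.measurableEquivIoc 1 0).measurable.comp (measurable_pi_apply j))

lemma abs_torusRep_le (v : UnitAddTorus (Fin d)) (j : Fin d) : |torusRep v j| ≤ 1 := by
  have h1 : 0 < torusRep v j := (AddCircle.equivIoc 1 0 (v j)).2.1
  have h2 : torusRep v j ≤ 0 + 1 := (AddCircle.equivIoc 1 0 (v j)).2.2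
  exact abs_le.2 ⟨by linarith, by linarith⟩

/-- The uniform measure on end points and times of straight segments. -/
def segmentMeasure (d : ℕ) : Measure (UnitAddTorus (Fin d) × ℝ) :=
  (volume : Measure (UnitAddTorus (Fin d))).prod (volume.restrict (Ioc 0 1))

instance : IsProbabilityMeasure (volume.restrict (Ioc (0 : ℝ) 1)) := ⟨by simp⟩

instance (d : ℕ) : IsProbabilityMeasure (segmentMeasure d) := by
  unfold segmentMeasure; infer_instance

/-- The displacement along a segment. -/
def segmentShift (p : UnitAddTorus (Fin d) × ℝ) : UnitAddTorus (Fin d) :=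
  torusMk (p.2 • torusRep p.1)

lemma measurable_segmentShift : Measurable (segmentShift (d := d)) :=
  continuous_torusMk.measurable.comp
    (measurable_snd.smul (measurable_torusRep.comp measurable_fst))

/-- The integrand of the line integral of `F` along segments starting at `x`. -/
def segmentIntegrand (F : VField d) (x : UnitAddTorus (Fin d)) (p : UnitAddTorus (Fin d) × ℝ) : ℝ :=
  ∑ j, torusRep p.1 j * F (x + segmentShift p) j

lemma measurable_segmentIntegrand (F : VField d) :
    Measurable fun q : UnitAddTorus (Fin d) × (UnitAddTorus (Fin d) × ℝ) =>
      segmentIntegrand F q.1 q.2 := by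
  refine Finset.measurable_sum _ fun j _ => Measurable.mul ?_ ?_
  · exact (measurable_pi_apply j).comp
      (measurable_torusRep.comp (measurable_fst.comp measurable_snd))
  · exact (continuous_component F.continuous j).measurable.comp
      (measurable_fst.add (measurable_segmentShift.comp measurable_snd))

lemma measurable_segmentIntegrand_right (F : VField d) (x : UnitAddTorus (Fin d)) :
    Measurable (segmentIntegrand F x) :=
  (measurable_segmentIntegrand F).comp measurable_prodMk_left

lemma abs_segmentIntegrand_le (F : VField d) (x : UnitAddTorus (Fin d))
    (p : UnitAddTorus (Fin d) × ℝ) :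
    |segmentIntegrand F x p| ≤ ∑ j, |F (x + segmentShift p) j| := by
  refine (Finset.abs_sum_le_sum_abs _ _).trans (Finset.sum_le_sum fun j _ => ?_)
  rw [abs_mul]
  exact mul_le_of_le_one_left (abs_nonneg _) (abs_torusRep_le _ j)

lemma sum_abs_le (F : VField d) (x : UnitAddTorus (Fin d)) : ∑ j, |F x j| ≤ d * ‖F‖ := by
  have : ∑ j, |F x j| ≤ ∑ _j : Fin d, ‖F‖ := Finset.sum_le_sum fun j _ =>
    (norm_le_pi_norm (F x) j).trans (F.norm_coe_le_norm x)
  simpa using this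

lemma integrable_segmentIntegrand (F : VField d) (x : UnitAddTorus (Fin d)) :
    Integrable (segmentIntegrand F x) (segmentMeasure d) :=
  Integrable.of_bound (measurable_segmentIntegrand_right F x).aestronglyMeasurable (d * ‖F‖)
    (ae_of_all _ fun p => (abs_segmentIntegrand_le F x p).trans (sum_abs_le F _))

/-- The operator `B`, which satisfies `B (∇φ) = φ - ∫ φ`. -/
def potentialL (d : ℕ) : VField d →L[ℝ] C(UnitAddTorus (Fin d), ℝ) :=
  LinearMap.mkContinuous
    { toFun := fun F =>
        ⟨fun x => - ∫ p, segmentIntegrand F x p ∂(segmentMeasure d),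
          (continuous_of_dominated
            (fun x => (measurable_segmentIntegrand_right F x).aestronglyMeasurable)
            (fun x => ae_of_all _ fun p =>
              (abs_segmentIntegrand_le F x p).trans (sum_abs_le F _))
            (integrable_const (d * ‖F‖))
            (ae_of_all _ fun p => continuous_finsetSum _ fun j _ => continuous_const.mul
              ((continuous_component F.continuous j).comp (by fun_prop)))).neg⟩
      map_add' := fun F G => by
        ext x
        simp only [ContinuousMap.coe_mk, ContinuousMap.add_apply]
        rw [← neg_add, ← integral_add (integrable_segmentIntegrand F x)
          (integrable_segmentIntegrand G x)]
        congr 2; ext p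
        simp only [segmentIntegrand, ContinuousMap.add_apply, Pi.add_apply, mul_add,
          Finset.sum_add_distrib]
      map_smul' := fun c F => by
        ext x
        simp only [ContinuousMap.coe_mk, ContinuousMap.smul_apply, RingHom.id_apply, smul_eq_mul]
        rw [mul_neg, ← integral_const_mul]
        congr 2; ext p
        simp only [segmentIntegrand, ContinuousMap.smul_apply, Pi.smul_apply, smul_eq_mul,
          Finset.mul_sum]
        exact Finset.sum_congr rfl fun j _ => by ring }
    d
    (fun F => (ContinuousMap.norm_le _ (by positivity)).2 fun x => by
      change ‖- ∫ p, segmentIntegrand F x p ∂(segmentMeasure d)‖ ≤ _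
      rw [norm_neg]
      have := norm_integral_le_of_norm_le_const (μ := segmentMeasure d) (C := d * ‖F‖)
        (f := segmentIntegrand F x) (ae_of_all _ fun p => (abs_segmentIntegrand_le F x p).trans (sum_abs_le F _))
      simpa using this)

lemma potentialL_apply (F : VField d) (x : UnitAddTorus (Fin d)) :
    potentialL d F x = - ∫ p, segmentIntegrand F x p ∂(segmentMeasure d) := rfl

/-- Along the segment from x to x + v the line integral of ∇φ is φ(x+v) - φ(x). Averaging over v
leaves ∫φ - φ(x), whence the minus sign in `potentialL`. -/
lemma potentialL_grad {φ : UnitAddTorus (Fin d) → ℝ} (hφ : IsCk 1 φ) (x : UnitAddTorus (Fin d)) :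
    potentialL d ⟨grad φ, hφ.continuous_grad⟩ x = φ x - ∫ u, φ u := by
  rw [potentialL_apply, segmentMeasure, integral_prod _
    (integrable_segmentIntegrand ⟨grad φ, hφ.continuous_grad⟩ x)]
  have h1 : ∀ v : UnitAddTorus (Fin d),
      ∫ s in Ioc (0 : ℝ) 1, segmentIntegrand ⟨grad φ, hφ.continuous_grad⟩ x (v, s)
        = φ (x + v) - φ x := by
    intro v
    rw [← intervalIntegral.integral_of_le zero_le_one]
    have hc : Continuous fun s : ℝ => ∑ j, torusRep v j *
        grad φ (x + torusMk (s • torusRep v)) j := by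
      refine continuous_finsetSum _ fun j _ => continuous_const.mul
        ((continuous_component hφ.continuous_grad j).comp
          (continuous_const.add (continuous_torusMk.comp (by fun_prop))))
    have := intervalIntegral.integral_eq_sub_of_hasDerivAt (a := 0) (b := 1)
      (fun s _ => hφ.hasDerivAt_grad x (torusRep v) s) (hc.intervalIntegrable _ _)
    rw [one_smul, zero_smul, torusMk_torusRep, torusMk_zero, add_zero] at this
    exact this
  simp only [h1]
  have hi : Integrable fun v => φ (x + v) :=
    integrable_of_continuous_torus (hφ.continuous.comp (by fun_prop))
  rw [integral_sub hi (integrable_const _), integral_add_left_eq_self φ x]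
  simp

/-- Displacements have coordinates at most 1, and by Fubini each shift preserves the integral. This
L¹ bound, stronger than the uniform one for later use, lets the mobility term absorb the correction
pointwise. -/
lemma integral_abs_potentialL_le (F : VField d) :
    ∫ x, |potentialL d F x| ≤ ∫ x, ∑ j, |F x j| := by
  set μ := segmentMeasure d
  let S : C(UnitAddTorus (Fin d), ℝ) := ⟨fun x => ∑ j, |F x j|,
    continuous_finsetSum _ fun j _ => (continuous_component F.continuous j).abs⟩
  have hS : ∀ x, |S x| ≤ d * ‖F‖ := fun x => by
    have h0 : 0 ≤ ∑ j, |F x j| := Finset.sum_nonneg fun _ _ => abs_nonneg _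
    exact (abs_of_nonneg h0).trans_le (sum_abs_le F x)
  have hm : Measurable fun q : UnitAddTorus (Fin d) × (UnitAddTorus (Fin d) × ℝ) =>
      S (q.1 + segmentShift q.2) :=
    S.continuous.measurable.comp (measurable_fst.add (measurable_segmentShift.comp measurable_snd))
  have hi : Integrable (fun q : UnitAddTorus (Fin d) × (UnitAddTorus (Fin d) × ℝ) =>
      S (q.1 + segmentShift q.2)) (volume.prod μ) :=
    Integrable.of_bound hm.aestronglyMeasurable (d * ‖F‖) (ae_of_all _ fun q => hS _)
  have h1 : ∀ x, |potentialL d F x| ≤ ∫ p, S (x + segmentShift p) ∂μ := fun x => by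
    rw [potentialL_apply, abs_neg]
    refine (abs_integral_le_integral_abs).trans (integral_mono
      (integrable_segmentIntegrand F x).abs ?_ fun p => abs_segmentIntegrand_le F x p)
    exact Integrable.of_bound (hm.comp measurable_prodMk_left).aestronglyMeasurable (d * ‖F‖)
      (ae_of_all _ fun q => hS _)
  calc ∫ x, |potentialL d F x| ≤ ∫ x, ∫ p, S (x + segmentShift p) ∂μ :=
        integral_mono (integrable_of_continuous_torus (potentialL d F).continuous.abs)
          hi.integral_prod_left h1
    _ = ∫ p, (∫ x, S (x + segmentShift p)) ∂μ := integral_integral_swap hi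
    _ = ∫ _p, (∫ x, S x) ∂μ := by
        congr 1; ext p
        exact integral_add_right_eq_self (fun x => S x) (segmentShift p)
    _ = ∫ x, ∑ j, |F x j| := by simp [S]

end

section

variable {d : ℕ}

/-! ### Weak integrals of paths of functionals -/

section WeakIntegral

variable {E : Type*} [NormedAddCommGroup E] [NormedSpace ℝ E]

/-- The functional `x ↦ ∫₀ᵗ u_s x ds` of a bounded, weakly continuous path. -/
def weakIntegral (u : ℝ → E →L[ℝ] ℝ) (hu : ∀ x, Continuous fun t => u t x) {C : ℝ}
    (hC : ∀ t, ‖u t‖ ≤ C) (t : ℝ) : E →L[ℝ] ℝ :=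
  LinearMap.mkContinuous
    { toFun := fun x => ∫ s in (0 : ℝ)..t, u s x
      map_add' := fun x y => by
        simp only [map_add]
        exact intervalIntegral.integral_add ((hu x).intervalIntegrable _ _)
          ((hu y).intervalIntegrable _ _)
      map_smul' := fun c x => by
        simp only [map_smul, smul_eq_mul, RingHom.id_apply]
        exact intervalIntegral.integral_const_mul _ _ }
    (C * |t|)
    (fun x => by
      have := intervalIntegral.norm_integral_le_of_norm_le_const (a := 0) (b := t)
        (f := fun s => u s x) (C := C * ‖x‖) fun s _ => (u s).le_of_opNorm_le (hC s) x
      rw [sub_zero] at this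
      calc _ ≤ C * ‖x‖ * |t| := this
        _ = _ := by ring)

variable {u : ℝ → E →L[ℝ] ℝ} (hu : ∀ x, Continuous fun t => u t x) {C : ℝ} (hC : ∀ t, ‖u t‖ ≤ C)

lemma weakIntegral_apply (t : ℝ) (x : E) :
    weakIntegral u hu hC t x = ∫ s in (0 : ℝ)..t, u s x := rfl

lemma weakIntegral_zero : weakIntegral u hu hC 0 = 0 := by
  ext x; simp [weakIntegral_apply]

lemma hasDerivAt_weakIntegral (x : E) (t : ℝ) :
    HasDerivAt (fun t => weakIntegral u hu hC t x) (u t x) t :=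
  intervalIntegral.integral_hasDerivAt_right ((hu x).intervalIntegrable _ _)
    ((hu x).stronglyMeasurableAtFilter _ _) (hu x).continuousAt

lemma abs_weakIntegral_sub_le (a b : ℝ) (x : E) :
    |weakIntegral u hu hC b x - weakIntegral u hu hC a x| ≤ C * ‖x‖ * |b - a| := by
  rw [weakIntegral_apply, weakIntegral_apply, intervalIntegral.integral_interval_sub_left
    ((hu x).intervalIntegrable _ _) ((hu x).intervalIntegrable _ _)]
  exact intervalIntegral.norm_integral_le_of_norm_le_const fun s _ =>
    (u s).le_of_opNorm_le (hC s) x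

/-- The product rule for a weak integral applied to a differentiable path. -/
lemma hasDerivAt_weakIntegral_apply {Φ Φ' : ℝ → E} (hΦ : ∀ t, HasDerivAt Φ (Φ' t) t) (t : ℝ) :
    HasDerivAt (fun t => weakIntegral u hu hC t (Φ t))
      (u t (Φ t) + weakIntegral u hu hC t (Φ' t)) t := by
  set D := weakIntegral u hu hC
  have h1 : HasDerivAt (fun s => D s (Φ t)) (u t (Φ t)) t := hasDerivAt_weakIntegral hu hC _ t
  have h2 : HasDerivAt (fun s => D t (Φ s)) (D t (Φ' t)) t :=
    (D t).hasFDerivAt.comp_hasDerivAt t (hΦ t)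
  -- The mixed increment is at most C‖Φ s - Φ t‖ |s - t|, which is o(s - t); thus only weak
  -- differentiability of the functionals is needed.
  have h3 : HasDerivAt (fun s => D s (Φ s - Φ t) - D t (Φ s - Φ t)) 0 t := by
    rw [hasDerivAt_iff_isLittleO]
    have hlim : Tendsto (fun s => C * ‖Φ s - Φ t‖) (𝓝 t) (𝓝 0) := by
      have : Tendsto (fun s => C * ‖Φ s - Φ t‖) (𝓝 t) (𝓝 (C * ‖Φ t - Φ t‖)) :=
        (((hΦ t).continuousAt.tendsto.sub_const (Φ t)).norm).const_mul C
      simpa using this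
    have ho : (fun s => C * ‖Φ s - Φ t‖ * (s - t)) =o[𝓝 t] fun s => s - t := by
      have := ((Asymptotics.isLittleO_one_iff ℝ).2 hlim).mul_isBigO
        (Asymptotics.isBigO_refl (fun s => s - t) (𝓝 t))
      simpa using this
    refine Asymptotics.IsBigO.trans_isLittleO (Asymptotics.IsBigO.of_bound 1
      (Eventually.of_forall fun s => ?_)) ho
    have h := abs_weakIntegral_sub_le hu hC t s (Φ s - Φ t)
    have hC0 : 0 ≤ C := (norm_nonneg _).trans (hC 0)
    simp only [sub_self, map_zero, smul_zero, sub_zero, one_mul, Real.norm_eq_abs]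
    rw [abs_mul, abs_of_nonneg (mul_nonneg hC0 (norm_nonneg _))]
    exact h
  have h4 := (h1.fun_add h2).fun_add h3
  have h5 := h4.sub_const (D t (Φ t))
  rw [add_zero] at h5
  refine h5.congr_of_eventuallyEq (Eventually.of_forall fun s => ?_)
  simp only [map_sub]
  ring

end WeakIntegral

/-! ### Relaxing a path to the initial density -/

/-- The convex combination `(1 - a) ρ + a σ`, with `a` truncated to `[0,1]`. -/
def Profile.mix (a : ℝ) (ρ σ : Profile d) : Profile d where
  toFun u := (1 - (projIcc (0 : ℝ) 1 zero_le_one a : ℝ)) * ρ.toFun u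
    + (projIcc (0 : ℝ) 1 zero_le_one a : ℝ) * σ.toFun u
  measurable := (ρ.measurable.const_mul _).add (σ.measurable.const_mul _)
  nonneg u := by
    obtain ⟨h0, h1⟩ := (projIcc (0 : ℝ) 1 zero_le_one a).2
    exact add_nonneg (mul_nonneg (by linarith) (ρ.nonneg u)) (mul_nonneg h0 (σ.nonneg u))
  le_one u := by
    obtain ⟨h0, h1⟩ := (projIcc (0 : ℝ) 1 zero_le_one a).2
    nlinarith [ρ.le_one u, σ.le_one u]

lemma Profile.mix_toFun {a : ℝ} (ha : a ∈ Icc (0 : ℝ) 1) (ρ σ : Profile d)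
    (u : UnitAddTorus (Fin d)) :
    (Profile.mix a ρ σ).toFun u = (1 - a) * ρ.toFun u + a * σ.toFun u := by
  simp only [Profile.mix, projIcc_of_mem zero_le_one ha]

lemma dpair_mix {a : ℝ} (ha : a ∈ Icc (0 : ℝ) 1) (ρ σ : Profile d)
    {f : UnitAddTorus (Fin d) → ℝ} (hf : Continuous f) :
    dpair (Profile.mix a ρ σ).toFun f = (1 - a) * dpair ρ.toFun f + a * dpair σ.toFun f := by
  have hi := integrable_of_continuous_torus hf
  rw [dpair, dpair, dpair, ← integral_const_mul, ← integral_const_mul, ← integral_add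
    ((ρ.integrable_mul hi).const_mul _) ((σ.integrable_mul hi).const_mul _)]
  congr 1; ext u
  rw [Profile.mix_toFun ha]; ring

lemma mobility_mix {a x y : ℝ} (ha : a ∈ Icc (0 : ℝ) 1) :
    (1 - a) * mobility x + a * mobility y ≤ mobility ((1 - a) * x + a * y) := by
  unfold mobility
  have h : 0 ≤ (1 - a) * a := mul_nonneg (by linarith [ha.2]) ha.1
  nlinarith [mul_nonneg h (sq_nonneg (x - y))]

/-- Concavity of the mobility in integrated form. -/
lemma energy_smul_sub_energy_mix_le {κ a : ℝ} (ha : a ∈ Icc (0 : ℝ) 1) (ρ σ : Profile d)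
    (hσ : ∀ u, κ ≤ mobility (σ.toFun u)) (F : VField d) :
    energy ρ ((1 - a) • F) - energy (Profile.mix a ρ σ) F ≤ - (a * κ * integralL d (sqLength F)) := by
  have hi := integrable_of_continuous_torus (sqLength F).continuous
  have hi' := integrable_of_continuous_torus (sqLength ((1 - a) • F)).continuous
  have e1 : energy ρ ((1 - a) • F) = ∫ u, mobility (ρ.toFun u) * sqLength ((1 - a) • F) u := rfl
  rw [e1, energy_eq, ← integral_sub (ρ.integrable_mobility_mul hi')
    ((Profile.mix a ρ σ).integrable_mobility_mul hi), integralL_apply, ← integral_const_mul,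
    ← integral_neg]
  refine integral_mono ((ρ.integrable_mobility_mul hi').sub
    ((Profile.mix a ρ σ).integrable_mobility_mul hi)) (hi.const_mul _).neg fun u => ?_
  have h1 : sqLength ((1 - a) • F) u = (1 - a) ^ 2 * sqLength F u := by
    simp only [sqLength_apply, Finset.mul_sum]
    exact Finset.sum_congr rfl fun j _ => mul_pow _ _ _
  have h2 := mobility_mix (x := ρ.toFun u) (y := σ.toFun u) ha
  have h3 := sqLength_nonneg F u
  have h4 := (mobility_bounds (ρ.nonneg u) (ρ.le_one u)).1
  have h5 := hσ u
  simp only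
  rw [h1, Profile.mix_toFun ha]
  -- Concavity needs only one factor 1 - a, so the second is discarded; the term a χ(σ) then remains
  -- as a gain.
  have h6 : (1 - a) ^ 2 * mobility (ρ.toFun u) ≤ (1 - a) * mobility (ρ.toFun u) :=
    mul_le_mul_of_nonneg_right (by nlinarith [ha.1, ha.2]) h4
  have h7 : a * κ ≤ a * mobility (σ.toFun u) := mul_le_mul_of_nonneg_left h5 ha.1
  have h8 : ((1 - a) ^ 2 * mobility (ρ.toFun u) + a * κ) * sqLength F u ≤
      mobility ((1 - a) * ρ.toFun u + a * σ.toFun u) * sqLength F u :=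
    mul_le_mul_of_nonneg_right (by linarith) h3
  linarith

/-- The functional `F ↦ -⟨ρ - σ, B F⟩`, a bounded solution of the divergence equation. -/
def correction (ρ σ : Profile d) : VField d →L[ℝ] ℝ := (dpairL σ - dpairL ρ).comp (potentialL d)

/-- Two profiles differ by at most 1, so the functional inherits the L¹ bound of `potentialL`: it
acts like a current whose components have density at most 1. -/
lemma correction_le (ρ σ : Profile d) (F : VField d) :
    |correction ρ σ F| ≤ ∫ u, ∑ j, |F u j| := by
  refine le_trans ?_ (integral_abs_potentialL_le F)
  have hi := integrable_of_continuous_torus (potentialL d F).continuous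
  have h1 : correction ρ σ F = ∫ u, (σ.toFun u * potentialL d F u - ρ.toFun u * potentialL d F u) :=
    (integral_sub (σ.integrable_mul hi) (ρ.integrable_mul hi)).symm
  rw [h1]
  refine abs_integral_le_integral_abs.trans (integral_mono
    ((σ.integrable_mul hi).sub (ρ.integrable_mul hi)).abs hi.abs fun u => ?_)
  simp only
  rw [← sub_mul, abs_mul]
  refine mul_le_of_le_one_left (abs_nonneg _) (abs_le.2 ⟨?_, ?_⟩)
  · linarith [ρ.le_one u, σ.nonneg u]
  · linarith [σ.le_one u, ρ.nonneg u]

/-- The operator inverts the gradient up to the constant ∫f, which is annihilated because the two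
profiles have equal mass. -/
lemma correction_grad {ρ σ : Profile d} (h : ∫ u, ρ.toFun u = ∫ u, σ.toFun u)
    {f : UnitAddTorus (Fin d) → ℝ} (hf : IsCk 1 f) :
    correction ρ σ ⟨grad f, hf.continuous_grad⟩ = dpair σ.toFun f - dpair ρ.toFun f := by
  have h1 : potentialL d ⟨grad f, hf.continuous_grad⟩ = (⟨f, hf.continuous⟩ : C(_, ℝ))
      - (∫ u, f u) • (1 : C(UnitAddTorus (Fin d), ℝ)) := by
    ext x
    rw [potentialL_grad hf]
    simp
  have h2 : ∀ τ : Profile d, dpairL τ 1 = ∫ u, τ.toFun u := fun τ => by simp [dpair]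
  simp only [correction, ContinuousLinearMap.comp_apply, h1, map_sub, map_smul, _root_.sub_apply, h2,
    h, sub_self, smul_zero, sub_zero]
  rfl

/-- For l > 0, completing the square bounds the left side by l'²/(lκ). For l = 0 the hypothesis
forces l' = 0, so there is no linear term to absorb. -/
lemma scalar_bound {κ l l' q a : ℝ} (hκ : 0 < κ) (hl : 0 ≤ l) (hq : 0 ≤ q)
    (h : l' ^ 2 ≤ 4 * q * l) : l' * a - l * κ / 4 * a ^ 2 ≤ 4 * q / κ := by
  rcases hl.eq_or_lt with rfl | hl
  · have h0 : l' = 0 := by nlinarith [sq_nonneg l']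
    rw [h0]
    have : 0 ≤ 4 * q / κ := by positivity
    simpa using this
  · rw [le_div_iff₀ hκ]
    have h1 : l * ((l' * a - l * κ / 4 * a ^ 2) * κ) ≤ l * (4 * q) := by
      nlinarith [sq_nonneg (l * κ * a / 2 - l')]
    exact le_of_mul_le_mul_left h1 hl

/-- The instantaneous cost of relaxing towards the initial density. -/
lemma IsRegularDensity.relaxation_slice {γ : UnitAddTorus (Fin d) → ℝ} {κ : ℝ}
    (hγ : IsRegularDensity γ κ) {B : ℝ} (hB : ∀ u j, |grad γ u j| ≤ B)
    {l l' q : ℝ} (hl : l ∈ Icc (0 : ℝ) 1) (hl' : 0 ≤ l') (hlq : l ≤ q) (h : l' ^ 2 ≤ 4 * q * l)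
    (ρ : Profile d) (F : VField d) (hF : IsCk 1 F) :
    l' * correction ρ hγ.profile F - (1 / 2) * (l * dpair γ (divergence F))
      + (1 / 2) * (energy ρ ((1 - l) • F) - energy (Profile.mix l ρ hγ.profile) F)
      ≤ q * (d * ((4 + B ^ 2 / 4) / κ)) := by
  have hκ := hγ.pos
  have hq : 0 ≤ q := hl.1.trans hlq
  have h1 := (le_abs_self _).trans (correction_le ρ hγ.profile F)
  have h2 := energy_smul_sub_energy_mix_le hl ρ hγ.profile hγ.le_mobility F
  have h3 := hγ.dpair_divergence hF
  have i1 : Integrable fun u => ∑ j, |F u j| := integrable_of_continuous_torus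
    (continuous_finsetSum _ fun j _ => (continuous_component F.continuous j).abs)
  have i2 : Integrable fun u => ∑ j, grad γ u j * F u j :=
    integrable_of_continuous_torus (continuous_finsetSum _ fun j _ =>
      (continuous_component hγ.isCk.continuous_grad j).mul (continuous_component F.continuous j))
  have i3 := integrable_of_continuous_torus (sqLength F).continuous
  have i12 : Integrable fun u => l' * (∑ j, |F u j|) + l / 2 * (∑ j, grad γ u j * F u j) :=
    (i1.const_mul _).add (i2.const_mul _)
  have h4 : l' * (∫ u, ∑ j, |F u j|) + l / 2 * (∫ u, ∑ j, grad γ u j * F u j)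
      - l * κ / 2 * (∫ u, sqLength F u) ≤ q * (d * ((4 + B ^ 2 / 4) / κ)) := by
    calc _ = ∫ u, (l' * (∑ j, |F u j|) + l / 2 * (∑ j, grad γ u j * F u j)
          - l * κ / 2 * sqLength F u) := by
          rw [integral_sub i12 (i3.const_mul _),
            integral_add (i1.const_mul _) (i2.const_mul _), integral_const_mul,
            integral_const_mul, integral_const_mul]
      _ ≤ ∫ _u : UnitAddTorus (Fin d), (q * (d * ((4 + B ^ 2 / 4) / κ)) : ℝ) := by
          refine integral_mono (i12.sub (i3.const_mul _))
            (integrable_const _) fun u => ?_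
          simp only [sqLength_apply, Finset.mul_sum]
          rw [← Finset.sum_add_distrib, ← Finset.sum_sub_distrib]
          have e : q * (d * ((4 + B ^ 2 / 4) / κ)) = ∑ _j : Fin d, (4 * q / κ + q * B ^ 2 / (4 * κ)) := by
            simp only [Finset.sum_const, Finset.card_univ, Fintype.card_fin, nsmul_eq_mul]
            field_simp
          rw [e]
          refine Finset.sum_le_sum fun j _ => ?_
          -- The gain lκ/2 · |F|² is used in two halves: this one absorbs the correction term, the
          -- other (in `a3`) the term in ∇γ.
          have a1 := scalar_bound (a := |F u j|) hκ hl.1 hq h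
          rw [sq_abs] at a1
          have a2 : grad γ u j * F u j ≤ B * |F u j| :=
            (le_abs_self _).trans ((abs_mul _ _).trans_le
              (mul_le_mul_of_nonneg_right (hB u j) (abs_nonneg _)))
          have a3 : l / 2 * (B * |F u j|) - l * κ / 4 * |F u j| ^ 2 ≤ q * B ^ 2 / (4 * κ) := by
            rw [le_div_iff₀ (by positivity)]
            have := mul_nonneg hl.1 (sq_nonneg (κ * |F u j| - B))
            have := mul_nonneg (sub_nonneg.2 hlq) (sq_nonneg B)
            nlinarith
          rw [sq_abs] at a3
          have a4 : l / 2 * (grad γ u j * F u j) ≤ l / 2 * (B * |F u j|) :=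
            mul_le_mul_of_nonneg_left a2 (by linarith [hl.1])
          linarith
      _ = _ := by simp
  rw [integralL_apply] at h2
  rw [h3]
  have h5 := mul_le_mul_of_nonneg_left h1 hl'
  linarith

end

section

variable {d : ℕ}

/-! ### Relaxation schedules -/

/-- A nondecreasing weight `l` running from `0` to `1` on `[0,T]`, with derivative `l'`,
controlled by a function `q` of integral at most `2`. -/
structure RelaxationSchedule (T : ℝ) (l l' q : ℝ → ℝ) : Prop where
  contDiff : ContDiff ℝ 1 l
  hasDerivAt : ∀ t, HasDerivAt l (l' t) t
  continuous_deriv : Continuous l'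
  continuous_bound : Continuous q
  map_zero : l 0 = 0
  map_end : l T = 1
  mem_Icc : ∀ t ∈ Icc 0 T, l t ∈ Icc (0 : ℝ) 1
  deriv_nonneg : ∀ t ∈ Icc 0 T, 0 ≤ l' t
  le_bound : ∀ t ∈ Icc 0 T, l t ≤ q t
  sq_deriv_le : ∀ t ∈ Icc 0 T, l' t ^ 2 ≤ 4 * q t * l t
  integral_bound_le : ∫ t in (0 : ℝ)..T, q t ≤ 2

/-- The weight `(t/T)ⁿ` with `n` comparable to `T`. -/
lemma exists_relaxationSchedule {T : ℝ} (hT : 2 ≤ T) : ∃ l l' q, RelaxationSchedule T l l' q := by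
  -- The exponent is n = m + 2 = ⌈T⌉. From n ≤ 2T follows (l')² = (n/T)² q l ≤ 4ql with q = (t/T)^m;
  -- from T ≤ n follows ∫q = T/(m+1) ≤ 2.
  obtain ⟨m, hm1, hm2⟩ : ∃ m : ℕ, T ≤ m + 2 ∧ (m : ℝ) + 2 ≤ 2 * T := by
    obtain ⟨m, hm⟩ := Nat.exists_eq_add_of_le' (show 2 ≤ ⌈T⌉₊ by exact_mod_cast hT.trans (Nat.le_ceil T))
    have h1 := Nat.le_ceil T
    have h2 := Nat.ceil_lt_add_one (zero_le_two.trans hT)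
    rw [hm] at h1 h2
    push_cast at h1 h2
    exact ⟨m, h1, by linarith⟩
  have hT0 : 0 < T := by linarith
  have hx : ∀ t ∈ Icc 0 T, 0 ≤ t / T ∧ t / T ≤ 1 := fun t ht =>
    ⟨div_nonneg ht.1 hT0.le, (div_le_one hT0).2 ht.2⟩
  refine ⟨fun t => (t / T) ^ (m + 2), fun t => (m + 2) / T * (t / T) ^ (m + 1),
    fun t => (t / T) ^ m, by fun_prop, fun t => ?_, by fun_prop, by fun_prop, by simp,
    by simp [div_self hT0.ne'], fun t ht => ?_, fun t ht => ?_, fun t ht => ?_, fun t ht => ?_, ?_⟩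
  · have := ((hasDerivAt_id t).div_const T).fun_pow (m + 2)
    refine this.congr_deriv ?_
    simp only [id, Nat.cast_add, Nat.cast_ofNat, Nat.add_succ_sub_one]
    ring
  · exact ⟨pow_nonneg (hx t ht).1 _, pow_le_one₀ (hx t ht).1 (hx t ht).2⟩
  · have := (hx t ht).1
    positivity
  · exact pow_le_pow_of_le_one (hx t ht).1 (hx t ht).2 (by omega)
  · have h1 : ((m + 2) / T) ^ 2 ≤ 4 := by
      have h2 : ((m : ℝ) + 2) / T ≤ 2 := by rw [div_le_iff₀ hT0]; exact hm2
      have h3 : 0 ≤ ((m : ℝ) + 2) / T := by positivity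
      nlinarith
    have h4 := mul_le_mul_of_nonneg_right h1 (pow_nonneg (hx t ht).1 (2 * m + 2))
    calc _ = ((m + 2) / T) ^ 2 * (t / T) ^ (2 * m + 2) := by ring
      _ ≤ _ := h4
      _ = _ := by ring
  · have h1 : ∫ t in (0 : ℝ)..T, (t / T) ^ m = T / (m + 1) := by
      rw [intervalIntegral.integral_comp_div (fun t => t ^ m) hT0.ne', zero_div, div_self hT0.ne',
        integral_pow]
      simp [div_eq_mul_inv]
    rw [h1, div_le_iff₀ (by positivity)]
    nlinarith [m.cast_nonneg (α := ℝ)]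

namespace RelaxationSchedule

variable {T : ℝ} {l l' q : ℝ → ℝ}

lemma integral_deriv (h : RelaxationSchedule T l l' q) : ∫ t in (0 : ℝ)..T, l' t = 1 := by
  rw [intervalIntegral.integral_eq_sub_of_hasDerivAt (fun t _ => h.hasDerivAt t)
    (h.continuous_deriv.intervalIntegrable _ _), h.map_end, h.map_zero, sub_zero]

end RelaxationSchedule

lemma abs_dpairL_le (ρ : Profile d) (f : C(UnitAddTorus (Fin d), ℝ)) : |dpairL ρ f| ≤ ‖f‖ := by
  rw [dpairL_apply, dpair, ← Real.norm_eq_abs]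
  have := norm_integral_le_of_norm_le_const (μ := (volume : Measure (UnitAddTorus (Fin d))))
    (f := fun u => ρ.toFun u * f u) (C := ‖f‖) (ae_of_all _ fun u => by
      rw [norm_mul, Real.norm_of_nonneg (ρ.nonneg u)]
      exact (mul_le_of_le_one_left (norm_nonneg _) (ρ.le_one u)).trans (f.norm_coe_le_norm u))
  simpa using this

lemma abs_correction_le (ρ σ : Profile d) (F : VField d) : |correction ρ σ F| ≤ d * ‖F‖ := by
  refine (correction_le ρ σ F).trans ?_
  have h1 : Integrable fun u => ∑ j, |F u j| := integrable_of_continuous_torus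
    (continuous_finsetSum _ fun j _ => (continuous_component F.continuous j).abs)
  calc _ ≤ ∫ _u : UnitAddTorus (Fin d), (d * ‖F‖ : ℝ) :=
        integral_mono h1 (integrable_const _) fun u => sum_abs_le F u
    _ = _ := by simp

/-! ### Steering to the initial density -/

section Relaxation

variable {γ : UnitAddTorus (Fin d) → ℝ} {κ T M : ℝ} {W : ℝ → Current d} {π : ℝ → Profile d}
  {l l' q : ℝ → ℝ}

/-- Conservation of mass: the constant test function 1 has zero gradient. -/
lemma HasCostLE.integral_profile_eq (h : HasCostLE γ T W π M) (hγ : IsRegularDensity γ κ) {t : ℝ}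
    (ht : t ∈ Icc 0 T) : ∫ u, (π t).toFun u = ∫ u, hγ.profile.toFun u := by
  have h1 := h.continuityEq.1 t ht (fun _ => 1) (isCk_const 1)
  have h2 : grad (fun _ : UnitAddTorus (Fin d) => (1 : ℝ)) = (0 : VField d) := by
    ext u j
    exact partialDeriv_const 1 j u
  rw [h2, ← pairL_apply, map_zero] at h1
  simp only [dpair, mul_one] at h1
  exact sub_eq_zero.1 h1

/-- The derivative of the current compensating for the relaxation. -/
def relaxationDrift (hγ : IsRegularDensity γ κ) (W : ℝ → Current d) (π : ℝ → Profile d)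
    (l' : ℝ → ℝ) (t : ℝ) : VField d →L[ℝ] ℝ :=
  l' t • (pairL (W t) + correction (π t) hγ.profile)

lemma relaxationDrift_apply (hγ : IsRegularDensity γ κ) (t : ℝ) (F : VField d) :
    relaxationDrift hγ W π l' t F = l' t * (pairL (W t) F + correction (π t) hγ.profile F) := rfl

lemma WeakPath.continuousOn_correction (h : WeakPath T W π) (σ : Profile d) (F : VField d) :
    ContinuousOn (fun t => correction (π t) σ F) (Icc 0 T) :=
  (continuousOn_const (c := dpairL σ (potentialL d F))).sub (h.profile (potentialL d F))

lemma WeakPath.continuousOn_relaxationDrift (h : WeakPath T W π) (hγ : IsRegularDensity γ κ)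
    (hl' : Continuous l') (F : VField d) :
    ContinuousOn (fun t => relaxationDrift hγ W π l' t F) (Icc 0 T) :=
  hl'.continuousOn.mul ((h.current F).add (h.continuousOn_correction hγ.profile F))

/-- A path of currents with the prescribed weak derivative. -/
lemma exists_current_primitive (hT : 0 ≤ T) {u : ℝ → VField d →L[ℝ] ℝ}
    (hu : ∀ F, ContinuousOn (fun t => u t F) (Icc 0 T)) :
    ∃ K : ℝ → Current d, K 0 = 0 ∧ (∀ F, Continuous fun t => pairL (K t) F) ∧
      (∀ t ∈ Icc 0 T, ∀ F, pairL (K t) F = ∫ s in (0 : ℝ)..t, u s F) ∧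
      ∀ Φ Φ' : ℝ → VField d, (∀ t, HasDerivAt Φ (Φ' t) t) → Continuous Φ' →
        pairL (K T) (Φ T) - ∫ t in (0 : ℝ)..T, pairL (K t) (Φ' t) =
          ∫ t in (0 : ℝ)..T, u t (Φ t) := by
  set v : ℝ → VField d →L[ℝ] ℝ := fun t => u (projIcc 0 T hT t) with hv
  have hvu : ∀ t ∈ Icc 0 T, v t = u t := fun t ht => by simp only [hv, projIcc_of_mem hT ht]
  have hvc : ∀ F, Continuous fun t => v t F := fun F =>
    (hu F).comp_continuous (continuous_subtype_val.comp continuous_projIcc)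
      fun t => (projIcc 0 T hT t).2
  obtain ⟨C, -, hC⟩ := exists_norm_le_of_weakly_continuousOn isCompact_Icc hu
  have hvC : ∀ t, ‖v t‖ ≤ C := fun t => hC _ (projIcc 0 T hT t).2
  choose K₀ hK₀ using fun t => exists_current_pair_eq (weakIntegral v hvc hvC t)
  classical
  -- The representing measures are chosen separately for each t. The value at 0 is set by hand
  -- because the continuity equation asks for the zero current itself, not merely for vanishing
  -- pairings.
  set K : ℝ → Current d := fun t => if t = 0 then 0 else K₀ t with hK
  have hKw : ∀ t, pairL (K t) = weakIntegral v hvc hvC t := fun t => by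
    rcases eq_or_ne t 0 with rfl | h
    · rw [hK, weakIntegral_zero]
      simp only [if_true, pairL_zero]
    · simp only [hK, if_neg h, hK₀]
  have hweak : ∀ F, Continuous fun t => pairL (K t) F := fun F => by
    simp only [hKw]
    exact continuous_iff_continuousAt.2 fun t => (hasDerivAt_weakIntegral hvc hvC F t).continuousAt
  refine ⟨K, if_pos rfl, hweak, fun t ht F => ?_, fun Φ Φ' hΦ hΦ' => ?_⟩
  · rw [hKw, weakIntegral_apply]
    refine intervalIntegral.integral_congr fun s hs => ?_
    rw [uIcc_of_le ht.1] at hs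
    simp only [hvu s ⟨hs.1, hs.2.trans ht.2⟩]
  · have hΦc : Continuous Φ := continuous_iff_continuousAt.2 fun t => (hΦ t).continuousAt
    have i1 : IntervalIntegrable (fun t => v t (Φ t)) volume 0 T :=
      ContinuousOn.intervalIntegrable (by
        rw [uIcc_of_le hT]
        exact continuousOn_weak_apply isCompact_Icc (fun F => (hvc F).continuousOn)
          hΦc.continuousOn)
    have i2 : IntervalIntegrable (fun t => pairL (K t) (Φ' t)) volume 0 T :=
      ContinuousOn.intervalIntegrable (by
        rw [uIcc_of_le hT]
        exact continuousOn_weak_apply isCompact_Icc (fun F => (hweak F).continuousOn)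
          hΦ'.continuousOn)
    have h1 := intervalIntegral.integral_eq_sub_of_hasDerivAt
      (fun t _ => hasDerivAt_weakIntegral_apply hvc hvC hΦ t)
      (by simpa only [hKw] using i1.add i2 : IntervalIntegrable _ volume 0 T)
    simp only [← hKw] at h1
    rw [intervalIntegral.integral_add i1 i2, hKw 0, weakIntegral_zero, _root_.zero_apply,
      sub_zero] at h1
    rw [← h1, add_sub_cancel_right]
    refine intervalIntegral.integral_congr fun s hs => ?_
    rw [uIcc_of_le hT] at hs
    simp only [hvu s hs]

end Relaxation

end

/-! ### The relaxed path: its cost and its mean current -/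

section

variable {d : ℕ}

section Relaxation

variable {γ : UnitAddTorus (Fin d) → ℝ} {κ B T M : ℝ} {W : ℝ → Current d} {π : ℝ → Profile d}
  {l l' q : ℝ → ℝ}

/-- A path of finite cost can be relaxed to the initial density at bounded additional cost. -/
lemma HasCostLE.exists_relaxation (hT : 0 < T) (h : HasCostLE γ T W π M)
    (hγ : IsRegularDensity γ κ) (hB : ∀ u j, |grad γ u j| ≤ B)
    (hl : RelaxationSchedule T l l' q) :
    ∃ W' π', HasCostLE γ T W' π' (M + 2 * (d * ((4 + B ^ 2 / 4) / κ))) ∧ W' T ∈ divFree d ∧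
      ∀ G, pairL (W' T) G = ∫ t in (0 : ℝ)..T, relaxationDrift hγ W π l' t G := by
  have hTmem : T ∈ Icc 0 T := ⟨hT.le, le_rfl⟩
  have hlc : Continuous l := hl.contDiff.continuous
  have hu := h.weakPath.continuousOn_relaxationDrift hγ hl.continuous_deriv
  obtain ⟨K, hK0, hKc, hKu, hKΦ⟩ := exists_current_primitive hT.le hu
  set W' : ℝ → Current d := fun t => (1 - l t) • W t + K t with hW'
  set π' : ℝ → Profile d := fun t => Profile.mix (l t) (π t) hγ.profile with hπ'
  have hpW' : ∀ t F, pairL (W' t) F = (1 - l t) * pairL (W t) F + pairL (K t) F := fun t F => by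
    simp only [hW', pairL_add, pairL_smul, _root_.add_apply, _root_.smul_apply, smul_eq_mul]
  have hpπ' : ∀ t ∈ Icc 0 T, ∀ f, dpairL (π' t) f = (1 - l t) * dpairL (π t) f
      + l t * dpairL hγ.profile f := fun t ht f =>
    dpair_mix (hl.mem_Icc t ht) (π t) hγ.profile f.continuous
  have hweak : WeakPath T W' π' := by
    refine ⟨fun F => ?_, fun f => ?_⟩
    · simp only [hpW']
      exact ((continuous_const.sub hlc).continuousOn.mul (h.weakPath.current F)).add
        (hKc F).continuousOn
    · refine ContinuousOn.congr ?_ fun t ht => hpπ' t ht f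
      exact ((continuous_const.sub hlc).continuousOn.mul (h.weakPath.profile f)).add
        (hlc.continuousOn.mul continuousOn_const)
  have hceq : ContinuityEq γ T W' π' := by
    refine ⟨fun t ht f hf => ?_, ?_⟩
    · have h1 : pairL (K t) ⟨grad f, hf.continuous_grad⟩ = 0 := by
        rw [hKu t ht]
        refine (intervalIntegral.integral_congr fun s hs => ?_).trans
          (intervalIntegral.integral_zero)
        rw [uIcc_of_le ht.1] at hs
        have hs' : s ∈ Icc 0 T := ⟨hs.1, hs.2.trans ht.2⟩
        have h2 := h.continuityEq.1 s hs' f hf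
        have h3 : dpair hγ.profile.toFun f = dpair γ f := rfl
        simp only [relaxationDrift_apply]
        rw [correction_grad (h.integral_profile_eq hγ hs') hf, pairL_apply, h3]
        change l' s * (pair (W s) (grad f) + _) = 0
        rw [← h2]
        ring
      have h2 := hpW' t ⟨grad f, hf.continuous_grad⟩
      rw [h1, add_zero] at h2
      have h3 := hpπ' t ht ⟨f, hf.continuous⟩
      have h4 := h.continuityEq.1 t ht f hf
      change dpair (π' t).toFun f = (1 - l t) * dpair (π t).toFun f + l t * dpair γ f at h3
      change pair (W' t) (grad f) = (1 - l t) * pair (W t) (grad f) at h2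
      rw [h2, h3, ← h4]
      ring
    · simp only [hW', h.continuityEq.2, hK0, smul_zero, add_zero]
  have hfinal : W' T ∈ divFree d := fun f hf => by
    have h1 := hceq.1 T hTmem f hf
    have h2 := hpπ' T hTmem ⟨f, hf.continuous⟩
    rw [hl.map_end, sub_self, zero_mul, zero_add, one_mul] at h2
    change dpair (π' T).toFun f = dpair γ f at h2
    rw [← h1, h2, sub_self]
  refine ⟨W', π', ⟨hceq, hweak, fun F hF => ?_⟩, hfinal, fun G => ?_⟩
  · obtain ⟨Φ, Φ', δ, hp⟩ := hF.exists_fieldPath hT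
    have hθ : ∀ t, HasDerivAt (fun t => 1 - l t) (-l' t) t := fun t =>
      (hl.hasDerivAt t).const_sub 1
    have hp₁ := hp.smul hT hθ hl.continuous_deriv.neg
    -- The time derivative of (1-l)F produces l'⟨W, F⟩, which matches the W part of the drift; only
    -- the correction, the γ divergence and the energy difference remain.
    have hle := h.testFunctional_le _ (hF.smul (contDiff_const.sub hl.contDiff : ContDiff ℝ 1
      fun t => 1 - l t))
    rw [testFunctional_eq hT.le _ _ hp₁] at hle
    rw [testFunctional_eq hT.le _ _ hp]
    have a1 := h.weakPath.intervalIntegrable_current hT.le hp₁.continuous_deriv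
    have a2 := h.weakPath.intervalIntegrable_profile hT.le hp₁.continuous_div
    have a3 := h.weakPath.intervalIntegrable_energy hT.le hp₁.continuous
    have b1 := hweak.intervalIntegrable_current hT.le hp.continuous_deriv
    have b2 := hweak.intervalIntegrable_profile hT.le hp.continuous_div
    have b3 := hweak.intervalIntegrable_energy hT.le hp.continuous
    have c1 : IntervalIntegrable (fun t => pairL (K t) (Φ' t)) volume 0 T :=
      ContinuousOn.intervalIntegrable (continuousOn_weak_apply isCompact_uIcc
        (fun F => (hKc F).continuousOn) hp.continuous_deriv.continuousOn)
    have c2 : IntervalIntegrable (fun t => relaxationDrift hγ W π l' t (Φ t)) volume 0 T :=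
      ContinuousOn.intervalIntegrable (by
        rw [uIcc_of_le hT.le]
        exact continuousOn_weak_apply isCompact_Icc hu hp.continuous.continuousOn)
    have hk := hKΦ Φ Φ' hp.hasDerivAt hp.continuous_deriv
    have hq : IntervalIntegrable q volume 0 T := hl.continuous_bound.intervalIntegrable 0 T
    set Q := d * ((4 + B ^ 2 / 4) / κ) with hQ
    have hQ0 : 0 ≤ Q := by have := hγ.pos; positivity
    have hslice : ∫ t in (0 : ℝ)..T, (relaxationDrift hγ W π l' t (Φ t)
          - (pairL (W' t) (Φ' t) - pairL (K t) (Φ' t))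
          + pairL (W t) ((1 - l t) • Φ' t + -l' t • Φ t)
          - (1 / 2) * (dpairL (π' t) (δ t) - dpairL (π t) ((1 - l t) • δ t))
          - (1 / 2) * (energy (π' t) (Φ t) - energy (π t) ((1 - l t) • Φ t : VField d)))
        ≤ ∫ t in (0 : ℝ)..T, q t * Q := by
      refine intervalIntegral.integral_mono_on hT.le ((((c2.sub (b1.sub c1)).add a1).sub
        ((b2.sub a2).const_mul _)).sub ((b3.sub a3).const_mul _)) (hq.mul_const _) fun t ht => ?_
      have hs := hγ.relaxation_slice hB (hl.mem_Icc t ht) (hl.deriv_nonneg t ht)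
        (hl.le_bound t ht) (hl.sq_deriv_le t ht) (π t) (Φ t)
        (by rw [← hp.eqOn t ht]; exact hF.isCk ht)
      have hdiv : dpair γ (divergence (Φ t)) = dpairL hγ.profile (δ t) := by
        rw [← hp.eqOn t ht, hp.divergence_eq t ht]
        rfl
      rw [hdiv] at hs
      refine le_trans (le_of_eq ?_) hs
      rw [hpW', hpπ' t ht, relaxationDrift_apply]
      simp only [map_add, map_smul, smul_eq_mul, hπ', ContinuousMap.coe_smul]
      ring
    rw [intervalIntegral.integral_sub ((((c2.sub (b1.sub c1)).add a1).sub
        ((b2.sub a2).const_mul _))) ((b3.sub a3).const_mul _),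
      intervalIntegral.integral_sub ((c2.sub (b1.sub c1)).add a1) ((b2.sub a2).const_mul _),
      intervalIntegral.integral_add (c2.sub (b1.sub c1)) a1,
      intervalIntegral.integral_sub c2 (b1.sub c1), intervalIntegral.integral_sub b1 c1,
      intervalIntegral.integral_const_mul, intervalIntegral.integral_const_mul,
      intervalIntegral.integral_sub b2 a2, intervalIntegral.integral_sub b3 a3,
      intervalIntegral.integral_mul_const] at hslice
    have hqQ := mul_le_mul_of_nonneg_right hl.integral_bound_le hQ0
    rw [map_smul, smul_eq_mul] at hle
    rw [hpW']
    linarith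
  · rw [hpW', hl.map_end, sub_self, zero_mul, zero_add, hKu T hTmem]

/-- The relaxed mean current is close to the original one. -/
lemma HasCostLE.abs_integral_relaxationDrift_sub_le (hT : 0 < T) (h : HasCostLE γ T W π M)
    (hγ : IsRegularDensity γ κ) (hl : RelaxationSchedule T l l' q) {G : VField d}
    {D : C(UnitAddTorus (Fin d), ℝ)} (hG : IsCk 1 G) (hD : divergence G = D) {a : ℝ} (ha : 0 < a) :
    |(∫ t in (0 : ℝ)..T, relaxationDrift hγ W π l' t G) - pairL (W T) G| ≤
      M / a + ‖D‖ + d / 4 * a * ‖G‖ ^ 2 + d * ‖G‖ := by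
  have i1 : IntervalIntegrable (fun t => l' t * pairL (W t) G) volume 0 T :=
    ContinuousOn.intervalIntegrable (by
      rw [uIcc_of_le hT.le]
      exact hl.continuous_deriv.continuousOn.mul (h.weakPath.current G))
  have i2 : IntervalIntegrable (fun t => l' t * correction (π t) hγ.profile G) volume 0 T :=
    ContinuousOn.intervalIntegrable (by
      rw [uIcc_of_le hT.le]
      exact hl.continuous_deriv.continuousOn.mul (h.weakPath.continuousOn_correction _ G))
  have hq : IntervalIntegrable q volume 0 T := hl.continuous_bound.intervalIntegrable 0 T
  -- The test field s l(t) G has final value sG and time derivative s l'(t)G (G is constant in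
  -- time), so its first two terms are exactly the difference sought. The bounds l ≤ q and l² ≤ q
  -- keep the other terms bounded uniformly in T.
  have key : ∀ s : ℝ, s * (pairL (W T) G - ∫ t in (0 : ℝ)..T, l' t * pairL (W t) G) ≤
      M + |s| * ‖D‖ + d / 4 * s ^ 2 * ‖G‖ ^ 2 := fun s => by
    have hp := (fieldPath_const hT G hD).smul hT (θ := fun t => s * l t) (θ' := fun t => s * l' t)
      (fun t => (hl.hasDerivAt t).const_mul s) (continuous_const.mul hl.continuous_deriv)
    have hle := h.testFunctional_le _ ((isC11_const hG T).smul
      (contDiff_const.mul hl.contDiff : ContDiff ℝ 1 fun t => s * l t))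
    have a2 := h.weakPath.intervalIntegrable_profile hT.le hp.continuous_div
    have a3 := h.weakPath.intervalIntegrable_energy hT.le hp.continuous
    rw [testFunctional_eq hT.le _ _ hp] at hle
    have b1 : ∫ t in (0 : ℝ)..T, dpairL (π t) ((s * l t) • D) ≤ 2 * (|s| * ‖D‖) :=
      calc _ ≤ ∫ t in (0 : ℝ)..T, q t * (|s| * ‖D‖) := by
            refine intervalIntegral.integral_mono_on hT.le a2 (hq.mul_const _) fun t ht => ?_
            refine (le_abs_self _).trans ((abs_dpairL_le _ _).trans ?_)
            rw [norm_smul, norm_mul, Real.norm_eq_abs, Real.norm_of_nonneg (hl.mem_Icc t ht).1]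
            have := mul_le_mul_of_nonneg_right (hl.le_bound t ht)
              (mul_nonneg (abs_nonneg s) (norm_nonneg D))
            linarith
        _ ≤ _ := by
            rw [intervalIntegral.integral_mul_const]
            exact mul_le_mul_of_nonneg_right hl.integral_bound_le (by positivity)
    have b2 : ∫ t in (0 : ℝ)..T, energy (π t) ((s * l t) • G : VField d) ≤
        2 * (d / 4 * s ^ 2 * ‖G‖ ^ 2) :=
      calc _ ≤ ∫ t in (0 : ℝ)..T, q t * (d / 4 * s ^ 2 * ‖G‖ ^ 2) := by
            refine intervalIntegral.integral_mono_on hT.le a3 (hq.mul_const _) fun t ht => ?_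
            have e1 := energy_le (π t) ((s * l t) • G)
            have e2 := integralL_sqLength_le ((s * l t) • G)
            rw [integralL_apply, norm_smul, norm_mul, Real.norm_eq_abs,
              Real.norm_of_nonneg (hl.mem_Icc t ht).1, mul_pow, mul_pow, sq_abs] at e2
            have e3 : l t ^ 2 ≤ q t := by
              have := hl.mem_Icc t ht
              nlinarith [hl.le_bound t ht, this.1, this.2]
            have e4 := mul_le_mul_of_nonneg_right e3
              (by positivity : 0 ≤ d / 4 * s ^ 2 * ‖G‖ ^ 2)
            linarith
        _ ≤ _ := by
            rw [intervalIntegral.integral_mul_const]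
            exact mul_le_mul_of_nonneg_right hl.integral_bound_le (by positivity)
    simp only [smul_zero, zero_add, hl.map_end, mul_one] at hle
    have b3 : ∫ t in (0 : ℝ)..T, pairL (W t) ((s * l' t) • G) =
        s * ∫ t in (0 : ℝ)..T, l' t * pairL (W t) G := by
      rw [← intervalIntegral.integral_const_mul]
      simp only [map_smul, smul_eq_mul, mul_assoc]
    rw [b3, map_smul, smul_eq_mul] at hle
    linarith
  have hcorr : |∫ t in (0 : ℝ)..T, l' t * correction (π t) hγ.profile G| ≤ d * ‖G‖ := by
    have i3 : IntervalIntegrable (fun t => l' t * (d * ‖G‖)) volume 0 T :=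
      (hl.continuous_deriv.mul continuous_const).intervalIntegrable 0 T
    calc _ ≤ ∫ t in (0 : ℝ)..T, |l' t * correction (π t) hγ.profile G| :=
          intervalIntegral.abs_integral_le_integral_abs hT.le
      _ ≤ ∫ t in (0 : ℝ)..T, l' t * (d * ‖G‖) := by
          refine intervalIntegral.integral_mono_on hT.le i2.abs i3 fun t ht => ?_
          rw [abs_mul, abs_of_nonneg (hl.deriv_nonneg t ht)]
          exact mul_le_mul_of_nonneg_left (abs_correction_le _ _ _) (hl.deriv_nonneg t ht)
      _ = _ := by rw [intervalIntegral.integral_mul_const, hl.integral_deriv, one_mul]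
  have hsplit : ∫ t in (0 : ℝ)..T, relaxationDrift hγ W π l' t G =
      (∫ t in (0 : ℝ)..T, l' t * pairL (W t) G)
        + ∫ t in (0 : ℝ)..T, l' t * correction (π t) hγ.profile G := by
    rw [← intervalIntegral.integral_add i1 i2]
    simp only [relaxationDrift_apply, mul_add]
  have hbound : |(∫ t in (0 : ℝ)..T, l' t * pairL (W t) G) - pairL (W T) G| ≤
      M / a + ‖D‖ + d / 4 * a * ‖G‖ ^ 2 := by
    have k1 := key a
    have k2 := key (-a)
    rw [abs_neg, abs_of_pos ha] at k2
    rw [abs_of_pos ha] at k1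
    have e : a * (M / a + ‖D‖ + d / 4 * a * ‖G‖ ^ 2) =
        M + a * ‖D‖ + d / 4 * a ^ 2 * ‖G‖ ^ 2 := by field_simp
    refine abs_le.2 ⟨?_, ?_⟩
    · refine le_of_mul_le_mul_left ?_ ha
      rw [mul_neg, e]
      linarith
    · refine le_of_mul_le_mul_left ?_ ha
      rw [e]
      linarith
  rw [hsplit, add_sub_right_comm]
  exact (abs_add_le _ _).trans (add_le_add hbound hcorr)

end Relaxation

end

/-! ### Divergence free approximation and the lower bound -/

section

variable {d : ℕ} {γ : UnitAddTorus (Fin d) → ℝ} {κ : ℝ}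

lemma dense_hasHelmholtz : Dense {F : VField d | HasHelmholtz F} := by
  refine Metric.dense_iff.2 fun F r hr => ?_
  obtain ⟨G, hG, h⟩ := exists_hasHelmholtz_approx F (half_pos hr)
  refine ⟨G, ?_, hG⟩
  rw [Metric.mem_ball, dist_comm, dist_eq_norm]
  exact h.trans_lt (half_lt_self hr)

/-- Replacing a mean current of finite cost by a nearby divergence free one. -/
lemma IsRegularDensity.exists_divFree_approx (hγ : IsRegularDensity γ κ) :
    ∃ C, 0 ≤ C ∧ ∀ T ≥ 2, ∀ c ≥ 0, ∀ J : Current d, Phi_T γ T J < ENNReal.ofReal c →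
      ∃ J' ∈ divFree d, Phi_T γ T J' ≤ ENNReal.ofReal (c + C / T) ∧
        (∀ F, |pairL J' F| ≤ (c + C + d / 8) * ‖F‖) ∧
        ∀ (G : VField d) (D : C(UnitAddTorus (Fin d), ℝ)), IsCk 1 G → divergence G = D →
          |pairL J' G - pairL J G| ≤
            (c + d / 4 * ‖G‖ ^ 2) / √T + (‖D‖ + d * ‖G‖) / T := by
  obtain ⟨B, hB0, hB⟩ := hγ.exists_grad_bound
  have hκ := hγ.pos
  refine ⟨2 * (d * ((4 + B ^ 2 / 4) / κ)), by positivity, fun T hT c hc J hJ => ?_⟩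
  have hT0 : 0 < T := by linarith
  set C := 2 * (d * ((4 + B ^ 2 / 4) / κ)) with hC
  have hC0 : 0 ≤ C := by positivity
  obtain ⟨W, π, h, hW⟩ := exists_hasCostLE_of_phi_T_lt hT0 hc hJ
  obtain ⟨l, l', q, hl⟩ := exists_relaxationSchedule hT
  obtain ⟨W', π', h', hdiv, hpair⟩ := h.exists_relaxation hT0 hγ hB hl
  have hWJ : W' T = T • (T⁻¹ • W' T) := (smul_inv_smul₀ hT0.ne' _).symm
  have e : (c * T + C) / T = c + C / T := by field_simp
  have hCT : C / T ≤ C := div_le_self hC0 (by linarith)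
  have hJ'div := smul_mem_divFree T⁻¹ hdiv
  refine ⟨T⁻¹ • W' T, hJ'div, ?_, fun F => ?_, fun G D hG hD => ?_⟩
  · rw [← e]
    exact h'.phi_T_le hT0 hWJ
  · have hM : c * T + C = (c + C / T) * T := by field_simp
    rw [hM] at h'
    refine (h'.abs_pair_le hT0 hWJ hJ'div F).trans ?_
    gcongr
  · have hs : 0 < √T := Real.sqrt_pos.2 hT0
    have h1 := h.abs_integral_relaxationDrift_sub_le hT0 hγ hl hG hD hs
    have hTJ : pairL (T • J) G = T * pairL J G := by
      rw [pairL_smul, _root_.smul_apply, smul_eq_mul]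
    have hTJ' : pairL (W' T) G = T * pairL (T⁻¹ • W' T) G := by
      rw [pairL_smul, _root_.smul_apply, smul_eq_mul, mul_inv_cancel_left₀ hT0.ne']
    rw [← hpair, hW, hTJ, hTJ', ← mul_sub, abs_mul, abs_of_pos hT0] at h1
    refine le_of_mul_le_mul_left (h1.trans (le_of_eq ?_)) hT0
    have h2 : T = √T * √T := (Real.mul_self_sqrt hT0.le).symm
    have h3 : T / √T = √T := by rw [div_eq_iff hs.ne']; exact h2
    have h4 : c * T / √T = c * √T := by rw [mul_div_assoc, h3]
    rw [h4, mul_add, mul_div_left_comm, h3, mul_div_cancel₀ _ hT0.ne']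
    ring

lemma phiTilde_le_phi_T {T : ℝ} (hT : 0 < T) {J : Current d} (hJ : J ∈ divFree d) :
    PhiTilde γ J ≤ Phi_T γ T J := by
  rw [PhiTilde, if_pos hJ]
  exact iInf₂_le T hT

/-- The lower bound in the `Γ`-convergence. -/
theorem IsRegularDensity.le_liminf (hγ : IsRegularDensity γ κ) {J : Current d} {y : ℝ → Current d}
    (hy : Tendsto y atTop (𝓝 J)) : Phi γ J ≤ liminf (fun T => Phi_T γ T (y T)) atTop := by
  obtain ⟨C, hC0, hC⟩ := hγ.exists_divFree_approx
  by_contra! hlt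
  obtain ⟨c, hc0, hc1, hc2⟩ := ENNReal.lt_iff_exists_real_btwn.1 hlt
  have hfreq : ∃ᶠ T in atTop, Phi_T γ T (y T) < ENNReal.ofReal c := frequently_lt_of_liminf_lt
    (by isBoundedDefault) hc1
  set A : Set ℝ := {T | Phi_T γ T (y T) < ENNReal.ofReal c}
  -- Restricting `atTop` to the times of cost below c plays the role of a subsequence.
  set L : Filter ℝ := atTop ⊓ 𝓟 A
  have : NeBot L := frequently_mem_iff_neBot.1 hfreq
  have hLA : ∀ᶠ T in L, T ∈ A := mem_inf_of_right (mem_principal_self A)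
  have hLtop : L ≤ atTop := inf_le_left
  have hL2 : ∀ᶠ T in L, (2 : ℝ) ≤ T := (eventually_ge_atTop 2).filter_mono hLtop
  have hex : ∀ T, ∃ J' : Current d, T ∈ A → 2 ≤ T → J' ∈ divFree d ∧
      Phi_T γ T J' ≤ ENNReal.ofReal (c + C / T) ∧
        (∀ F, |pairL J' F| ≤ (c + C + d / 8) * ‖F‖) ∧
        ∀ (G : VField d) (D : C(UnitAddTorus (Fin d), ℝ)), IsCk 1 G → divergence G = D →
          |pairL J' G - pairL (y T) G| ≤
            (c + d / 4 * ‖G‖ ^ 2) / √T + (‖D‖ + d * ‖G‖) / T := fun T => by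
    by_cases h : T ∈ A ∧ 2 ≤ T
    · obtain ⟨J', h1, h2⟩ := hC T h.2 c hc0 (y T) h.1
      exact ⟨J', fun _ _ => ⟨h1, h2⟩⟩
    · exact ⟨0, fun h1 h2 => absurd ⟨h1, h2⟩ h⟩
  choose z hz using hex
  have hzlim : Tendsto z L (𝓝 J) := by
    refine tendsto_current_of_dense (B := c + C + d / 8) ?_ dense_hasHelmholtz fun G hG => ?_
    · filter_upwards [hLA, hL2] with T h1 h2 using (hz T h1 h2).2.2.1
    · have hT : Tendsto (fun T : ℝ => T) L atTop := hLtop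
      have h1 : Tendsto (fun T => (c + d / 4 * ‖G‖ ^ 2) / √T
          + (‖(⟨divergence G, hG.1.continuous_divergence⟩ : C(UnitAddTorus (Fin d), ℝ))‖
            + d * ‖G‖) / T) L (𝓝 0) := by
        simpa using ((Real.tendsto_sqrt_atTop.comp hT).const_div_atTop _).add
          (hT.const_div_atTop _)
      have h2 : Tendsto (fun T => pairL (z T) G - pairL (y T) G) L (𝓝 0) := by
        refine squeeze_zero_norm' ?_ h1
        filter_upwards [hLA, hL2] with T h3 h4
        exact (hz T h3 h4).2.2.2 G ⟨divergence G, hG.1.continuous_divergence⟩ hG.1 rfl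
      have h3 := h2.add ((tendsto_current_iff.1 hy G).mono_left hLtop)
      simpa using h3
  -- It remains to see Φ(J) ≤ c: each neighbourhood U of J eventually contains z T along L, and Φ̃(z
  -- T) ≤ c + C/T.
  refine hc2.not_ge ?_
  refine iSup₂_le fun U hU => ?_
  have hlim : Tendsto (fun T => ENNReal.ofReal (c + C / T)) L (𝓝 (ENNReal.ofReal c)) := by
    refine ENNReal.tendsto_ofReal ?_
    have hT : Tendsto (fun T : ℝ => T) L atTop := hLtop
    simpa using (hT.const_div_atTop C).const_add c
  refine ge_of_tendsto hlim ?_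
  filter_upwards [hLA, hL2, hzlim (hU.1.mem_nhds hU.2)] with T h1 h2 h3
  exact (iInf₂_le (z T) h3).trans ((phiTilde_le_phi_T (by linarith) (hz T h1 h2).1).trans
    (hz T h1 h2).2.1)

end

end CurrentLD

end

theorem proposition4p4 (d : ℕ) (γ : UnitAddTorus (Fin d) → ℝ)
    (hγ : CurrentLD.IsCk 2 γ)
    (hγ_bdd : ∃ δ : ℝ, 0 < δ ∧ ∀ u, δ ≤ γ u ∧ γ u ≤ 1 - δ) :
    CurrentLD.GammaConverges (fun T => CurrentLD.Phi_T γ T) (CurrentLD.Phi γ) := by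
  obtain ⟨κ, h⟩ := CurrentLD.exists_isRegularDensity hγ hγ_bdd
  exact fun J => ⟨fun _ hy => h.le_liminf hy, h.exists_recovery_family J⟩
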